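/- Let $M$ be a complete smooth $n$-dimensional Riemannian manifold, and let $\Omega\subset M$ be a bounded domain (a nonempty connected open bounded set; its boundary may be empty). Integrals over $\Omega$ are with respect to the Riemannian volume, $\nabla$ and $\Delta=\operatorname{div}\nabla$ are the gradient and the Laplacian of $M$, extended complex-linearly to complex-valued functions, and $|\nabla g|^2=|\nabla\operatorname{Re}g|^2+|\nabla\operatorname{Im}g|^2$. Let $\lambda_1\le\lambda_2\le\lambda_3\le\cdots$ be the eigenvalues, repeated according to multiplicity, of the Dirichlet problem $$\Delta u=-\lambda u\ \text{ in }\Omega,\qquad u=0\ \text{ on }\partial\Omega,$$ and let $\{u_j\}_{j\ge1}$ be a corresponding orthonormal basis of the real Hilbert space $L^2(\Omega)$ consisting of real eigenfunctions: $u_j$ is of class $C^2$ in $\Omega$ and satisfies $\Delta u_j=-\lambda_ju_j$ there, the boundary condition means $u_j\in H^1_0(\Omega)$, and $\int_\Omega u_iu_j=\delta_{ij}$. (If $\partial\Omega=\emptyset$, the enumeration begins with $\lambda_1=0$.) A function is in $C^3(\Omega)\cap C^2(\overline\Omega)$ if it is $C^3$ in $\Omega$ and its derivatives of order at most $2$ (in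 charts) extend continuously to $\overline\Omega$. Let $k>i\ge1$ be integers. Then the following hold, all the integrals being those of integrable functions. (1) For every complex-valued $g\in C^3(\Omega)\cap C^2(\overline\Omega)$, $$\big((\lambda_{k+1}-\lambda_i)+(\lambda_{k+2}-\lambda_i)\big)\int_\Omega|\nabla g|^2u_i^2\le\int_\Omega\big|2\nabla g\cdot\nabla u_i+u_i\Delta g\big|^2+(\lambda_{k+1}-\lambda_i)(\lambda_{k+2}-\lambda_i)\int_\Omega|gu_i|^2 .$$ (2) For every real-valued $f\in C^3(\Omega)\cap C^2(\overline\Omega)$, $$\big((\lambda_{k+2}-\lambda_i)+(\lambda_{k+1}-\lambda_i)\big)\int_\Omega|\nabla f|^2u_i^2\le2\sqrt{(\lambda_{k+2}-\lambda_i)(\lambda_{k+1}-\lambda_i)\int_\Omega|\nabla f|^4u_i^2}+\int_\Omega\big(2\nabla f\cdot\nabla u_i+u_i\Delta f\big)^2 .$$ (3) For every real-valued $f\in C^3(\Omega)\cap C^2(\overline\Omega)$ with $|\nabla f|^2=1$ in $\Omega$, $$(\lambda_{k+2}-\lambda_{k+1})^2\le16\Big(\int_\Omega(\nabla f\cdot\nabla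 u_i)^2-\tfrac14\int_\Omega(\Delta f)^2u_i^2-\tfrac12\int_\Omega(\nabla(\Delta f)\cdot\nabla f)\,u_i^2\Big)\lambda_{k+2},$$ and, with $Q_i=\lambda_i-\frac14\int_\Omega(\Delta f)^2u_i^2-\frac12\int_\Omega(\nabla(\Delta f)\cdot\nabla f)\,u_i^2$, one has $Q_i\ge0$, $$(\lambda_{k+2}-\lambda_{k+1})^2\le16\,Q_i\,\lambda_{k+2}\qquad\text{and}\qquad\lambda_{k+2}-\lambda_{k+1}\le4\,Q_i^{1/2}\sqrt{\lambda_{k+2}} .$$ -/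

import Mathlib

open Set Filter Topology MeasureTheory Bundle Manifold
open scoped ENNReal ContDiff

noncomputable section

namespace RiemDirichlet

/-- The model space `ℝⁿ` with its Euclidean structure. -/
abbrev Euc (n : ℕ) : Type := EuclideanSpace ℝ (Fin n)

section Geometry

variable {n : ℕ} {M : Type*} [MetricSpace M] [ChartedSpace (Euc n) M]
  [RiemannianBundle (fun x : M => TangentSpace (𝓡 n) x)]

/-- The coordinate vector field `∂ᵢ` of the chart `chartAt x₀`, at the point with
coordinates `y`. -/
def coordVec (x₀ : M) (y : Euc n) (i : Fin n) :
    TangentSpace (𝓡 n) ((chartAt (Euc n) x₀).symm y) :=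
  mfderiv (𝓡 n) (𝓡 n) (chartAt (Euc n) x₀).symm y (EuclideanSpace.single i (1 : ℝ))

/-- The matrix `g_{ij} = ⟨∂ᵢ, ∂ⱼ⟩` of the metric in the chart `chartAt x₀`, as a function of the
coordinates. -/
def gram (x₀ : M) (y : Euc n) : Matrix (Fin n) (Fin n) ℝ :=
  Matrix.of fun i j => inner ℝ (coordVec x₀ y i) (coordVec x₀ y j)

/-- The density `√(det g_{ij})` of the Riemannian volume in the chart `chartAt x₀`. -/
def volDensity (x₀ : M) (y : Euc n) : ℝ := Real.sqrt (gram x₀ y).det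

/-- The Riemannian volume of the domain of the chart `chartAt x₀`: the image of
`√(det g) dy` under the inverse of the chart (a measure on `M` carried by that domain). -/
def chartVolume [MeasurableSpace M] (x₀ : M) : Measure M :=
  (((volume : Measure (Euc n)).withDensity
    (fun y => ENNReal.ofReal (volDensity x₀ y))).restrict (chartAt (Euc n) x₀).target).map
    (chartAt (Euc n) x₀).symm

variable (n M) in
/-- The Riemannian volume measure, that is, the least measure which dominates
`√(det g) dy` in every chart `chartAt x₀`. As the measures `√(det g) dy` of two charts agree on the
overlap of their domains, its restriction to the domain of each chart is `√(det g) dy`. -/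
def riemVolume [MeasurableSpace M] : Measure M := ⨆ x₀ : M, chartVolume (n := n) x₀

instance (p : M) : FiniteDimensional ℝ (TangentSpace (𝓡 n) p) :=
  inferInstanceAs (FiniteDimensional ℝ (Euc n))

instance (p : M) : CompleteSpace (TangentSpace (𝓡 n) p) :=
  FiniteDimensional.complete ℝ _

variable (n) in
/-- The gradient of a real function: `⟨∇f, v⟩ = df(v)`. -/
def grad (f : M → ℝ) (p : M) : TangentSpace (𝓡 n) p :=
  (InnerProductSpace.toDual ℝ (TangentSpace (𝓡 n) p)).symm (mfderiv (𝓡 n) 𝓘(ℝ, ℝ) f p)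

/-- The partial derivative `∂ᵢ` of a function of the coordinates. -/
def partialDeriv (i : Fin n) (F : Euc n → ℝ) (y : Euc n) : ℝ :=
  fderiv ℝ F y (EuclideanSpace.single i (1 : ℝ))

/-- The Laplacian in the chart `chartAt x₀`, as a function of the coordinates:
`(det g)^{-1/2} ∑ᵢ ∂ᵢ ((det g)^{1/2} ∑ⱼ g^{ij} ∂ⱼ f)`. -/
def chartLaplacian (x₀ : M) (f : M → ℝ) (y : Euc n) : ℝ :=
  (volDensity x₀ y)⁻¹ * ∑ i, partialDeriv i (fun z => volDensity x₀ z *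
    ∑ j, (gram x₀ z)⁻¹ i j * partialDeriv j (fun w => f ((chartAt (Euc n) x₀).symm w)) z) y

variable (n) in
/-- The Laplacian `Δf = div ∇f`. At each point it is computed in the preferred chart there; the
value is the same in every chart. -/
def lap (f : M → ℝ) (p : M) : ℝ := chartLaplacian p f (chartAt (Euc n) p p)

variable (n) in
/-- `|∇g|²` for a complex-valued function `g`. -/
def cGradSq (g : M → ℂ) (p : M) : ℝ :=
  ‖grad n (fun x => (g x).re) p‖ ^ 2 + ‖grad n (fun x => (g x).im) p‖ ^ 2

variable (n) in
/-- `∇g · ∇u` for `g` complex-valued and `u` real-valued. -/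
def cGradDot (g : M → ℂ) (u : M → ℝ) (p : M) : ℂ :=
  ⟨inner ℝ (grad n (fun x => (g x).re) p) (grad n u p),
    inner ℝ (grad n (fun x => (g x).im) p) (grad n u p)⟩

variable (n) in
/-- `Δg` for a complex-valued function `g`. -/
def cLap (g : M → ℂ) (p : M) : ℂ :=
  ⟨lap n (fun x => (g x).re) p, lap n (fun x => (g x).im) p⟩

end Geometry

section Regularity

variable {n : ℕ} {M : Type*} [MetricSpace M] [ChartedSpace (Euc n) M]
  {F : Type*} [NormedAddCommGroup F] [NormedSpace ℝ F]

variable (n) in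
/-- The class `C³(Ω) ∩ C²(Ω̄)`: `g` is of class `C³` in the open set `Ω`, and its derivatives in
charts of order at most two extend continuously to the closure of `Ω`, i.e. they have a
(finite) limit, taken from within `Ω`, at each point of the closure. -/
structure C3C2Closure (Ω : Set M) (g : M → F) : Prop where
  contMDiffOn : ContMDiffOn (𝓡 n) 𝓘(ℝ, F) 3 g Ω
  limits : ∀ x₀ ∈ closure Ω, ∀ m : ℕ, m ≤ 2 →
    ∃ L, Tendsto (iteratedFDeriv ℝ m (fun y => g ((chartAt (Euc n) x₀).symm y)))
      (𝓝[(chartAt (Euc n) x₀).target ∩ (chartAt (Euc n) x₀).symm ⁻¹' Ω]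
        (chartAt (Euc n) x₀ x₀)) (𝓝 L)

end Regularity

section Dirichlet

variable {n : ℕ} {M : Type*} [MetricSpace M] [ChartedSpace (Euc n) M]
  [RiemannianBundle (fun x : M => TangentSpace (𝓡 n) x)]

variable (n) in
/-- Test functions: `C_c^∞(Ω)`. -/
structure IsTestFunction (Ω : Set M) (φ : M → ℝ) : Prop where
  smooth : ContMDiff (𝓡 n) 𝓘(ℝ, ℝ) ∞ φ
  compact : HasCompactSupport φ
  subset : tsupport φ ⊆ Ω

variable [MeasurableSpace M]

variable (n) in
/-- The boundary condition `u = 0` on `∂Ω`, for a function which is `C¹` in `Ω`, in the usual sense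
`u ∈ H¹₀(Ω)`: `u` is the limit, in the `H¹(Ω)`-norm, of functions of class `C_c^∞(Ω)`. -/
def VanishesOnBoundary (Ω : Set M) (u : M → ℝ) : Prop :=
  ∃ φ : ℕ → M → ℝ, (∀ m, IsTestFunction n Ω (φ m)) ∧
    Tendsto (fun m => ∫⁻ x in Ω, (‖u x - φ m x‖ₑ ^ 2 + ‖grad n u x - grad n (φ m) x‖ₑ ^ 2)
      ∂(riemVolume n M)) atTop (𝓝 0)

variable (n) in
/-- `u` solves the Dirichlet problem `Δu = -lam u` in `Ω`, `u = 0` on `∂Ω`. -/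
structure IsDirichletSolution (Ω : Set M) (lam : ℝ) (u : M → ℝ) : Prop where
  contMDiffOn : ContMDiffOn (𝓡 n) 𝓘(ℝ, ℝ) 2 u Ω
  equation : ∀ x ∈ Ω, lap n u x = -lam * u x
  boundary : VanishesOnBoundary n Ω u

variable (n) in
/-- `lam 1 ≤ lam 2 ≤ ⋯` are the Dirichlet eigenvalues of `Ω`, repeated according to
multiplicity, and `u 1, u 2, …` is a corresponding orthonormal basis of the real Hilbert space
`L²(Ω)` consisting of eigenfunctions. -/
structure IsDirichletEigensystem (Ω : Set M) (lam : ℕ+ → ℝ) (u : ℕ+ → M → ℝ) : Prop where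
  monotone : Monotone lam
  solution : ∀ j, IsDirichletSolution n Ω (lam j) (u j)
  orthonormal_basis : ∃ b : HilbertBasis ℕ+ ℝ (Lp ℝ 2 ((riemVolume n M).restrict Ω)),
    ∀ j, b j =ᵐ[(riemVolume n M).restrict Ω] u j

end Dirichlet

end RiemDirichlet

end

/-! Let `v = u i` and let `w = [Δ, g] v = 2 ∇g · ∇v + v Δg`. By Green's formula the coefficients of
`w` and of `g v` in the basis `u` are related by `⟨w, u j⟩ = (lam i - lam j) ⟨g v, u j⟩`, and
`-⟨w, g v⟩ = ∫ |∇g|² v²`. There is no eigenvalue strictly between two consecutive ones, so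
`(lam j - lam m) (lam j - lam (m + 1)) ≥ 0` for all `j`; summing this against `⟨g v, u j⟩²` gives
the first inequality. Applied to `g = exp (I s f)` it becomes a quadratic inequality in `s²`, whose
discriminant gives the second. When `|∇f| = 1`, the second controls the difference of
`√(lam (m + 1) - lam i)` and `√(lam m - lam i)`, and integrating `∫ |w|²` by parts gives the third.

On the analytic side, Hopf–Rinow makes the closure of `Ω` compact, so the derivatives of order at
most two are bounded. The term `∇(Δf) · ∇f` involves third derivatives, which need not be bounded;
differentiating `|∇f|² = 1` twice expresses the third derivatives of `f` along `∇f` through those of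
order at most two. -/

namespace RiemDirichlet

section Coordinates

variable {n : ℕ} {M : Type*} [MetricSpace M] [ChartedSpace (Euc n) M]

/-- The expression of a function in the coordinates of the chart `chartAt x₀`. -/
abbrev inChart (x₀ : M) (f : M → ℝ) : Euc n → ℝ := fun y => f ((chartAt (Euc n) x₀).symm y)

/-- The open set of coordinates which the part of `A` covered by the chart `chartAt x₀` occupies
when `A` is open. -/
def chartDom (x₀ : M) (A : Set M) : Set (Euc n) :=
  (chartAt (Euc n) x₀).target ∩ (chartAt (Euc n) x₀).symm ⁻¹' A

lemma isOpen_chartDom (x₀ : M) {A : Set M} (hA : IsOpen A) : IsOpen (chartDom (n := n) x₀ A) :=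
  (chartAt (Euc n) x₀).isOpen_inter_preimage_symm hA

lemma chart_mem_chartDom {x₀ p : M} {A : Set M} (hp : p ∈ (chartAt (Euc n) x₀).source)
    (hpA : p ∈ A) : chartAt (Euc n) x₀ p ∈ chartDom (n := n) x₀ A :=
  ⟨(chartAt (Euc n) x₀).map_source hp, by rwa [mem_preimage, (chartAt (Euc n) x₀).left_inv hp]⟩

variable [IsManifold (𝓡 n) 1 M]

lemma mdifferentiableAt_chart_symm (x₀ : M) {y : Euc n} (hy : y ∈ (chartAt (Euc n) x₀).target) :
    MDifferentiableAt (𝓡 n) (𝓡 n) (chartAt (Euc n) x₀).symm y :=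
  (mdifferentiable_chart (I := 𝓡 n) x₀).mdifferentiableAt_symm hy

/-- The coordinate frame `∂₁, …, ∂ₙ` as a basis of the tangent space. -/
noncomputable def coordBasis (x₀ : M) {y : Euc n} (hy : y ∈ (chartAt (Euc n) x₀).target) :
    Module.Basis (Fin n) ℝ (TangentSpace (𝓡 n) ((chartAt (Euc n) x₀).symm y)) :=
  (EuclideanSpace.basisFun (Fin n) ℝ).toBasis.map
    ((mdifferentiable_chart (I := 𝓡 n) x₀).symm.mfderiv hy).toLinearEquiv

lemma coe_coordBasis (x₀ : M) {y : Euc n} (hy : y ∈ (chartAt (Euc n) x₀).target) :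
    ⇑(coordBasis x₀ hy) = coordVec x₀ y :=
  funext fun i => congrArg (mfderiv (𝓡 n) (𝓡 n) (chartAt (Euc n) x₀).symm y)
    ((congrFun (EuclideanSpace.basisFun (Fin n) ℝ).coe_toBasis i).trans
      (EuclideanSpace.basisFun_apply _ _ i))

end Coordinates

section Metric

variable {n : ℕ} {M : Type*} [MetricSpace M] [ChartedSpace (Euc n) M]
  [RiemannianBundle (fun x : M => TangentSpace (𝓡 n) x)]

lemma gram_eq_matrixGram (x₀ : M) (y : Euc n) : gram x₀ y = Matrix.gram ℝ (coordVec x₀ y) := rfl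

lemma gram_inv_symm (x₀ : M) (y : Euc n) (i j : Fin n) :
    (gram x₀ y)⁻¹ i j = (gram x₀ y)⁻¹ j i := by
  rw [gram_eq_matrixGram]
  simpa using ((Matrix.isHermitian_gram ℝ (coordVec x₀ y)).inv.apply i j).symm

section C1

variable [IsManifold (𝓡 n) 1 M]

lemma gram_posDef (x₀ : M) {y : Euc n} (hy : y ∈ (chartAt (Euc n) x₀).target) :
    (gram x₀ y).PosDef :=
  Matrix.posDef_gram_of_linearIndependent (coe_coordBasis x₀ hy ▸
    (coordBasis x₀ hy).linearIndependent)

lemma det_gram_pos (x₀ : M) {y : Euc n} (hy : y ∈ (chartAt (Euc n) x₀).target) :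
    0 < (gram x₀ y).det := (gram_posDef x₀ hy).det_pos

lemma volDensity_pos (x₀ : M) {y : Euc n} (hy : y ∈ (chartAt (Euc n) x₀).target) :
    0 < volDensity x₀ y := Real.sqrt_pos.2 (det_gram_pos x₀ hy)

end C1

section Smooth

variable [IsManifold (𝓡 n) ∞ M]
  [IsContMDiffRiemannianBundle (𝓡 n) ∞ (Euc n) (fun x : M => TangentSpace (𝓡 n) x)]

lemma contDiffOn_gram (x₀ : M) (i j : Fin n) :
    ContDiffOn ℝ ∞ (fun y => gram x₀ y i j) (chartAt (Euc n) x₀).target := by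
  have hT := (chartAt (Euc n) x₀).open_target
  have contMDiffOn_coordVec : ∀ i : Fin n, ContMDiffOn (𝓡 n) ((𝓡 n).prod 𝓘(ℝ, Euc n)) ∞
      (fun y : Euc n => (⟨(chartAt (Euc n) x₀).symm y, coordVec x₀ y i⟩ :
        TotalSpace (Euc n) (fun x : M => TangentSpace (𝓡 n) x)))
      (chartAt (Euc n) x₀).target := fun i => by
    have htangent := (contMDiffOn_chart_symm (I := 𝓡 n) (n := ∞)
      (x := x₀)).contMDiffOn_tangentMapWithin (m := ∞) (by simp) hT.uniqueMDiffOn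
    have hconst : ContMDiff (𝓡 n) ((𝓡 n).prod 𝓘(ℝ, Euc n)) ∞
        (fun y : Euc n => (⟨y, EuclideanSpace.single i (1 : ℝ)⟩ : TangentBundle (𝓡 n) (Euc n))) :=
      fun y => contMDiffAt_vectorSpace_iff_contDiffAt.2 contDiffAt_const
    refine (htangent.comp hconst.contMDiffOn fun y hy => hy).congr fun y hy => ?_
    simp only [Function.comp, tangentMapWithin, mfderivWithin_of_isOpen hT hy]
    rfl
  exact contMDiffOn_iff_contDiffOn.1
    ((contMDiffOn_coordVec i).inner_bundle (IB := 𝓡 n) (contMDiffOn_coordVec j))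

lemma contDiffOn_det_gram (x₀ : M) :
    ContDiffOn ℝ ∞ (fun y => (gram x₀ y).det) (chartAt (Euc n) x₀).target := by
  simp only [Matrix.det_apply]
  exact ContDiffOn.sum fun σ _ => (contDiffOn_prod fun i _ => contDiffOn_gram x₀ _ _).const_smul _

lemma contDiffOn_volDensity (x₀ : M) :
    ContDiffOn ℝ ∞ (volDensity x₀) (chartAt (Euc n) x₀).target :=
  (contDiffOn_det_gram x₀).sqrt fun _ hy => (det_gram_pos x₀ hy).ne'

lemma contDiffOn_gram_inv (x₀ : M) (i j : Fin n) :
    ContDiffOn ℝ ∞ (fun y => (gram x₀ y)⁻¹ i j) (chartAt (Euc n) x₀).target := by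
  have hadjugate : ContDiffOn ℝ ∞ (fun y => (gram x₀ y).adjugate i j)
      (chartAt (Euc n) x₀).target := by
    simp only [Matrix.adjugate_apply, Matrix.det_apply]
    refine ContDiffOn.sum fun σ _ => (contDiffOn_prod fun k _ => ?_).const_smul _
    by_cases hk : σ k = j
    · simp only [hk, Matrix.updateRow_self]
      exact contDiffOn_const
    · simp only [Matrix.updateRow_ne hk]
      exact contDiffOn_gram x₀ _ _
  simp only [Matrix.inv_def, Matrix.smul_apply, smul_eq_mul, Ring.inverse_eq_inv']
  exact ((contDiffOn_det_gram x₀).inv fun y hy => (det_gram_pos x₀ hy).ne').mul hadjugate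

end Smooth

end Metric

section Gradient

variable {n : ℕ} {M : Type*} [MetricSpace M] [ChartedSpace (Euc n) M]
  [RiemannianBundle (fun x : M => TangentSpace (𝓡 n) x)]

lemma inner_grad_left (f : M → ℝ) (p : M) (v : TangentSpace (𝓡 n) p) :
    inner ℝ (grad n f p) v = (show ℝ from mfderiv (𝓡 n) 𝓘(ℝ, ℝ) f p v) :=
  InnerProductSpace.toDual_symm_apply (𝕜 := ℝ) (E := TangentSpace (𝓡 n) p)

lemma grad_add {f h : M → ℝ} {p : M} (hf : MDifferentiableAt (𝓡 n) 𝓘(ℝ, ℝ) f p)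
    (hh : MDifferentiableAt (𝓡 n) 𝓘(ℝ, ℝ) h p) :
    grad n (fun x => f x + h x) p = grad n f p + grad n h p := by
  refine ext_inner_right ℝ fun v => ?_
  rw [inner_add_left, inner_grad_left, inner_grad_left, inner_grad_left]
  exact DFunLike.congr_fun (hf.hasMFDerivAt.add hh.hasMFDerivAt).mfderiv v

lemma grad_sub {f h : M → ℝ} {p : M} (hf : MDifferentiableAt (𝓡 n) 𝓘(ℝ, ℝ) f p)
    (hh : MDifferentiableAt (𝓡 n) 𝓘(ℝ, ℝ) h p) :
    grad n (fun x => f x - h x) p = grad n f p - grad n h p := by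
  refine ext_inner_right ℝ fun v => ?_
  rw [inner_sub_left, inner_grad_left, inner_grad_left, inner_grad_left]
  exact DFunLike.congr_fun (hf.hasMFDerivAt.sub hh.hasMFDerivAt).mfderiv v

lemma grad_mul {f h : M → ℝ} {p : M} (hf : MDifferentiableAt (𝓡 n) 𝓘(ℝ, ℝ) f p)
    (hh : MDifferentiableAt (𝓡 n) 𝓘(ℝ, ℝ) h p) :
    grad n (fun x => f x * h x) p = f p • grad n h p + h p • grad n f p := by
  refine ext_inner_right ℝ fun v => ?_
  rw [inner_add_left, real_inner_smul_left, real_inner_smul_left, inner_grad_left,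
    inner_grad_left, inner_grad_left]
  exact DFunLike.congr_fun (hf.hasMFDerivAt.mul hh.hasMFDerivAt).mfderiv v

lemma grad_comp {θ : ℝ → ℝ} {f : M → ℝ} {p : M} (hf : MDifferentiableAt (𝓡 n) 𝓘(ℝ, ℝ) f p)
    (hθ : DifferentiableAt ℝ θ (f p)) :
    grad n (fun x => θ (f x)) p = deriv θ (f p) • grad n f p := by
  refine ext_inner_right ℝ fun v => ?_
  rw [real_inner_smul_left, inner_grad_left, inner_grad_left]
  have hchain := mfderiv_comp p hθ.mdifferentiableAt hf
  rw [mfderiv_eq_fderiv] at hchain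
  refine (DFunLike.congr_fun hchain v).trans ?_
  exact (fderiv_eq_smul_deriv (f := θ) (x := f p) _).trans (mul_comm _ _)

lemma grad_congr {f h : M → ℝ} {p : M} (hfh : f =ᶠ[𝓝 p] h) : grad n f p = grad n h p := by
  refine ext_inner_right ℝ fun v => ?_
  rw [inner_grad_left, inner_grad_left]
  exact DFunLike.congr_fun (hfh.mfderiv_eq (I := 𝓡 n) (I' := 𝓘(ℝ, ℝ))) v

lemma grad_const (c : ℝ) (p : M) : grad n (fun _ : M => c) p = 0 := by
  refine ext_inner_right ℝ fun v => ?_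
  rw [inner_grad_left, inner_zero_left]
  exact DFunLike.congr_fun (mfderiv_const (I := 𝓡 n) (I' := 𝓘(ℝ, ℝ)) (c := c)) v

lemma grad_eq_zero_of_notMem_tsupport {f : M → ℝ} {p : M} (hp : p ∉ tsupport f) :
    grad n f p = 0 := by
  rw [grad_congr (notMem_tsupport_iff_eventuallyEq.1 hp)]
  exact grad_const 0 p

lemma grad_sum {ι : Type*} (s : Finset ι) {f : ι → M → ℝ} {p : M}
    (hf : ∀ i ∈ s, MDifferentiableAt (𝓡 n) 𝓘(ℝ, ℝ) (f i) p) :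
    grad n (fun x => ∑ i ∈ s, f i x) p = ∑ i ∈ s, grad n (f i) p := by
  classical
  suffices h : MDifferentiableAt (𝓡 n) 𝓘(ℝ, ℝ) (fun x => ∑ i ∈ s, f i x) p ∧
      grad n (fun x => ∑ i ∈ s, f i x) p = ∑ i ∈ s, grad n (f i) p from h.2
  induction s using Finset.induction_on with
  | empty => exact ⟨mdifferentiableAt_const, grad_const 0 p⟩
  | insert a s ha ih =>
    obtain ⟨hsum, hgrad⟩ := ih fun i hi => hf i (Finset.mem_insert_of_mem hi)
    have hfa := hf a (Finset.mem_insert_self a s)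
    simp only [Finset.sum_insert ha]
    exact ⟨hfa.add hsum, by rw [grad_add hfa hsum, hgrad]⟩

/-- The component `∑ⱼ gⁱʲ ∂ⱼf` of `∇f` along `∂ᵢ` in the chart `chartAt x₀`, as a function of the
coordinates. -/
noncomputable def gradCoord (x₀ : M) (f : M → ℝ) (i : Fin n) (y : Euc n) : ℝ :=
  ∑ j, (gram x₀ y)⁻¹ i j * partialDeriv j (inChart x₀ f) y

variable [IsManifold (𝓡 n) 1 M]

lemma partialDeriv_inChart (x₀ : M) {y : Euc n} (hy : y ∈ (chartAt (Euc n) x₀).target) {f : M → ℝ}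
    (hf : MDifferentiableAt (𝓡 n) 𝓘(ℝ, ℝ) f ((chartAt (Euc n) x₀).symm y)) (i : Fin n) :
    partialDeriv i (inChart x₀ f) y =
      inner ℝ (grad n f ((chartAt (Euc n) x₀).symm y)) (coordVec x₀ y i) := by
  have hchain := mfderiv_comp y hf (mdifferentiableAt_chart_symm x₀ hy)
  rw [mfderiv_eq_fderiv] at hchain
  rw [inner_grad_left]
  exact DFunLike.congr_fun hchain (EuclideanSpace.single i 1)

lemma grad_eq_sum_gradCoord (x₀ : M) {y : Euc n} (hy : y ∈ (chartAt (Euc n) x₀).target)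
    {f : M → ℝ} (hf : MDifferentiableAt (𝓡 n) 𝓘(ℝ, ℝ) f ((chartAt (Euc n) x₀).symm y)) :
    grad n f ((chartAt (Euc n) x₀).symm y) = ∑ i, gradCoord x₀ f i y • coordVec x₀ y i := by
  set a := (coordBasis x₀ hy).repr (grad n f ((chartAt (Euc n) x₀).symm y))
  have hgrad : ∑ i, a i • coordVec x₀ y i = grad n f ((chartAt (Euc n) x₀).symm y) := by
    simpa only [coe_coordBasis] using (coordBasis x₀ hy).sum_repr _
  have hpartial : (fun i => partialDeriv i (inChart x₀ f) y) = (gram x₀ y).mulVec a := by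
    ext i
    rw [partialDeriv_inChart x₀ hy hf, ← hgrad, sum_inner]
    refine Finset.sum_congr rfl fun j _ => ?_
    rw [real_inner_smul_left, real_inner_comm, mul_comm]
    rfl
  have hcoord : (fun i => gradCoord x₀ f i y) = a := by
    change (gram x₀ y)⁻¹.mulVec (fun j => partialDeriv j (inChart x₀ f) y) = a
    rw [hpartial, Matrix.mulVec_mulVec, Matrix.nonsing_inv_mul _ (det_gram_pos x₀ hy).ne'.isUnit,
      Matrix.one_mulVec]
  rw [← hgrad]
  exact Finset.sum_congr rfl fun i _ => by rw [← hcoord]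

lemma inner_grad_inChart (x₀ : M) {y : Euc n} (hy : y ∈ (chartAt (Euc n) x₀).target) {f h : M → ℝ}
    (hf : MDifferentiableAt (𝓡 n) 𝓘(ℝ, ℝ) f ((chartAt (Euc n) x₀).symm y))
    (hh : MDifferentiableAt (𝓡 n) 𝓘(ℝ, ℝ) h ((chartAt (Euc n) x₀).symm y)) :
    inner ℝ (grad n f ((chartAt (Euc n) x₀).symm y)) (grad n h ((chartAt (Euc n) x₀).symm y)) =
      ∑ i, partialDeriv i (inChart x₀ f) y * gradCoord x₀ h i y := by
  rw [grad_eq_sum_gradCoord x₀ hy hh, inner_sum]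
  exact Finset.sum_congr rfl fun i _ => by
    rw [real_inner_smul_right, partialDeriv_inChart x₀ hy hf, mul_comm]

lemma norm_grad_inChart_sq (x₀ : M) {y : Euc n} (hy : y ∈ (chartAt (Euc n) x₀).target) {f : M → ℝ}
    (hf : MDifferentiableAt (𝓡 n) 𝓘(ℝ, ℝ) f ((chartAt (Euc n) x₀).symm y)) :
    ‖grad n f ((chartAt (Euc n) x₀).symm y)‖ ^ 2 = ∑ i, ∑ j, (gram x₀ y)⁻¹ i j *
      (partialDeriv j (inChart x₀ f) y * partialDeriv i (inChart x₀ f) y) := by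
  rw [← real_inner_self_eq_norm_sq, inner_grad_inChart x₀ hy hf hf]
  simp only [gradCoord, Finset.mul_sum]
  exact Finset.sum_congr rfl fun i _ => Finset.sum_congr rfl fun j _ => by ring

end Gradient

section Volume

variable {n : ℕ} {M : Type*} [MetricSpace M] [ChartedSpace (Euc n) M]

/-- The change of coordinates from `chartAt x₀` to `chartAt x₁`. -/
def chartTransition (x₀ x₁ : M) : OpenPartialHomeomorph (Euc n) (Euc n) :=
  (chartAt (Euc n) x₀).symm ≫ₕ chartAt (Euc n) x₁

lemma image_chartTransition_chartDom {x₀ x₁ : M} {A : Set M}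
    (h₀ : A ⊆ (chartAt (Euc n) x₀).source) (h₁ : A ⊆ (chartAt (Euc n) x₁).source) :
    chartTransition x₀ x₁ '' chartDom x₀ A = chartDom (n := n) x₁ A := by
  ext z
  constructor
  · rintro ⟨y, ⟨-, hyA⟩, rfl⟩
    exact chart_mem_chartDom (h₁ hyA) hyA
  · rintro ⟨hz, hzA⟩
    refine ⟨_, chart_mem_chartDom (h₀ hzA) hzA, ?_⟩
    simp only [chartTransition, OpenPartialHomeomorph.coe_trans, Function.comp_apply,
      (chartAt (Euc n) x₀).left_inv (h₀ hzA), (chartAt (Euc n) x₁).right_inv hz]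

section C1

variable [IsManifold (𝓡 n) 1 M]

lemma differentiableAt_chartTransition {x₀ x₁ : M} {y : Euc n}
    (hy : y ∈ (chartTransition x₀ x₁).source) :
    DifferentiableAt ℝ (chartTransition x₀ x₁) y := by
  rw [chartTransition, OpenPartialHomeomorph.trans_source] at hy
  exact (((mdifferentiable_chart (I := 𝓡 n) x₁).mdifferentiableAt hy.2).comp y
    (mdifferentiableAt_chart_symm x₀ hy.1)).differentiableAt

lemma coordVec_eq_mfderiv_chartTransition {x₀ x₁ : M} {y : Euc n}
    (hy : y ∈ (chartTransition x₀ x₁).source) (i : Fin n) :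
    coordVec x₀ y i = mfderiv (𝓡 n) (𝓡 n) (chartAt (Euc n) x₁).symm (chartTransition x₀ x₁ y)
      (fderiv ℝ (chartTransition x₀ x₁) y (EuclideanSpace.single i 1)) := by
  have heq : (chartAt (Euc n) x₀).symm =ᶠ[𝓝 y]
      (chartAt (Euc n) x₁).symm ∘ chartTransition x₀ x₁ := by
    filter_upwards [(chartTransition x₀ x₁).open_source.mem_nhds hy] with z hz
    rw [chartTransition, OpenPartialHomeomorph.trans_source] at hz
    exact ((chartAt (Euc n) x₁).left_inv hz.2).symm
  have htarget : chartTransition x₀ x₁ y ∈ (chartAt (Euc n) x₁).target := by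
    rw [chartTransition, OpenPartialHomeomorph.trans_source] at hy
    exact (chartAt (Euc n) x₁).map_source hy.2
  have hchain := mfderiv_comp y (mdifferentiableAt_chart_symm x₁ htarget)
    (differentiableAt_chartTransition hy).mdifferentiableAt
  rw [mfderiv_eq_fderiv] at hchain
  exact DFunLike.congr_fun ((heq.mfderiv_eq (I := 𝓡 n) (I' := 𝓡 n)).trans hchain) _

variable [RiemannianBundle (fun x : M => TangentSpace (𝓡 n) x)]

lemma gram_eq_jacobian_mul_gram_mul {x₀ x₁ : M} {y : Euc n}
    (hy : y ∈ (chartTransition x₀ x₁).source) :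
    let b := (EuclideanSpace.basisFun (Fin n) ℝ).toBasis
    let J := LinearMap.toMatrix b b (fderiv ℝ (chartTransition x₀ x₁) y : Euc n →ₗ[ℝ] Euc n)
    gram x₀ y = J.transpose * gram x₁ (chartTransition x₀ x₁ y) * J := by
  intro b J
  set z := chartTransition x₀ x₁ y with hz
  have hpoint : (chartAt (Euc n) x₁).symm z = (chartAt (Euc n) x₀).symm y := by
    rw [chartTransition, OpenPartialHomeomorph.trans_source] at hy
    exact (chartAt (Euc n) x₁).left_inv hy.2
  have hcoordVec (i : Fin n) : coordVec x₀ y i = ∑ k, J k i • coordVec x₁ z k := by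
    have hcol : fderiv ℝ (chartTransition x₀ x₁) y (EuclideanSpace.single i 1) =
        ∑ k, J k i • EuclideanSpace.single k (1 : ℝ) := by
      ext l
      simp [J, b, LinearMap.toMatrix_apply, Pi.single_apply]
    rw [coordVec_eq_mfderiv_chartTransition hy, hcol]
    exact (map_sum _ _ _).trans (Finset.sum_congr rfl fun k _ => map_smul _ _ _)
  have hinner (v w : Euc n) :
      (inner ℝ (show TangentSpace (𝓡 n) ((chartAt (Euc n) x₀).symm y) from v)
        (show TangentSpace (𝓡 n) ((chartAt (Euc n) x₀).symm y) from w) : ℝ) =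
      inner ℝ (show TangentSpace (𝓡 n) ((chartAt (Euc n) x₁).symm z) from v)
        (show TangentSpace (𝓡 n) ((chartAt (Euc n) x₁).symm z) from w) := by
    rw [hpoint]
  ext i j
  refine (hinner _ _).trans ?_
  rw [hcoordVec i, hcoordVec j, Matrix.mul_assoc]
  exact (Matrix.star_dotProduct_gram_mulVec (𝕜 := ℝ) (coordVec x₁ z) (fun k => J k i)
    fun k => J k j).symm

lemma volDensity_chartTransition {x₀ x₁ : M} {y : Euc n}
    (hy : y ∈ (chartTransition x₀ x₁).source) :
    volDensity x₀ y = |(fderiv ℝ (chartTransition x₀ x₁) y).det| *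
      volDensity x₁ (chartTransition x₀ x₁ y) := by
  set J := fderiv ℝ (chartTransition x₀ x₁) y with hJ
  have hdet : (gram x₀ y).det = J.det ^ 2 * (gram x₁ (chartTransition x₀ x₁ y)).det := by
    rw [gram_eq_jacobian_mul_gram_mul hy, Matrix.det_mul, Matrix.det_mul, Matrix.det_transpose,
      LinearMap.det_toMatrix, ← hJ, ContinuousLinearMap.det]
    ring
  rw [volDensity, volDensity, hdet, Real.sqrt_mul (sq_nonneg _), Real.sqrt_sq_eq_abs]

end C1

section Measurability

variable [MeasurableSpace M] [BorelSpace M]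

lemma aemeasurable_chart_symm (x₀ : M) (μ : Measure (Euc n)) :
    AEMeasurable (chartAt (Euc n) x₀).symm (μ.restrict (chartAt (Euc n) x₀).target) :=
  (chartAt (Euc n) x₀).continuousOn_symm.aemeasurable
    (chartAt (Euc n) x₀).open_target.measurableSet

lemma measurableSet_chartDom (x₀ : M) {A : Set M} (hA : MeasurableSet A) :
    MeasurableSet (chartDom (n := n) x₀ A) := by
  rw [chartDom, ← Subtype.image_preimage_coe]
  exact (chartAt (Euc n) x₀).open_target.measurableSet.subtype_image
    ((chartAt (Euc n) x₀).continuousOn_symm.domRestrict.measurable hA)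

variable [RiemannianBundle (fun x : M => TangentSpace (𝓡 n) x)]

lemma chartVolume_apply (x₀ : M) {A : Set M} (hA : MeasurableSet A) :
    chartVolume (n := n) x₀ A =
      ∫⁻ y in chartDom (n := n) x₀ A, ENNReal.ofReal (volDensity x₀ y) := by
  rw [chartVolume, Measure.map_apply_of_aemeasurable (aemeasurable_chart_symm x₀ _) hA,
    Measure.restrict_apply₀' (chartAt (Euc n) x₀).open_target.measurableSet.nullMeasurableSet,
    inter_comm]
  exact withDensity_apply _ (measurableSet_chartDom x₀ hA)

lemma chartVolume_compl_source (x₀ : M) :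
    chartVolume (n := n) x₀ (chartAt (Euc n) x₀).sourceᶜ = 0 := by
  have hempty : chartDom x₀ (chartAt (Euc n) x₀).sourceᶜ = ∅ :=
    eq_empty_of_forall_notMem fun y hy => hy.2 ((chartAt (Euc n) x₀).map_target hy.1)
  rw [chartVolume_apply x₀ (chartAt (Euc n) x₀).open_source.measurableSet.compl, hempty,
    Measure.restrict_empty, lintegral_zero_measure]

lemma chartVolume_restrict_source (x₀ : M) :
    (chartVolume (n := n) x₀).restrict (chartAt (Euc n) x₀).source = chartVolume (n := n) x₀ :=
  Measure.restrict_eq_self_of_ae_mem (chartVolume_compl_source x₀)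

section C1

variable [IsManifold (𝓡 n) 1 M]

lemma chartVolume_eq_of_subset {x₀ x₁ : M} {A : Set M} (hA : MeasurableSet A)
    (h₀ : A ⊆ (chartAt (Euc n) x₀).source) (h₁ : A ⊆ (chartAt (Euc n) x₁).source) :
    chartVolume (n := n) x₁ A = chartVolume (n := n) x₀ A := by
  have hsource : chartDom x₀ A ⊆ (chartTransition (n := n) x₀ x₁).source := fun y hy => by
    rw [chartTransition, OpenPartialHomeomorph.trans_source]
    exact ⟨hy.1, h₁ hy.2⟩
  have hB := measurableSet_chartDom (n := n) x₀ hA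
  rw [chartVolume_apply x₀ hA, chartVolume_apply x₁ hA, ← image_chartTransition_chartDom h₀ h₁,
    lintegral_image_eq_lintegral_abs_det_fderiv_mul volume hB (fun y hy =>
      (differentiableAt_chartTransition (hsource hy)).hasFDerivAt.hasFDerivWithinAt)
      ((chartTransition x₀ x₁).injOn.mono hsource)]
  refine setLIntegral_congr_fun hB fun y hy => ?_
  rw [← ENNReal.ofReal_mul (abs_nonneg _), ← volDensity_chartTransition (hsource hy)]

lemma chartVolume_restrict_source_le (x₀ x₁ : M) :
    (chartVolume (n := n) x₁).restrict (chartAt (Euc n) x₀).source ≤ chartVolume (n := n) x₀ := by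
  have hS₀ := (chartAt (Euc n) x₀).open_source.measurableSet
  have hS₁ := (chartAt (Euc n) x₁).open_source.measurableSet
  refine Measure.le_iff.2 fun A hA => ?_
  rw [Measure.restrict_apply hA, ← chartVolume_restrict_source x₁,
    Measure.restrict_apply (hA.inter hS₀), chartVolume_eq_of_subset (x₀ := x₀)
      ((hA.inter hS₀).inter hS₁) (fun p hp => hp.1.2) (fun p hp => hp.2)]
  exact measure_mono fun p hp => hp.1.1

lemma riemVolume_restrict_source (x₀ : M) :
    (riemVolume n M).restrict (chartAt (Euc n) x₀).source = chartVolume (n := n) x₀ := by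
  have hS := (chartAt (Euc n) x₀).open_source.measurableSet
  apply le_antisymm
  · have hle : riemVolume n M ≤
        (riemVolume n M).restrict (chartAt (Euc n) x₀).sourceᶜ + chartVolume (n := n) x₀ := by
      refine iSup_le fun x₁ => ?_
      rw [← Measure.restrict_compl_add_restrict (μ := chartVolume (n := n) x₁) hS]
      exact add_le_add (Measure.restrict_mono le_rfl (le_iSup _ x₁))
        (chartVolume_restrict_source_le x₀ x₁)
    refine (Measure.restrict_mono le_rfl hle).trans ?_
    rw [Measure.restrict_add, Measure.restrict_restrict hS, inter_compl_self,
      Measure.restrict_empty, zero_add, chartVolume_restrict_source]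
  · rw [← chartVolume_restrict_source x₀]
    exact Measure.restrict_mono le_rfl (le_iSup (fun x₁ => chartVolume (n := n) x₁) x₀)

lemma riemVolume_restrict_of_subset_source (x₀ : M) {A : Set M} (hA : MeasurableSet A)
    (hAS : A ⊆ (chartAt (Euc n) x₀).source) :
    (riemVolume n M).restrict A = (chartVolume (n := n) x₀).restrict A := by
  rw [← riemVolume_restrict_source, Measure.restrict_restrict hA, inter_eq_left.2 hAS]

end C1

section Smooth

variable [IsManifold (𝓡 n) ∞ M]
  [IsContMDiffRiemannianBundle (𝓡 n) ∞ (Euc n) (fun x : M => TangentSpace (𝓡 n) x)]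

instance : IsLocallyFiniteMeasure (riemVolume n M) := by
  refine ⟨fun p => ?_⟩
  set c := chartAt (Euc n) p with hc
  obtain ⟨r, hr, hrT⟩ := Metric.nhds_basis_closedBall.mem_iff.1
    (c.open_target.mem_nhds (mem_chart_target _ p))
  set U := c.source ∩ c ⁻¹' Metric.ball (c p) r
  have hU : IsOpen U := c.isOpen_inter_preimage Metric.isOpen_ball
  refine ⟨U, hU.mem_nhds ⟨mem_chart_source _ p, Metric.mem_ball_self hr⟩, ?_⟩
  have hball : chartDom p U ⊆ Metric.closedBall (c p) r := by
    rintro y ⟨hy, -, hyr⟩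
    rw [mem_preimage, ← hc, c.right_inv hy] at hyr
    exact Metric.ball_subset_closedBall hyr
  have hintegrable : IntegrableOn (volDensity p) (Metric.closedBall (c p) r) :=
    ((contDiffOn_volDensity p).continuousOn.mono hrT).integrableOn_compact
      (isCompact_closedBall _ _)
  rw [← Measure.restrict_apply_self, riemVolume_restrict_of_subset_source p hU.measurableSet
    inter_subset_left, Measure.restrict_apply_self, chartVolume_apply p hU.measurableSet]
  exact (lintegral_mono_set hball).trans_lt hintegrable.lintegral_lt_top

lemma setIntegral_eq_setIntegral_chartDom (x₀ : M) {f : M → ℝ} {A : Set M} (hA : MeasurableSet A)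
    (hAS : A ⊆ (chartAt (Euc n) x₀).source)
    (hf : AEStronglyMeasurable f ((riemVolume n M).restrict A)) :
    ∫ x in A, f x ∂(riemVolume n M) =
      ∫ y in chartDom (n := n) x₀ A, volDensity x₀ y * inChart x₀ f y := by
  have hB := measurableSet_chartDom (n := n) x₀ hA
  have hdensity : AEMeasurable (fun y => ENNReal.ofReal (volDensity x₀ y))
      (volume.restrict (chartDom x₀ A)) :=
    (((contDiffOn_volDensity x₀).continuousOn.mono inter_subset_left).aemeasurable
      hB).ennreal_ofReal
  have hsymm : AEMeasurable (chartAt (Euc n) x₀).symm ((volume.restrict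
      (chartDom x₀ A)).withDensity fun y => ENNReal.ofReal (volDensity x₀ y)) := by
    rw [← restrict_withDensity hB]
    exact ((chartAt (Euc n) x₀).continuousOn_symm.mono inter_subset_left).aemeasurable hB
  have hmap : (riemVolume n M).restrict A = ((volume.restrict (chartDom x₀ A)).withDensity
      fun y => ENNReal.ofReal (volDensity x₀ y)).map (chartAt (Euc n) x₀).symm := by
    ext D hD
    rw [riemVolume_restrict_of_subset_source x₀ hA hAS, Measure.restrict_apply hD,
      chartVolume_apply x₀ (hD.inter hA), Measure.map_apply_of_aemeasurable hsymm hD,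
      ← restrict_withDensity hB, Measure.restrict_apply₀' hB.nullMeasurableSet, withDensity_apply']
    congr 2
    ext y
    simp only [chartDom, mem_inter_iff, mem_preimage]
    tauto
  rw [hmap] at hf ⊢
  rw [integral_map hsymm hf, integral_withDensity_eq_integral_toReal_smul₀ hdensity (by simp)]
  refine setIntegral_congr_fun hB fun y hy => ?_
  simp only [smul_eq_mul, ENNReal.toReal_ofReal (volDensity_pos x₀ hy.1).le]

end Smooth

end Measurability

end Volume

section ChartCalculus

variable {n : ℕ}

lemma contDiffOn_partialDeriv {O : Set (Euc n)} (hO : IsOpen O) {F : Euc n → ℝ}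
    {k l : WithTop ℕ∞} (hF : ContDiffOn ℝ l F O) (hk : k + 1 ≤ l) (i : Fin n) :
    ContDiffOn ℝ k (partialDeriv i F) O :=
  (hF.fderiv_of_isOpen hO hk).clm_apply contDiffOn_const

lemma partialDeriv_congr {F H : Euc n → ℝ} {y : Euc n} (h : F =ᶠ[𝓝 y] H) (i : Fin n) :
    partialDeriv i F y = partialDeriv i H y := by
  rw [partialDeriv, partialDeriv, h.fderiv_eq]

lemma partialDeriv_mul {F H : Euc n → ℝ} {y : Euc n} (hF : DifferentiableAt ℝ F y)
    (hH : DifferentiableAt ℝ H y) (i : Fin n) :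
    partialDeriv i (fun z => F z * H z) y =
      F y * partialDeriv i H y + H y * partialDeriv i F y := by
  simp only [partialDeriv, fderiv_fun_mul hF hH, add_apply,
    smul_apply, smul_eq_mul]

lemma partialDeriv_sum {ι : Type*} (s : Finset ι) {F : ι → Euc n → ℝ} {y : Euc n}
    (hF : ∀ j ∈ s, DifferentiableAt ℝ (F j) y) (i : Fin n) :
    partialDeriv i (fun z => ∑ j ∈ s, F j z) y = ∑ j ∈ s, partialDeriv i (F j) y := by
  simp only [partialDeriv, fderiv_fun_sum hF, sum_apply]

lemma partialDeriv_comp {θ : ℝ → ℝ} {F : Euc n → ℝ} {y : Euc n} (hF : DifferentiableAt ℝ F y)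
    (hθ : DifferentiableAt ℝ θ (F y)) (i : Fin n) :
    partialDeriv i (fun z => θ (F z)) y = deriv θ (F y) * partialDeriv i F y := by
  rw [partialDeriv, partialDeriv, fderiv_fun_comp y hθ hF, ContinuousLinearMap.comp_apply,
    fderiv_eq_smul_deriv, smul_eq_mul, mul_comm]

variable {M : Type*} [MetricSpace M] [ChartedSpace (Euc n) M]

lemma mdifferentiableAt_of_contMDiffOn {A : Set M} (hA : IsOpen A) {f : M → ℝ} {k : WithTop ℕ∞}
    (hk : k ≠ 0) (hf : ContMDiffOn (𝓡 n) 𝓘(ℝ, ℝ) k f A) {p : M} (hp : p ∈ A) :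
    MDifferentiableAt (𝓡 n) 𝓘(ℝ, ℝ) f p :=
  (hf.contMDiffAt (hA.mem_nhds hp)).mdifferentiableAt hk

section Regularity

variable [IsManifold (𝓡 n) ∞ M]

lemma contDiffOn_comp_chartAt_symm (x₀ : M) {A : Set M} {E : Type*} [NormedAddCommGroup E]
    [NormedSpace ℝ E] {f : M → E} {k : WithTop ℕ∞} (hk : k ≤ (∞ : WithTop ℕ∞))
    (hf : ContMDiffOn (𝓡 n) 𝓘(ℝ, E) k f A) :
    ContDiffOn ℝ k (f ∘ (chartAt (Euc n) x₀).symm) (chartDom (n := n) x₀ A) :=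
  contMDiffOn_iff_contDiffOn.1 (hf.comp (((contMDiffOn_chart_symm (I := 𝓡 n) (n := ∞)
    (x := x₀)).of_le hk).mono inter_subset_left) fun _ hy => hy.2)

lemma contDiffOn_inChart (x₀ : M) {A : Set M} {f : M → ℝ} {k : WithTop ℕ∞}
    (hk : k ≤ (∞ : WithTop ℕ∞)) (hf : ContMDiffOn (𝓡 n) 𝓘(ℝ, ℝ) k f A) :
    ContDiffOn ℝ k (inChart x₀ f) (chartDom (n := n) x₀ A) :=
  contDiffOn_comp_chartAt_symm x₀ hk hf

lemma contMDiffOn_of_inChart {A : Set M} (hA : IsOpen A) {f : M → ℝ} {k : WithTop ℕ∞}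
    (hk : k ≤ (∞ : WithTop ℕ∞))
    (hf : ∀ x₀ ∈ A, ContDiffOn ℝ k (inChart x₀ f) (chartDom (n := n) x₀ A)) :
    ContMDiffOn (𝓡 n) 𝓘(ℝ, ℝ) k f A := by
  intro p hp
  have hcomp := (hf p hp).contMDiffOn.comp (t := chartDom p A)
    (s := (chartAt (Euc n) p).source ∩ A)
    (((contMDiffOn_chart (I := 𝓡 n) (n := ∞) (x := p)).of_le hk).mono inter_subset_left)
    fun q hq => chart_mem_chartDom hq.1 hq.2
  have hsource : ContMDiffOn (𝓡 n) 𝓘(ℝ, ℝ) k f ((chartAt (Euc n) p).source ∩ A) :=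
    hcomp.congr fun q hq => congrArg f ((chartAt (Euc n) p).left_inv hq.1).symm
  exact (hsource.contMDiffAt (((chartAt (Euc n) p).open_source.inter hA).mem_nhds
    ⟨mem_chart_source _ p, hp⟩)).contMDiffWithinAt

end Regularity

variable [RiemannianBundle (fun x : M => TangentSpace (𝓡 n) x)]

/-- The component along `∂ᵢ` of the gradient, weighted by the volume density; its coordinate
divergence is `√(det g) Δf`. -/
noncomputable def gradFlux (x₀ : M) (f : M → ℝ) (i : Fin n) (y : Euc n) : ℝ :=
  volDensity x₀ y * gradCoord x₀ f i y

lemma chartLaplacian_eq_sum_gradFlux (x₀ : M) (f : M → ℝ) (y : Euc n) :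
    chartLaplacian x₀ f y = (volDensity x₀ y)⁻¹ * ∑ i, partialDeriv i (gradFlux x₀ f i) y := rfl

variable [IsManifold (𝓡 n) ∞ M]
  [IsContMDiffRiemannianBundle (𝓡 n) ∞ (Euc n) (fun x : M => TangentSpace (𝓡 n) x)]

lemma contDiffOn_gradCoord (x₀ : M) {A : Set M} (hA : IsOpen A) {f : M → ℝ} {k l : WithTop ℕ∞}
    (hl : l ≤ (∞ : WithTop ℕ∞)) (hk : k + 1 ≤ l) (hf : ContMDiffOn (𝓡 n) 𝓘(ℝ, ℝ) l f A)
    (i : Fin n) : ContDiffOn ℝ k (gradCoord x₀ f i) (chartDom x₀ A) := by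
  have hk' : k ≤ (∞ : WithTop ℕ∞) := (le_self_add.trans hk).trans hl
  exact ContDiffOn.sum fun j _ =>
    (((contDiffOn_gram_inv x₀ i j).of_le hk').mono inter_subset_left).mul
      (contDiffOn_partialDeriv (isOpen_chartDom x₀ hA) (contDiffOn_inChart x₀ hl hf) hk j)

lemma contDiffOn_gradFlux (x₀ : M) {A : Set M} (hA : IsOpen A) {f : M → ℝ} {k l : WithTop ℕ∞}
    (hl : l ≤ (∞ : WithTop ℕ∞)) (hk : k + 1 ≤ l) (hf : ContMDiffOn (𝓡 n) 𝓘(ℝ, ℝ) l f A)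
    (i : Fin n) : ContDiffOn ℝ k (gradFlux x₀ f i) (chartDom x₀ A) :=
  (((contDiffOn_volDensity x₀).of_le ((le_self_add.trans hk).trans hl)).mono
    inter_subset_left).mul (contDiffOn_gradCoord x₀ hA hl hk hf i)

lemma contDiffOn_chartLaplacian (x₀ : M) {A : Set M} (hA : IsOpen A) {f : M → ℝ}
    {k l : WithTop ℕ∞} (hl : l ≤ (∞ : WithTop ℕ∞)) (hk : k + 1 + 1 ≤ l)
    (hf : ContMDiffOn (𝓡 n) 𝓘(ℝ, ℝ) l f A) :
    ContDiffOn ℝ k (chartLaplacian x₀ f) (chartDom (n := n) x₀ A) := by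
  have hk' : k ≤ (∞ : WithTop ℕ∞) := ((le_self_add.trans le_self_add).trans hk).trans hl
  refine ((((contDiffOn_volDensity x₀).of_le hk').mono inter_subset_left).inv
    fun y hy => (volDensity_pos x₀ hy.1).ne').mul ?_
  exact ContDiffOn.sum fun i _ => contDiffOn_partialDeriv (isOpen_chartDom x₀ hA)
    (contDiffOn_gradFlux x₀ hA hl hk hf i) le_rfl i

lemma continuousOn_inner_grad {A : Set M} (hA : IsOpen A) {f h : M → ℝ}
    (hf : ContMDiffOn (𝓡 n) 𝓘(ℝ, ℝ) 1 f A) (hh : ContMDiffOn (𝓡 n) 𝓘(ℝ, ℝ) 1 h A) :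
    ContinuousOn (fun p => inner ℝ (grad n f p) (grad n h p)) A := by
  refine (contMDiffOn_zero_iff (I := 𝓡 n) (I' := 𝓘(ℝ, ℝ))).1
    (contMDiffOn_of_inChart hA (by simp) fun x₀ _ => ?_)
  have hcoord : ContDiffOn ℝ 0 (fun y => ∑ i, partialDeriv i (inChart x₀ f) y *
      gradCoord x₀ h i y) (chartDom x₀ A) :=
    ContDiffOn.sum fun i _ => (contDiffOn_partialDeriv (l := 1) (isOpen_chartDom x₀ hA)
      (contDiffOn_inChart x₀ (by simp) hf) (zero_add _).le i).mul
        (contDiffOn_gradCoord x₀ hA (by simp) (zero_add _).le hh i)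
  exact hcoord.congr fun y hy => inner_grad_inChart x₀ hy.1
    (mdifferentiableAt_of_contMDiffOn hA one_ne_zero hf hy.2)
    (mdifferentiableAt_of_contMDiffOn hA one_ne_zero hh hy.2)

lemma continuousOn_norm_grad {A : Set M} (hA : IsOpen A) {f : M → ℝ}
    (hf : ContMDiffOn (𝓡 n) 𝓘(ℝ, ℝ) 1 f A) : ContinuousOn (fun p => ‖grad n f p‖) A := by
  simp only [norm_eq_sqrt_real_inner]
  exact (continuousOn_inner_grad hA hf hf).sqrt

end ChartCalculus

section CompactSupport

lemma integrable_of_continuousOn_of_forall_notMem {X : Type*} [TopologicalSpace X] [T2Space X]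
    [MeasurableSpace X] [OpensMeasurableSpace X] {μ : Measure X} [IsFiniteMeasureOnCompacts μ]
    {F : X → ℝ} {K : Set X} (hK : IsCompact K) (hF : ContinuousOn F K) (h0 : ∀ x ∉ K, F x = 0) :
    Integrable F μ :=
  (integrableOn_iff_integrable_of_support_subset (Function.support_subset_iff'.2 h0)).1
    (hF.integrableOn_compact hK)

lemma integrable_mul_of_hasCompactSupport {X : Type*} [TopologicalSpace X] [T2Space X]
    [MeasurableSpace X] [OpensMeasurableSpace X] {μ : Measure X} [IsFiniteMeasureOnCompacts μ]
    {ψ F : X → ℝ} (hψ : Continuous ψ) (hc : HasCompactSupport ψ)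
    (hF : ContinuousOn F (tsupport ψ)) : Integrable (fun x => ψ x * F x) μ :=
  integrable_of_continuousOn_of_forall_notMem hc (hψ.continuousOn.mul hF) fun x hx => by
    rw [image_eq_zero_of_notMem_tsupport hx, zero_mul]

lemma tsupport_indicator_comp_subset {X Y : Type*} [TopologicalSpace X] [T2Space X]
    [TopologicalSpace Y] (e : OpenPartialHomeomorph X Y) {φ : Y → ℝ} (hc : HasCompactSupport φ)
    (hs : tsupport φ ⊆ e.target) :
    tsupport (e.source.indicator (φ ∘ e)) ⊆ e.symm '' tsupport φ := by
  refine closure_minimal (fun x hx => ?_)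
    (hc.isCompact.image_of_continuousOn (e.continuousOn_symm.mono hs)).isClosed
  obtain ⟨hxe, hφx⟩ := indicator_apply_ne_zero.1 hx
  exact ⟨e x, subset_tsupport _ hφx, e.left_inv hxe⟩

lemma hasCompactSupport_indicator_comp {X Y : Type*} [TopologicalSpace X] [T2Space X]
    [TopologicalSpace Y] (e : OpenPartialHomeomorph X Y) {φ : Y → ℝ} (hc : HasCompactSupport φ)
    (hs : tsupport φ ⊆ e.target) : HasCompactSupport (e.source.indicator (φ ∘ e)) :=
  (hc.isCompact.image_of_continuousOn (e.continuousOn_symm.mono hs)).of_isClosed_subset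
    (isClosed_tsupport _) (tsupport_indicator_comp_subset e hc hs)

lemma contMDiff_indicator_comp {n : ℕ} {X Y : Type*} [TopologicalSpace X] [T2Space X]
    [ChartedSpace (Euc n) X] [TopologicalSpace Y] [ChartedSpace (Euc n) Y]
    {e : OpenPartialHomeomorph X Y} {k : WithTop ℕ∞} (he : ContMDiffOn (𝓡 n) (𝓡 n) k e e.source)
    {φ : Y → ℝ} (hφ : ContMDiff (𝓡 n) 𝓘(ℝ, ℝ) k φ) (hc : HasCompactSupport φ)
    (hs : tsupport φ ⊆ e.target) :
    ContMDiff (𝓡 n) 𝓘(ℝ, ℝ) k (e.source.indicator (φ ∘ e)) := by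
  intro x
  by_cases hx : x ∈ e.source
  · have hsource := e.open_source.mem_nhds hx
    refine ((hφ.comp_contMDiffOn he).contMDiffAt hsource).congr_of_eventuallyEq ?_
    filter_upwards [hsource] with z hz using indicator_of_mem hz _
  · have hx' : x ∉ tsupport (e.source.indicator (φ ∘ e)) := fun h => by
      obtain ⟨y, hy, rfl⟩ := tsupport_indicator_comp_subset e hc hs h
      exact hx (e.map_target (hs hy))
    exact contMDiffAt_const.congr_of_eventuallyEq (notMem_tsupport_iff_eventuallyEq.1 hx')

end CompactSupport

section GreenFormula

variable {n : ℕ}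

lemma setIntegral_mul_sum_partialDeriv {O : Set (Euc n)} (hO : IsOpen O) {Ψ : Euc n → ℝ}
    (hΨ : ContDiff ℝ 1 Ψ) (hc : HasCompactSupport Ψ) (hs : tsupport Ψ ⊆ O)
    {W : Fin n → Euc n → ℝ} (hW : ∀ i, ContDiffOn ℝ 1 (W i) O) :
    ∫ y in O, Ψ y * ∑ i, partialDeriv i (W i) y =
      -∫ y in O, ∑ i, partialDeriv i Ψ y * W i y := by
  have hΨ0 : ∀ y ∉ tsupport Ψ, Ψ y = 0 := fun y => image_eq_zero_of_notMem_tsupport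
  have hdΨ0 (i : Fin n) : ∀ y ∉ tsupport Ψ, partialDeriv i Ψ y = 0 := fun y hy => by
    rw [partialDeriv, image_eq_zero_of_notMem_tsupport fun h => hy (tsupport_fderiv_subset ℝ h),
      zero_apply]
  have hdΨ (i : Fin n) : Continuous (partialDeriv i Ψ) :=
    (hΨ.continuous_fderiv one_ne_zero).clm_apply continuous_const
  have hWc (i : Fin n) : ContinuousOn (W i) (tsupport Ψ) := (hW i).continuousOn.mono hs
  have hdW (i : Fin n) : ContinuousOn (partialDeriv i (W i)) (tsupport Ψ) :=
    (contDiffOn_partialDeriv hO (hW i) (zero_add _).le i).continuousOn.mono hs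
  have hint_div (i : Fin n) : Integrable fun y => Ψ y * partialDeriv i (W i) y :=
    integrable_mul_of_hasCompactSupport hΨ.continuous hc (hdW i)
  have hint_grad (i : Fin n) : Integrable fun y => partialDeriv i Ψ y * W i y :=
    integrable_of_continuousOn_of_forall_notMem hc ((hdΨ i).continuousOn.mul (hWc i))
      fun y hy => by rw [hdΨ0 i y hy, zero_mul]
  have hint_mul (i : Fin n) : Integrable fun y => Ψ y * W i y :=
    integrable_mul_of_hasCompactSupport hΨ.continuous hc (hWc i)
  rw [setIntegral_eq_integral_of_forall_compl_eq_zero fun y hy => by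
      rw [hΨ0 y fun h => hy (hs h), zero_mul],
    setIntegral_eq_integral_of_forall_compl_eq_zero fun y hy => Finset.sum_eq_zero fun i _ => by
      rw [hdΨ0 i y fun h => hy (hs h), zero_mul]]
  simp only [Finset.mul_sum]
  rw [integral_finsetSum _ fun i _ => hint_div i, integral_finsetSum _ fun i _ => hint_grad i,
    ← Finset.sum_neg_distrib]
  exact Finset.sum_congr rfl fun i _ => integral_mul_fderiv_eq_neg_fderiv_mul_of_integrable
    (hint_grad i) (hint_div i) (hint_mul i) (fun y _ => hΨ.differentiable one_ne_zero y)
    fun y hy => ((hW i).differentiableOn one_ne_zero).differentiableAt (hO.mem_nhds (hs hy))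

variable {M : Type*} [MetricSpace M] [ChartedSpace (Euc n) M]

lemma exists_sum_eq_of_hasCompactSupport [SigmaCompactSpace M] [IsManifold (𝓡 n) ∞ M]
    {k : WithTop ℕ∞} (hk : k ≤ (∞ : WithTop ℕ∞)) {ψ : M → ℝ} (hψ : ContMDiff (𝓡 n) 𝓘(ℝ, ℝ) k ψ)
    (hc : HasCompactSupport ψ) :
    ∃ (t : Finset M) (χ : t → M → ℝ), (∀ i, ContMDiff (𝓡 n) 𝓘(ℝ, ℝ) k (χ i)) ∧
      (∀ i, tsupport (χ i) ⊆ tsupport ψ ∩ (chartAt (Euc n) (i : M)).source) ∧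
      ψ = fun x => ∑ i, χ i x := by
  obtain ⟨t, ht⟩ := hc.isCompact.elim_finite_subcover (fun x : M => (chartAt (Euc n) x).source)
    (fun x => (chartAt (Euc n) x).open_source) fun x _ => mem_iUnion.2 ⟨x, mem_chart_source _ x⟩
  obtain ⟨ρ, hρ⟩ := SmoothPartitionOfUnity.exists_isSubordinate (𝓡 n) (isClosed_tsupport ψ)
    (fun x : t => (chartAt (Euc n) (x : M)).source)
    (fun x => (chartAt (Euc n) (x : M)).open_source) fun x hx => by
      obtain ⟨i, hi, hxi⟩ := mem_iUnion₂.1 (ht hx)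
      exact mem_iUnion.2 ⟨⟨i, hi⟩, hxi⟩
  refine ⟨t, fun i x => ρ i x * ψ x, fun i => ((ρ i).contMDiff.of_le hk).mul hψ,
    fun i => subset_inter tsupport_mul_subset_right (tsupport_mul_subset_left.trans (hρ i)),
    funext fun x => ?_⟩
  rw [← Finset.sum_mul]
  by_cases hx : x ∈ tsupport ψ
  · rw [← finsum_eq_sum_of_fintype, ρ.sum_eq_one hx, one_mul]
  · rw [image_eq_zero_of_notMem_tsupport hx, mul_zero]

variable [RiemannianBundle (fun x : M => TangentSpace (𝓡 n) x)] [IsManifold (𝓡 n) ∞ M]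
  [IsContMDiffRiemannianBundle (𝓡 n) ∞ (Euc n) (fun x : M => TangentSpace (𝓡 n) x)]

lemma continuousOn_chartLaplacian_chart (x₀ : M) {A : Set M} (hA : IsOpen A)
    (hAS : A ⊆ (chartAt (Euc n) x₀).source) {v : M → ℝ} (hv : ContMDiffOn (𝓡 n) 𝓘(ℝ, ℝ) 2 v A) :
    ContinuousOn (fun x => chartLaplacian x₀ v (chartAt (Euc n) x₀ x)) A :=
  (contDiffOn_chartLaplacian x₀ hA (k := 0) (l := 2) ENat.LEInfty.out (by norm_num)
    hv).continuousOn.comp ((chartAt (Euc n) x₀).continuousOn.mono hAS) fun _ hx =>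
      chart_mem_chartDom (hAS hx) hx

variable [MeasurableSpace M] [BorelSpace M]

lemma setIntegral_mul_chartLaplacian (x₀ : M) {A : Set M} (hA : IsOpen A)
    (hAS : A ⊆ (chartAt (Euc n) x₀).source) {v ψ : M → ℝ}
    (hv : ContMDiffOn (𝓡 n) 𝓘(ℝ, ℝ) 2 v A) (hψ : ContMDiff (𝓡 n) 𝓘(ℝ, ℝ) 1 ψ)
    (hc : HasCompactSupport ψ) (hs : tsupport ψ ⊆ A) :
    ∫ x in A, ψ x * chartLaplacian x₀ v (chartAt (Euc n) x₀ x) ∂(riemVolume n M) =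
      -∫ x in A, inner ℝ (grad n ψ x) (grad n v x) ∂(riemVolume n M) := by
  set c := chartAt (Euc n) x₀
  have hO := isOpen_chartDom (n := n) x₀ hA
  have hsS : tsupport ψ ⊆ c.source := hs.trans hAS
  set Ψ := c.target.indicator (inChart x₀ ψ)
  have hΨeq {y : Euc n} (hy : y ∈ c.target) : Ψ =ᶠ[𝓝 y] inChart x₀ ψ := by
    filter_upwards [c.open_target.mem_nhds hy] with z hz using indicator_of_mem hz _
  have hsymm : ContMDiffOn (𝓡 n) (𝓡 n) 1 c.symm c.target := contMDiffOn_chart_symm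
  have hΨ : ContDiff ℝ 1 Ψ :=
    (contMDiff_indicator_comp (e := c.symm) hsymm hψ hc hsS).contDiff
  have hΨs : tsupport Ψ ⊆ chartDom x₀ A :=
    (tsupport_indicator_comp_subset c.symm hc hsS).trans <| image_subset_iff.2 fun p hp =>
      chart_mem_chartDom (hsS hp) (hs hp)
  have hleft : ContinuousOn (fun x => ψ x * chartLaplacian x₀ v (c x)) A :=
    hψ.continuous.continuousOn.mul (continuousOn_chartLaplacian_chart x₀ hA hAS hv)
  have hright := continuousOn_inner_grad hA hψ.contMDiffOn (hv.of_le one_le_two)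
  have hleft_chart : EqOn (fun y => volDensity x₀ y *
      inChart x₀ (fun x => ψ x * chartLaplacian x₀ v (c x)) y)
      (fun y => Ψ y * ∑ i, partialDeriv i (gradFlux x₀ v i) y) (chartDom x₀ A) := fun y hy => by
    have hdensity := (volDensity_pos x₀ hy.1).ne'
    simp only [(hΨeq hy.1).eq_of_nhds, inChart, c, (chartAt (Euc n) x₀).right_inv hy.1,
      chartLaplacian_eq_sum_gradFlux]
    field_simp
  have hright_chart : EqOn (fun y => volDensity x₀ y *
      inChart x₀ (fun x => inner ℝ (grad n ψ x) (grad n v x)) y)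
      (fun y => ∑ i, partialDeriv i Ψ y * gradFlux x₀ v i y) (chartDom x₀ A) := fun y hy => by
    simp only [inChart, partialDeriv_congr (hΨeq hy.1), gradFlux]
    rw [inner_grad_inChart x₀ hy.1 (hψ.mdifferentiableAt one_ne_zero)
      (mdifferentiableAt_of_contMDiffOn hA two_ne_zero hv hy.2), Finset.mul_sum]
    exact Finset.sum_congr rfl fun i _ => mul_left_comm _ _ _
  rw [setIntegral_eq_setIntegral_chartDom x₀ hA.measurableSet hAS
      (hleft.aestronglyMeasurable hA.measurableSet),
    setIntegral_eq_setIntegral_chartDom x₀ hA.measurableSet hAS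
      (hright.aestronglyMeasurable hA.measurableSet),
    setIntegral_congr_fun hO.measurableSet hleft_chart,
    setIntegral_congr_fun hO.measurableSet hright_chart]
  exact setIntegral_mul_sum_partialDeriv hO hΨ (hasCompactSupport_indicator_comp c.symm hc hsS) hΨs
    fun i => contDiffOn_gradFlux x₀ hA (l := 2) ENat.LEInfty.out (by norm_num) hv i

lemma eq_zero_of_forall_setIntegral_mul_eq_zero (x₀ : M) {U : Set M} (hU : IsOpen U)
    (hUS : U ⊆ (chartAt (Euc n) x₀).source) {D : M → ℝ} (hD : ContinuousOn D U)
    (h : ∀ ψ : M → ℝ, ContMDiff (𝓡 n) 𝓘(ℝ, ℝ) ∞ ψ → HasCompactSupport ψ → tsupport ψ ⊆ U →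
      ∫ x in U, ψ x * D x ∂(riemVolume n M) = 0) : ∀ x ∈ U, D x = 0 := by
  set c := chartAt (Euc n) x₀
  have hO := isOpen_chartDom (n := n) x₀ hU
  have hDO : ContinuousOn (fun y => volDensity x₀ y * inChart x₀ D y) (chartDom x₀ U) :=
    ((contDiffOn_volDensity x₀).continuousOn.mono inter_subset_left).mul
      (hD.comp (c.continuousOn_symm.mono inter_subset_left) fun y hy => hy.2)
  have hae : ∀ᵐ y ∂(volume : Measure (Euc n)), y ∈ chartDom x₀ U →
      volDensity x₀ y * inChart x₀ D y = 0 := by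
    refine hO.ae_eq_zero_of_integral_contDiff_smul_eq_zero
      (hDO.locallyIntegrableOn hO.measurableSet) fun φ hφ hφc hφs => ?_
    have hφT : tsupport φ ⊆ c.target := hφs.trans inter_subset_left
    have hψ := contMDiff_indicator_comp contMDiffOn_chart hφ.contMDiff hφc hφT
    have hψs : tsupport (c.source.indicator (φ ∘ c)) ⊆ U :=
      (tsupport_indicator_comp_subset c hφc hφT).trans (image_subset_iff.2 fun y hy => (hφs hy).2)
    have hzero := h _ hψ (hasCompactSupport_indicator_comp c hφc hφT) hψs
    rw [setIntegral_eq_setIntegral_chartDom (f := fun x => _ * D x) x₀ hU.measurableSet hUS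
      ((hψ.continuous.continuousOn.mul hD).aestronglyMeasurable hU.measurableSet)] at hzero
    rw [← hzero, ← setIntegral_eq_integral_of_forall_compl_eq_zero (s := chartDom x₀ U)
      fun y hy => by rw [image_eq_zero_of_notMem_tsupport fun h => hy (hφs h), zero_smul]]
    refine setIntegral_congr_fun hO.measurableSet fun y hy => ?_
    simp only [smul_eq_mul, inChart, indicator_of_mem (c.map_target hy.1), Function.comp_apply,
      c.right_inv hy.1, c]
    ring
  intro p hp
  have hpO := chart_mem_chartDom (hUS hp) hp
  have hzero := Measure.eqOn_open_of_ae_eq ((ae_restrict_iff' hO.measurableSet).2 hae) hO hDO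
    continuousOn_const hpO
  simpa only [inChart, (chartAt (Euc n) x₀).left_inv (hUS hp), mul_eq_zero,
    (volDensity_pos x₀ hpO.1).ne', false_or] using hzero

lemma chartLaplacian_congr_chart {A : Set M} (hA : IsOpen A) {v : M → ℝ}
    (hv : ContMDiffOn (𝓡 n) 𝓘(ℝ, ℝ) 2 v A) {x₀ x₁ p : M} (hpA : p ∈ A)
    (hp₀ : p ∈ (chartAt (Euc n) x₀).source) (hp₁ : p ∈ (chartAt (Euc n) x₁).source) :
    chartLaplacian x₀ v (chartAt (Euc n) x₀ p) = chartLaplacian x₁ v (chartAt (Euc n) x₁ p) := by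
  set U := A ∩ (chartAt (Euc n) x₀).source ∩ (chartAt (Euc n) x₁).source
  have hU : IsOpen U :=
    (hA.inter (chartAt (Euc n) x₀).open_source).inter (chartAt (Euc n) x₁).open_source
  have hU₀ : U ⊆ (chartAt (Euc n) x₀).source := fun q hq => hq.1.2
  have hU₁ : U ⊆ (chartAt (Euc n) x₁).source := fun q hq => hq.2
  have hvU : ContMDiffOn (𝓡 n) 𝓘(ℝ, ℝ) 2 v U := hv.mono fun q hq => hq.1.1
  have hcont₀ := continuousOn_chartLaplacian_chart x₀ hU hU₀ hvU
  have hcont₁ := continuousOn_chartLaplacian_chart x₁ hU hU₁ hvU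
  -- Both sides satisfy the same Green formula against every test function.
  refine sub_eq_zero.1 (eq_zero_of_forall_setIntegral_mul_eq_zero x₀ hU hU₀
    (hcont₀.sub hcont₁) (fun ψ hψ hc hs => ?_) p ⟨⟨hpA, hp₀⟩, hp₁⟩)
  have hintegrable {F : M → ℝ} (hF : ContinuousOn F U) :
      IntegrableOn (fun q => ψ q * F q) U (riemVolume n M) :=
    (integrable_mul_of_hasCompactSupport hψ.continuous hc (hF.mono hs)).integrableOn
  simp only [Pi.sub_apply, mul_sub]
  rw [integral_sub (hintegrable hcont₀) (hintegrable hcont₁),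
    setIntegral_mul_chartLaplacian x₀ hU hU₀ hvU (hψ.of_le (by simp)) hc hs,
    setIntegral_mul_chartLaplacian x₁ hU hU₁ hvU (hψ.of_le (by simp)) hc hs, sub_self]

lemma lap_eq_chartLaplacian {A : Set M} (hA : IsOpen A) {v : M → ℝ}
    (hv : ContMDiffOn (𝓡 n) 𝓘(ℝ, ℝ) 2 v A) {x₀ p : M} (hpA : p ∈ A)
    (hp₀ : p ∈ (chartAt (Euc n) x₀).source) :
    lap n v p = chartLaplacian x₀ v (chartAt (Euc n) x₀ p) :=
  chartLaplacian_congr_chart hA hv hpA (mem_chart_source _ p) hp₀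

lemma lap_chart_symm {A : Set M} (hA : IsOpen A) {v : M → ℝ}
    (hv : ContMDiffOn (𝓡 n) 𝓘(ℝ, ℝ) 2 v A) (x₀ : M) {y : Euc n} (hy : y ∈ chartDom x₀ A) :
    lap n v ((chartAt (Euc n) x₀).symm y) = chartLaplacian x₀ v y := by
  rw [lap_eq_chartLaplacian hA hv hy.2 ((chartAt (Euc n) x₀).map_target hy.1),
    (chartAt (Euc n) x₀).right_inv hy.1]

lemma contMDiffOn_lap {A : Set M} (hA : IsOpen A) {v : M → ℝ} {k l : WithTop ℕ∞}
    (hl : l ≤ (∞ : WithTop ℕ∞)) (hk : k + 1 + 1 ≤ l) (hv : ContMDiffOn (𝓡 n) 𝓘(ℝ, ℝ) l v A) :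
    ContMDiffOn (𝓡 n) 𝓘(ℝ, ℝ) k (lap n v) A := by
  have htwo : (2 : WithTop ℕ∞) ≤ l := by
    rw [add_assoc, one_add_one_eq_two] at hk
    exact le_add_self.trans hk
  refine contMDiffOn_of_inChart hA (((le_self_add.trans le_self_add).trans hk).trans hl)
    fun x₀ _ => ?_
  exact (contDiffOn_chartLaplacian x₀ hA hl hk hv).congr fun y hy =>
    lap_chart_symm hA (hv.of_le htwo) x₀ hy

lemma continuousOn_lap {A : Set M} (hA : IsOpen A) {v : M → ℝ}
    (hv : ContMDiffOn (𝓡 n) 𝓘(ℝ, ℝ) 2 v A) : ContinuousOn (lap n v) A :=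
  (contMDiffOn_lap hA (k := 0) ENat.LEInfty.out (by norm_num) hv).continuousOn

lemma integrable_mul_lap {A : Set M} (hA : IsOpen A) {v ψ : M → ℝ}
    (hv : ContMDiffOn (𝓡 n) 𝓘(ℝ, ℝ) 2 v A) (hψ : Continuous ψ) (hc : HasCompactSupport ψ)
    (hs : tsupport ψ ⊆ A) : Integrable (fun x => ψ x * lap n v x) (riemVolume n M) :=
  integrable_mul_of_hasCompactSupport hψ hc ((continuousOn_lap hA hv).mono hs)

lemma integrable_inner_grad {A : Set M} (hA : IsOpen A) {v ψ : M → ℝ}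
    (hv : ContMDiffOn (𝓡 n) 𝓘(ℝ, ℝ) 1 v A) (hψ : ContMDiff (𝓡 n) 𝓘(ℝ, ℝ) 1 ψ)
    (hc : HasCompactSupport ψ) (hs : tsupport ψ ⊆ A) :
    Integrable (fun x => inner ℝ (grad n ψ x) (grad n v x)) (riemVolume n M) :=
  integrable_of_continuousOn_of_forall_notMem hc
    ((continuousOn_inner_grad hA hψ.contMDiffOn hv).mono hs) fun _ hx => by
      rw [grad_eq_zero_of_notMem_tsupport hx, inner_zero_left]

lemma setIntegral_mul_lap_of_tsupport_subset_source (x₀ : M) {A : Set M} (hA : IsOpen A)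
    {v ψ : M → ℝ} (hv : ContMDiffOn (𝓡 n) 𝓘(ℝ, ℝ) 2 v A) (hψ : ContMDiff (𝓡 n) 𝓘(ℝ, ℝ) 1 ψ)
    (hc : HasCompactSupport ψ) (hs : tsupport ψ ⊆ A ∩ (chartAt (Euc n) x₀).source) :
    ∫ x in A, ψ x * lap n v x ∂(riemVolume n M) =
      -∫ x in A, inner ℝ (grad n ψ x) (grad n v x) ∂(riemVolume n M) := by
  have hB : IsOpen (A ∩ (chartAt (Euc n) x₀).source) := hA.inter (chartAt (Euc n) x₀).open_source
  have hlocal := setIntegral_mul_chartLaplacian x₀ hB inter_subset_right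
    (hv.mono inter_subset_left) hψ hc hs
  rw [setIntegral_eq_of_subset_of_forall_sdiff_eq_zero hA.measurableSet inter_subset_left
      fun x hx => by rw [image_eq_zero_of_notMem_tsupport fun h => hx.2 (hs h), zero_mul],
    setIntegral_eq_of_subset_of_forall_sdiff_eq_zero
      (f := fun x => inner ℝ (grad n ψ x) (grad n v x)) hA.measurableSet inter_subset_left
      fun x hx => by
        rw [grad_eq_zero_of_notMem_tsupport fun h => hx.2 (hs h), inner_zero_left], ← hlocal]
  exact setIntegral_congr_fun hB.measurableSet fun x hx =>
    congrArg (ψ x * ·) (lap_eq_chartLaplacian hA hv hx.1 hx.2)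

lemma setIntegral_mul_lap [SigmaCompactSpace M] {A : Set M} (hA : IsOpen A) {v ψ : M → ℝ}
    (hv : ContMDiffOn (𝓡 n) 𝓘(ℝ, ℝ) 2 v A) (hψ : ContMDiff (𝓡 n) 𝓘(ℝ, ℝ) 1 ψ)
    (hc : HasCompactSupport ψ) (hs : tsupport ψ ⊆ A) :
    ∫ x in A, ψ x * lap n v x ∂(riemVolume n M) =
      -∫ x in A, inner ℝ (grad n ψ x) (grad n v x) ∂(riemVolume n M) := by
  obtain ⟨t, χ, hχ, hsupp, hsum⟩ := exists_sum_eq_of_hasCompactSupport (by simp) hψ hc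
  have hχc (i : t) : HasCompactSupport (χ i) :=
    hc.of_isClosed_subset (isClosed_tsupport _) fun _ hx => (hsupp i hx).1
  have hχA (i : t) : tsupport (χ i) ⊆ A := fun _ hx => hs (hsupp i hx).1
  have hleft : ∫ x in A, ψ x * lap n v x ∂(riemVolume n M) =
      ∑ i, ∫ x in A, χ i x * lap n v x ∂(riemVolume n M) := by
    rw [← integral_finsetSum _ fun i _ =>
      (integrable_mul_lap hA hv (hχ i).continuous (hχc i) (hχA i)).integrableOn]
    simp only [hsum, Finset.sum_mul]
  have hright : ∫ x in A, inner ℝ (grad n ψ x) (grad n v x) ∂(riemVolume n M) =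
      ∑ i, ∫ x in A, inner ℝ (grad n (χ i) x) (grad n v x) ∂(riemVolume n M) := by
    rw [← integral_finsetSum _ fun i _ =>
      (integrable_inner_grad hA (hv.of_le one_le_two) (hχ i) (hχc i) (hχA i)).integrableOn]
    simp only [← sum_inner,
      ← grad_sum Finset.univ fun i _ => (hχ i).mdifferentiableAt one_ne_zero, hsum]
  rw [hleft, hright, ← Finset.sum_neg_distrib]
  exact Finset.sum_congr rfl fun i _ => setIntegral_mul_lap_of_tsupport_subset_source (i : M) hA hv
    (hχ i) (hχc i) fun x hx => ⟨hχA i hx, (hsupp i hx).2⟩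

end GreenFormula

section LaplacianChainRule

variable {n : ℕ} {M : Type*} [MetricSpace M] [ChartedSpace (Euc n) M]
  [RiemannianBundle (fun x : M => TangentSpace (𝓡 n) x)]

lemma gradFlux_comp (x₀ : M) {θ : ℝ → ℝ} {f : M → ℝ} {y : Euc n}
    (hf : DifferentiableAt ℝ (inChart x₀ f) y) (hθ : DifferentiableAt ℝ θ (inChart x₀ f y))
    (i : Fin n) : gradFlux x₀ (fun x => θ (f x)) i y =
      deriv θ (inChart x₀ f y) * gradFlux x₀ f i y := by
  have hpartial (j : Fin n) : partialDeriv j (inChart x₀ fun x => θ (f x)) y =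
      deriv θ (inChart x₀ f y) * partialDeriv j (inChart x₀ f) y := partialDeriv_comp hf hθ j
  simp only [gradFlux, gradCoord, hpartial, Finset.mul_sum]
  exact Finset.sum_congr rfl fun j _ => by ring

variable [IsManifold (𝓡 n) ∞ M]
  [IsContMDiffRiemannianBundle (𝓡 n) ∞ (Euc n) (fun x : M => TangentSpace (𝓡 n) x)]

lemma partialDeriv_gradFlux_comp (x₀ : M) {A : Set M} (hA : IsOpen A) {f : M → ℝ} {θ : ℝ → ℝ}
    (hθ : ContDiff ℝ 2 θ) (hf : ContMDiffOn (𝓡 n) 𝓘(ℝ, ℝ) 2 f A) {y : Euc n}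
    (hy : y ∈ chartDom x₀ A) (i : Fin n) :
    partialDeriv i (gradFlux x₀ (fun x => θ (f x)) i) y =
      deriv θ (inChart x₀ f y) * partialDeriv i (gradFlux x₀ f i) y + gradFlux x₀ f i y *
        (deriv (deriv θ) (inChart x₀ f y) * partialDeriv i (inChart x₀ f) y) := by
  have hO := isOpen_chartDom (n := n) x₀ hA
  have hdiff {z : Euc n} (hz : z ∈ chartDom x₀ A) : DifferentiableAt ℝ (inChart x₀ f) z :=
    ((contDiffOn_inChart x₀ ENat.LEInfty.out hf).differentiableOn two_ne_zero).differentiableAt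
      (hO.mem_nhds hz)
  have hθ' : Differentiable ℝ (deriv θ) :=
    ((contDiff_succ_iff_deriv (n := 1)).1 hθ).2.2.differentiable one_ne_zero
  have hflux : DifferentiableAt ℝ (gradFlux x₀ f i) y :=
    ((contDiffOn_gradFlux x₀ hA (k := 1) (l := 2) ENat.LEInfty.out (by norm_num) hf
      i).differentiableOn one_ne_zero).differentiableAt (hO.mem_nhds hy)
  have hcomp : gradFlux x₀ (fun x => θ (f x)) i =ᶠ[𝓝 y]
      fun z => deriv θ (inChart x₀ f z) * gradFlux x₀ f i z := by
    filter_upwards [hO.mem_nhds hy] with z hz using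
      gradFlux_comp x₀ (hdiff hz) (hθ.differentiable two_ne_zero _) i
  have hderiv : DifferentiableAt ℝ (fun z => deriv θ (inChart x₀ f z)) y :=
    hθ'.differentiableAt.comp y (hdiff hy)
  rw [partialDeriv_congr hcomp, partialDeriv_mul hderiv hflux]
  congr 2
  exact partialDeriv_comp (hdiff hy) hθ'.differentiableAt i

lemma lap_comp {A : Set M} (hA : IsOpen A) {f : M → ℝ} {θ : ℝ → ℝ} (hθ : ContDiff ℝ 2 θ)
    (hf : ContMDiffOn (𝓡 n) 𝓘(ℝ, ℝ) 2 f A) {p : M} (hp : p ∈ A) :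
    lap n (fun x => θ (f x)) p =
      deriv θ (f p) * lap n f p + deriv (deriv θ) (f p) * ‖grad n f p‖ ^ 2 := by
  set c := chartAt (Euc n) p
  have hleft : c.symm (c p) = p := c.left_inv (mem_chart_source _ p)
  have hy : c p ∈ chartDom p A := chart_mem_chartDom (mem_chart_source _ p) hp
  have hdiff := mdifferentiableAt_of_contMDiffOn hA two_ne_zero hf hy.2
  have hnorm : ‖grad n f p‖ ^ 2 =
      ∑ i, partialDeriv i (inChart p f) (c p) * gradCoord p f i (c p) := by
    rw [← inner_grad_inChart p hy.1 hdiff hdiff, real_inner_self_eq_norm_sq, hleft]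
  have hdensity := (volDensity_pos p hy.1).ne'
  have hval : inChart p f (c p) = f p := congrArg f hleft
  change chartLaplacian p _ (c p) = _ * chartLaplacian p f (c p) + _
  simp only [chartLaplacian_eq_sum_gradFlux, partialDeriv_gradFlux_comp p hA hθ hf hy, hval, hnorm,
    Finset.sum_add_distrib, mul_add, Finset.mul_sum]
  congr 1
  · exact Finset.sum_congr rfl fun i _ => mul_left_comm _ _ _
  · refine Finset.sum_congr rfl fun i _ => ?_
    rw [gradFlux]
    field_simp

end LaplacianChainRule

section HopfRinow

variable {X : Type*} [MetricSpace X]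

lemma exists_isCompact_closedBall_add [LocallyCompactSpace X]
    (hX : ∀ (x : X) (r δ : ℝ), 0 ≤ r → 0 < δ →
      Metric.ball x (r + δ) ⊆ Metric.thickening δ (Metric.closedBall x r))
    {x : X} {r : ℝ} (hr : 0 ≤ r) (hK : IsCompact (Metric.closedBall x r)) :
    ∃ ε > 0, IsCompact (Metric.closedBall x (r + ε)) := by
  obtain ⟨K', hK', hKK'⟩ := exists_compact_superset hK
  obtain ⟨δ, hδ, hsub⟩ := hK.exists_thickening_subset_open isOpen_interior hKK'
  have hball : Metric.closedBall x (r + δ / 2) ⊆ K' :=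
    (Metric.closedBall_subset_ball (add_lt_add_right (half_lt_self hδ) r)).trans
      ((hX x r δ hr hδ).trans (hsub.trans interior_subset))
  exact ⟨δ / 2, half_pos hδ, hK'.of_isClosed_subset Metric.isClosed_closedBall hball⟩

lemma isCompact_closedBall_of_forall_lt [CompleteSpace X]
    (hX : ∀ (x : X) (r δ : ℝ), 0 ≤ r → 0 < δ →
      Metric.ball x (r + δ) ⊆ Metric.thickening δ (Metric.closedBall x r))
    {x : X} {R : ℝ} (hR : 0 < R) (hK : ∀ r < R, IsCompact (Metric.closedBall x r)) :
    IsCompact (Metric.closedBall x R) := by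
  rw [isCompact_iff_totallyBounded_isComplete]
  refine ⟨Metric.totallyBounded_iff.2 fun ε hε => ?_, Metric.isClosed_closedBall.isComplete⟩
  set r := max (R - ε / 4) 0
  have hRr : R < r + ε / 2 := by linarith [le_max_left (R - ε / 4) 0]
  obtain ⟨t, ht, hcover⟩ := Metric.totallyBounded_iff.1
    (hK r (max_lt (by linarith) hR)).totallyBounded (ε / 2) (half_pos hε)
  refine ⟨t, ht, fun y hy => ?_⟩
  obtain ⟨z, hz, hyz⟩ := Metric.mem_thickening_iff.1 <|
    hX x r (ε / 2) (le_max_right _ _) (half_pos hε) (Metric.closedBall_subset_ball hRr hy)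
  obtain ⟨w, hw, hzw⟩ := mem_iUnion₂.1 (hcover hz)
  exact mem_iUnion₂.2 ⟨w, hw, (dist_triangle y z w).trans_lt
    ((add_lt_add hyz (Metric.mem_ball.1 hzw)).trans_eq (add_halves ε))⟩

lemma properSpace_of_ball_add_subset_thickening [CompleteSpace X] [LocallyCompactSpace X]
    (hX : ∀ (x : X) (r δ : ℝ), 0 ≤ r → 0 < δ →
      Metric.ball x (r + δ) ⊆ Metric.thickening δ (Metric.closedBall x r)) : ProperSpace X := by
  refine ⟨fun x => ?_⟩
  by_contra! hnot
  obtain ⟨r₀, hr₀⟩ := hnot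
  set S := {r | ¬ IsCompact (Metric.closedBall x r)}
  have hnonneg : ∀ r ∈ S, 0 ≤ r := fun r hr => by
    by_contra! hneg
    exact hr (by rw [Metric.closedBall_eq_empty.2 hneg]; exact isCompact_empty)
  have hbelow : ∀ r < sInf S, IsCompact (Metric.closedBall x r) := fun r hr =>
    not_not.1 fun hrS => hr.not_ge (csInf_le ⟨0, hnonneg⟩ hrS)
  have hinf : IsCompact (Metric.closedBall x (sInf S)) := by
    rcases (le_csInf ⟨r₀, hr₀⟩ hnonneg).eq_or_lt with hzero | hpos
    · rw [← hzero, Metric.closedBall_zero]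
      exact isCompact_singleton
    · exact isCompact_closedBall_of_forall_lt hX hpos hbelow
  obtain ⟨ε, hε, hcompact⟩ :=
    exists_isCompact_closedBall_add hX (le_csInf ⟨r₀, hr₀⟩ hnonneg) hinf
  refine (lt_add_of_pos_right (sInf S) hε).not_ge (le_csInf ⟨r₀, hr₀⟩ fun r hr => ?_)
  by_contra! hlt
  exact hr (hcompact.of_isClosed_subset Metric.isClosed_closedBall
    (Metric.closedBall_subset_closedBall hlt.le))

variable (n : ℕ) {M : Type*} [MetricSpace M] [ChartedSpace (Euc n) M]
  [RiemannianBundle (fun x : M => TangentSpace (𝓡 n) x)] [IsRiemannianManifold (𝓡 n) M]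

include n

lemma ball_add_subset_thickening (x : M) {r δ : ℝ} (hr : 0 ≤ r) (hδ : 0 < δ) :
    Metric.ball x (r + δ) ⊆ Metric.thickening δ (Metric.closedBall x r) := by
  intro y hy
  rw [Metric.mem_thickening_iff]
  rw [Metric.mem_ball'] at hy
  by_cases hyr : dist x y ≤ r
  · exact ⟨y, Metric.mem_closedBall'.2 hyr, by rwa [dist_self]⟩
  have hlt : riemannianEDist (𝓡 n) x y < ENNReal.ofReal (r + δ) := by
    rw [← IsRiemannianManifold.out (I := 𝓡 n), edist_dist]
    exact (ENNReal.ofReal_lt_ofReal_iff (by positivity)).2 hy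
  obtain ⟨γ, hγ0, hγ1, hγ, hlength⟩ := exists_lt_of_riemannianEDist_lt hlt
  have hcont : ContinuousOn (fun t => dist x (γ t)) (Icc 0 1) :=
    (continuous_const.dist continuous_id).comp_continuousOn hγ.continuousOn
  obtain ⟨t, ht, htr⟩ := intermediate_value_Icc zero_le_one hcont
    (show r ∈ Icc _ _ by rw [hγ0, hγ1, dist_self]; exact ⟨hr, (not_le.1 hyr).le⟩)
  have hxz := riemannianEDist_le_pathELength (I := 𝓡 n)
    (hγ.mono (Icc_subset_Icc_right ht.2)) hγ0 rfl ht.1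
  have hzy := riemannianEDist_le_pathELength (I := 𝓡 n)
    (hγ.mono (Icc_subset_Icc_left ht.1)) rfl hγ1 ht.2
  rw [← IsRiemannianManifold.out (I := 𝓡 n), edist_dist] at hxz hzy
  have hsum := (add_le_add hxz hzy).trans_lt ((pathELength_add ht.1 ht.2).trans_lt hlength)
  rw [← ENNReal.ofReal_add dist_nonneg dist_nonneg,
    ENNReal.ofReal_lt_ofReal_iff (by positivity)] at hsum
  exact ⟨γ t, Metric.mem_closedBall'.2 htr.le, by rw [dist_comm]; linarith⟩

variable (M) in
theorem properSpace_of_completeSpace [CompleteSpace M] : ProperSpace M :=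
  have := ChartedSpace.locallyCompactSpace (Euc n) M
  properSpace_of_ball_add_subset_thickening fun x _ _ => ball_add_subset_thickening n x

end HopfRinow

section LpLimits

variable {X : Type*} [MeasurableSpace X] {μ : Measure X}

lemma tendsto_eLpNorm_two_zero_of_enorm_sq_le {f : ℕ → X → ℝ} {g : ℕ → X → ℝ≥0∞}
    (hfg : ∀ m x, ‖f m x‖ₑ ^ 2 ≤ g m x) (hg : Tendsto (fun m => ∫⁻ x, g m x ∂μ) atTop (𝓝 0)) :
    Tendsto (fun m => eLpNorm (f m) 2 μ) atTop (𝓝 0) := by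
  have hroot : Tendsto (fun m => (∫⁻ x, g m x ∂μ) ^ (1 / 2 : ℝ)) atTop (𝓝 0) := by
    have hcomp := ((ENNReal.continuous_rpow_const (y := (1 / 2 : ℝ))).tendsto 0).comp hg
    rwa [ENNReal.zero_rpow_of_pos (by norm_num)] at hcomp
  refine tendsto_of_tendsto_of_tendsto_of_le_of_le tendsto_const_nhds hroot (fun m => zero_le)
    fun m => ?_
  rw [eLpNorm_eq_lintegral_rpow_enorm_toReal two_ne_zero ENNReal.ofNat_ne_top]
  simp only [ENNReal.toReal_ofNat]
  refine ENNReal.rpow_le_rpow (lintegral_mono fun x => ?_) (by norm_num)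
  exact (ENNReal.rpow_ofNat _ 2).trans_le (hfg m x)

lemma tendsto_eLpNorm_zero_of_norm_le_mul {f g : ℕ → X → ℝ} {p : ℝ≥0∞} {C : ℝ}
    (hfg : ∀ m, ∀ᵐ x ∂μ, ‖f m x‖ ≤ C * ‖g m x‖)
    (hg : Tendsto (fun m => eLpNorm (g m) p μ) atTop (𝓝 0)) :
    Tendsto (fun m => eLpNorm (f m) p μ) atTop (𝓝 0) := by
  have hmul := ENNReal.Tendsto.const_mul (a := ENNReal.ofReal C) hg (Or.inr ENNReal.ofReal_ne_top)
  rw [mul_zero] at hmul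
  exact tendsto_of_tendsto_of_tendsto_of_le_of_le tendsto_const_nhds hmul (fun m => zero_le)
    fun m => eLpNorm_le_mul_eLpNorm_of_ae_le_mul (hfg m) p

lemma tendsto_integral_of_abs_sub_le_mul {F : ℕ → X → ℝ} {G : X → ℝ} {a : ℕ → X → ℝ} {b : X → ℝ}
    (hF : ∀ m, Integrable (F m) μ) (hG : Integrable G μ) (ha : ∀ m, AEStronglyMeasurable (a m) μ)
    (hb : MemLp b 2 μ) (hlim : Tendsto (fun m => eLpNorm (a m) 2 μ) atTop (𝓝 0))
    (hle : ∀ m, ∀ᵐ x ∂μ, |F m x - G x| ≤ |a m x| * |b x|) :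
    Tendsto (fun m => ∫ x, F m x ∂μ) atTop (𝓝 (∫ x, G x ∂μ)) := by
  refine tendsto_integral_of_L1' G hG.1 (Eventually.of_forall hF) ?_
  have hmul := ENNReal.Tendsto.mul_const hlim (Or.inr hb.eLpNorm_ne_top)
  rw [zero_mul] at hmul
  refine tendsto_of_tendsto_of_tendsto_of_le_of_le tendsto_const_nhds hmul
    (fun m => zero_le) fun m => ?_
  calc eLpNorm (F m - G) 1 μ ≤ eLpNorm (a m • b) 1 μ := by
        refine eLpNorm_mono_ae ?_
        filter_upwards [hle m] with x hx
        simpa only [Pi.sub_apply, Pi.smul_apply', smul_eq_mul, Real.norm_eq_abs, abs_mul] using hx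
    _ ≤ eLpNorm (a m) 2 μ * eLpNorm b 2 μ := eLpNorm_smul_le_mul_eLpNorm hb.1 (ha m)

variable [TopologicalSpace X] [OpensMeasurableSpace X]

lemma memLp_of_continuousOn_of_le_mul {s : Set X} (hs : IsOpen s) {F G : X → ℝ} {p : ℝ≥0∞} {C : ℝ}
    (hG : MemLp G p (μ.restrict s)) (hF : ContinuousOn F s) (hle : ∀ x ∈ s, |F x| ≤ C * |G x|) :
    MemLp F p (μ.restrict s) :=
  hG.of_le_mul (hF.aestronglyMeasurable hs.measurableSet)
    (ae_restrict_of_forall_mem hs.measurableSet hle)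

lemma memLp_mul_of_continuousOn_of_abs_le {s : Set X} (hs : IsOpen s) {b v : X → ℝ} {p : ℝ≥0∞}
    {C : ℝ} (hv : MemLp v p (μ.restrict s)) (hb : ContinuousOn b s) (hC : ∀ x ∈ s, |b x| ≤ C) :
    MemLp (fun x => b x * v x) p (μ.restrict s) :=
  hv.of_le_mul ((hb.aestronglyMeasurable hs.measurableSet).mul hv.1)
    (ae_restrict_of_forall_mem hs.measurableSet fun x hx =>
      (abs_mul _ _).trans_le (mul_le_mul_of_nonneg_right (hC x hx) (abs_nonneg _)))

lemma integrableOn_of_continuousOn_of_abs_le {s : Set X} (hs : IsOpen s) {F G : X → ℝ}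
    (hG : IntegrableOn G s μ) (hF : ContinuousOn F s) (hle : ∀ x ∈ s, |F x| ≤ G x) :
    IntegrableOn F s μ :=
  hG.mono' (hF.aestronglyMeasurable hs.measurableSet)
    (ae_restrict_of_forall_mem hs.measurableSet hle)

lemma memLp_two_of_hasCompactSupport [T2Space X] [IsFiniteMeasureOnCompacts μ] {φ : X → ℝ}
    (hφ : Continuous φ) (hc : HasCompactSupport φ) : MemLp φ 2 μ := by
  rw [memLp_two_iff_integrable_sq hφ.aestronglyMeasurable]
  simp only [sq]
  exact integrable_mul_of_hasCompactSupport hφ hc hφ.continuousOn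

end LpLimits

section Sobolev

variable {n : ℕ} {M : Type*} [MetricSpace M] [ChartedSpace (Euc n) M]

lemma contMDiff_mul_of_tsupport_subset {Ω : Set M} (hΩ : IsOpen Ω) {k : WithTop ℕ∞} {f φ : M → ℝ}
    (hf : ContMDiffOn (𝓡 n) 𝓘(ℝ, ℝ) k f Ω) (hφ : ContMDiff (𝓡 n) 𝓘(ℝ, ℝ) k φ)
    (hs : tsupport φ ⊆ Ω) : ContMDiff (𝓡 n) 𝓘(ℝ, ℝ) k (fun x => f x * φ x) :=
  contMDiff_of_tsupport fun x hx =>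
    (hf.contMDiffAt (hΩ.mem_nhds (hs (tsupport_mul_subset_right hx)))).mul (hφ x)

variable [RiemannianBundle (fun x : M => TangentSpace (𝓡 n) x)]

lemma norm_grad_mul_sub_le {g w φ : M → ℝ} {p : M} {C : ℝ}
    (hg : MDifferentiableAt (𝓡 n) 𝓘(ℝ, ℝ) g p) (hw : MDifferentiableAt (𝓡 n) 𝓘(ℝ, ℝ) w p)
    (hφ : MDifferentiableAt (𝓡 n) 𝓘(ℝ, ℝ) φ p) (hgC : |g p| ≤ C) (hgradC : ‖grad n g p‖ ≤ C) :
    ‖grad n (fun x => g x * w x) p - grad n (fun x => g x * φ x) p‖ ≤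
      C * (|w p - φ p| + ‖grad n w p - grad n φ p‖) := by
  rw [grad_mul hg hw, grad_mul hg hφ,
    show g p • grad n w p + w p • grad n g p - (g p • grad n φ p + φ p • grad n g p) =
      (w p - φ p) • grad n g p + g p • (grad n w p - grad n φ p) by module, mul_add, mul_comm C]
  refine (norm_add_le _ _).trans ?_
  rw [norm_smul, norm_smul, Real.norm_eq_abs, Real.norm_eq_abs]
  gcongr

variable (n) in
/-- The commutator `[Δ, g]u = Δ(gu) - g Δu = 2∇g · ∇u + u Δg`. -/
noncomputable def lapComm (g u : M → ℝ) (x : M) : ℝ :=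
  2 * inner ℝ (grad n g x) (grad n u x) + u x * lap n g x

variable (n) in
/-- Functions of class `C²` in `Ω` which are bounded, with bounded gradient and Laplacian:
multiplication by such a function preserves `H¹₀(Ω)`. -/
structure IsBoundedC2 (Ω : Set M) (g : M → ℝ) : Prop where
  contMDiffOn : ContMDiffOn (𝓡 n) 𝓘(ℝ, ℝ) 2 g Ω
  bound : ∃ C : ℝ, ∀ x ∈ Ω, |g x| ≤ C ∧ ‖grad n g x‖ ≤ C ∧ |lap n g x| ≤ C

variable [MeasurableSpace M]

variable (n) in
/-- The `φ m` are `C¹` functions with compact support in `Ω` converging to `w` in `H¹(Ω)`. -/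
structure ApproximatesInH1 (Ω : Set M) (w : M → ℝ) (φ : ℕ → M → ℝ) : Prop where
  contMDiff : ∀ m, ContMDiff (𝓡 n) 𝓘(ℝ, ℝ) 1 (φ m)
  hasCompactSupport : ∀ m, HasCompactSupport (φ m)
  tsupport_subset : ∀ m, tsupport (φ m) ⊆ Ω
  tendsto : Tendsto (fun m => eLpNorm (fun x => w x - φ m x) 2 ((riemVolume n M).restrict Ω))
    atTop (𝓝 0)
  tendsto_grad : Tendsto (fun m => eLpNorm (fun x => ‖grad n w x - grad n (φ m) x‖) 2
    ((riemVolume n M).restrict Ω)) atTop (𝓝 0)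

variable (n) in
/-- Functions of class `C¹` in `Ω` belonging to `H¹₀(Ω)`. The approximating functions are only
required to be `C¹`, so that products with `C¹` functions are again of this kind. -/
structure IsH10 (Ω : Set M) (w : M → ℝ) : Prop where
  contMDiffOn : ContMDiffOn (𝓡 n) 𝓘(ℝ, ℝ) 1 w Ω
  exists_approx : ∃ φ : ℕ → M → ℝ, ApproximatesInH1 n Ω w φ

lemma VanishesOnBoundary.isH10 {Ω : Set M} {u : M → ℝ}
    (hu : ContMDiffOn (𝓡 n) 𝓘(ℝ, ℝ) 1 u Ω) (h : VanishesOnBoundary n Ω u) : IsH10 n Ω u := by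
  obtain ⟨φ, hφ, hlim⟩ := h
  refine ⟨hu, φ, fun m => (hφ m).smooth.of_le (by simp), fun m => (hφ m).compact,
    fun m => (hφ m).subset, ?_, ?_⟩
  · exact tendsto_eLpNorm_two_zero_of_enorm_sq_le (fun m x => le_self_add) hlim
  · refine tendsto_eLpNorm_two_zero_of_enorm_sq_le (fun m x => ?_) hlim
    rw [enorm_norm]
    exact le_add_self

lemma IsDirichletSolution.isH10 {Ω : Set M} {lam : ℝ} {u : M → ℝ}
    (hu : IsDirichletSolution n Ω lam u) : IsH10 n Ω u :=
  hu.boundary.isH10 (hu.contMDiffOn.of_le one_le_two)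

lemma isH10_of_hasCompactSupport {Ω : Set M} {φ : M → ℝ} (hφ : ContMDiff (𝓡 n) 𝓘(ℝ, ℝ) 1 φ)
    (hc : HasCompactSupport φ) (hs : tsupport φ ⊆ Ω) : IsH10 n Ω φ :=
  ⟨hφ.contMDiffOn, fun _ => φ, fun _ => hφ, fun _ => hc, fun _ => hs, by simp, by simp⟩

lemma ApproximatesInH1.isH10 {Ω : Set M} {w : M → ℝ} {φ : ℕ → M → ℝ}
    (hφ : ApproximatesInH1 n Ω w φ) (m : ℕ) : IsH10 n Ω (φ m) :=
  isH10_of_hasCompactSupport (hφ.contMDiff m) (hφ.hasCompactSupport m) (hφ.tsupport_subset m)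

variable [BorelSpace M] [IsManifold (𝓡 n) ∞ M]
  [IsContMDiffRiemannianBundle (𝓡 n) ∞ (Euc n) (fun x : M => TangentSpace (𝓡 n) x)]
  {Ω : Set M} (hΩ : IsOpen Ω)

include hΩ

lemma aestronglyMeasurable_norm_grad_sub {f h : M → ℝ} (hf : ContMDiffOn (𝓡 n) 𝓘(ℝ, ℝ) 1 f Ω)
    (hh : ContMDiffOn (𝓡 n) 𝓘(ℝ, ℝ) 1 h Ω) :
    AEStronglyMeasurable (fun x => ‖grad n f x - grad n h x‖) ((riemVolume n M).restrict Ω) := by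
  refine ((continuousOn_norm_grad hΩ (f := fun x => f x - h x) (hf.sub hh)).congr
    fun x hx => ?_).aestronglyMeasurable hΩ.measurableSet
  rw [grad_sub (mdifferentiableAt_of_contMDiffOn hΩ one_ne_zero hf hx)
    (mdifferentiableAt_of_contMDiffOn hΩ one_ne_zero hh hx)]

lemma IsH10.memLp {w : M → ℝ} (hw : IsH10 n Ω w) : MemLp w 2 ((riemVolume n M).restrict Ω) := by
  obtain ⟨φ, hφ⟩ := hw.exists_approx
  obtain ⟨m, hm⟩ := (hφ.tendsto.eventually (gt_mem_nhds ENNReal.zero_lt_top)).exists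
  have hsub : MemLp (fun x => w x - φ m x) 2 ((riemVolume n M).restrict Ω) :=
    ⟨(hw.contMDiffOn.continuousOn.sub (hφ.contMDiff m).continuous.continuousOn).aestronglyMeasurable
      hΩ.measurableSet, hm⟩
  simpa only [Pi.add_def, sub_add_cancel] using hsub.add
    ((memLp_two_of_hasCompactSupport (hφ.contMDiff m).continuous
      (hφ.hasCompactSupport m)).restrict Ω)

lemma IsH10.memLp_grad {w : M → ℝ} (hw : IsH10 n Ω w) :
    MemLp (fun x => ‖grad n w x‖) 2 ((riemVolume n M).restrict Ω) := by
  obtain ⟨φ, hφ⟩ := hw.exists_approx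
  obtain ⟨m, hm⟩ := (hφ.tendsto_grad.eventually (gt_mem_nhds ENNReal.zero_lt_top)).exists
  have hsub : MemLp (fun x => ‖grad n w x - grad n (φ m) x‖) 2 ((riemVolume n M).restrict Ω) :=
    ⟨aestronglyMeasurable_norm_grad_sub hΩ hw.contMDiffOn (hφ.contMDiff m).contMDiffOn, hm⟩
  have hcont : Continuous fun x => ‖grad n (φ m) x‖ :=
    continuousOn_univ.1 (continuousOn_norm_grad isOpen_univ (hφ.contMDiff m).contMDiffOn)
  have hsupp : HasCompactSupport fun x => ‖grad n (φ m) x‖ :=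
    HasCompactSupport.intro (hφ.hasCompactSupport m) fun x hx => by
      rw [grad_eq_zero_of_notMem_tsupport hx, norm_zero]
  refine memLp_of_continuousOn_of_le_mul (C := 1) hΩ
    (hsub.add ((memLp_two_of_hasCompactSupport hcont hsupp).restrict Ω))
    (continuousOn_norm_grad hΩ hw.contMDiffOn) fun x _ => ?_
  rw [one_mul, abs_norm, Pi.add_apply, abs_of_nonneg (by positivity)]
  exact norm_le_norm_sub_add _ _

lemma ApproximatesInH1.mul {g w : M → ℝ} {φ : ℕ → M → ℝ} (hg : IsBoundedC2 n Ω g)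
    (hw : ContMDiffOn (𝓡 n) 𝓘(ℝ, ℝ) 1 w Ω) (hφ : ApproximatesInH1 n Ω w φ) :
    ApproximatesInH1 n Ω (fun x => g x * w x) (fun m x => g x * φ m x) := by
  obtain ⟨C, hC⟩ := hg.bound
  have hg1 : ContMDiffOn (𝓡 n) 𝓘(ℝ, ℝ) 1 g Ω := hg.contMDiffOn.of_le one_le_two
  refine ⟨fun m => contMDiff_mul_of_tsupport_subset hΩ hg1 (hφ.contMDiff m) (hφ.tsupport_subset m),
    fun m => (hφ.hasCompactSupport m).mul_left,
    fun m => tsupport_mul_subset_right.trans (hφ.tsupport_subset m), ?_, ?_⟩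
  · refine tendsto_eLpNorm_zero_of_norm_le_mul (C := C)
      (fun m => ae_restrict_of_forall_mem hΩ.measurableSet fun x hx => ?_) hφ.tendsto
    rw [← mul_sub, norm_mul]
    exact mul_le_mul_of_nonneg_right (hC x hx).1 (norm_nonneg _)
  have hsum : Tendsto (fun m => eLpNorm ((fun x => |w x - φ m x|) +
      fun x => ‖grad n w x - grad n (φ m) x‖) 2 ((riemVolume n M).restrict Ω)) atTop (𝓝 0) := by
    have hadd := hφ.tendsto.add hφ.tendsto_grad
    rw [add_zero] at hadd
    refine tendsto_of_tendsto_of_tendsto_of_le_of_le tendsto_const_nhds hadd (fun m => zero_le)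
      fun m => ?_
    have hmeas : AEStronglyMeasurable (fun x => w x - φ m x) ((riemVolume n M).restrict Ω) :=
      (hw.continuousOn.sub (hφ.contMDiff m).continuous.continuousOn).aestronglyMeasurable
        hΩ.measurableSet
    refine (eLpNorm_add_le hmeas.norm (aestronglyMeasurable_norm_grad_sub hΩ hw
      (hφ.contMDiff m).contMDiffOn) one_le_two).trans_eq ?_
    rw [eLpNorm_norm]
  refine tendsto_eLpNorm_zero_of_norm_le_mul (C := C)
    (fun m => ae_restrict_of_forall_mem hΩ.measurableSet fun x hx => ?_) hsum
  rw [norm_norm, Pi.add_apply, Real.norm_of_nonneg (by positivity)]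
  exact norm_grad_mul_sub_le (mdifferentiableAt_of_contMDiffOn hΩ one_ne_zero hg1 hx)
    (mdifferentiableAt_of_contMDiffOn hΩ one_ne_zero hw hx)
    ((hφ.contMDiff m).mdifferentiableAt one_ne_zero) (hC x hx).1 (hC x hx).2.1

lemma IsH10.mul {g w : M → ℝ} (hg : IsBoundedC2 n Ω g) (hw : IsH10 n Ω w) :
    IsH10 n Ω (fun x => g x * w x) := by
  obtain ⟨φ, hφ⟩ := hw.exists_approx
  exact ⟨(hg.contMDiffOn.of_le one_le_two).mul hw.contMDiffOn, _, hφ.mul hΩ hg hw.contMDiffOn⟩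

lemma IsBoundedC2.memLp_norm_grad_mul {g u : M → ℝ} (hg : IsBoundedC2 n Ω g) (hu : IsH10 n Ω u) :
    MemLp (fun x => ‖grad n g x‖ * u x) 2 ((riemVolume n M).restrict Ω) := by
  obtain ⟨C, hC⟩ := hg.bound
  exact memLp_mul_of_continuousOn_of_abs_le hΩ (hu.memLp hΩ)
    (continuousOn_norm_grad hΩ (hg.contMDiffOn.of_le one_le_two))
    fun x hx => (abs_norm _).trans_le (hC x hx).2.1

lemma IsBoundedC2.memLp_inner_grad {g u : M → ℝ} (hg : IsBoundedC2 n Ω g) (hu : IsH10 n Ω u) :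
    MemLp (fun x => inner ℝ (grad n g x) (grad n u x)) 2 ((riemVolume n M).restrict Ω) := by
  obtain ⟨C, hC⟩ := hg.bound
  refine memLp_of_continuousOn_of_le_mul hΩ (hu.memLp_grad hΩ) (C := C)
    (continuousOn_inner_grad hΩ (hg.contMDiffOn.of_le one_le_two) hu.contMDiffOn) fun x hx => ?_
  rw [abs_norm]
  exact (abs_real_inner_le_norm _ _).trans
    (mul_le_mul_of_nonneg_right (hC x hx).2.1 (norm_nonneg _))

lemma IsBoundedC2.memLp_mul_lap {g u : M → ℝ} (hg : IsBoundedC2 n Ω g) (hu : IsH10 n Ω u) :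
    MemLp (fun x => u x * lap n g x) 2 ((riemVolume n M).restrict Ω) := by
  obtain ⟨C, hC⟩ := hg.bound
  simpa only [mul_comm] using memLp_mul_of_continuousOn_of_abs_le hΩ (hu.memLp hΩ)
    (continuousOn_lap hΩ hg.contMDiffOn) fun x hx => (hC x hx).2.2

lemma IsBoundedC2.memLp_lapComm {g u : M → ℝ} (hg : IsBoundedC2 n Ω g) (hu : IsH10 n Ω u) :
    MemLp (lapComm n g u) 2 ((riemVolume n M).restrict Ω) :=
  ((hg.memLp_inner_grad hΩ hu).const_mul 2).add (hg.memLp_mul_lap hΩ hu)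

lemma IsBoundedC2.integrable_norm_grad_pow_mul_sq {g v : M → ℝ} (hg : IsBoundedC2 n Ω g)
    (hv : IsH10 n Ω v) (m : ℕ) :
    IntegrableOn (fun x => ‖grad n g x‖ ^ m * v x ^ 2) Ω (riemVolume n M) := by
  obtain ⟨C, hC⟩ := hg.bound
  refine integrableOn_of_continuousOn_of_abs_le hΩ ((hv.memLp hΩ).integrable_sq.const_mul (C ^ m))
    (((continuousOn_norm_grad hΩ (hg.contMDiffOn.of_le one_le_two)).pow m).mul
      (hv.contMDiffOn.continuousOn.pow 2)) fun x hx => ?_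
  rw [abs_of_nonneg (by positivity)]
  gcongr
  exact (hC x hx).2.1

lemma IsH10.integrable_mul_inner_grad {b v w : M → ℝ} (hw : IsH10 n Ω w) (hb : ContinuousOn b Ω)
    (hv : ContMDiffOn (𝓡 n) 𝓘(ℝ, ℝ) 1 v Ω)
    (hbv : MemLp (fun x => b x * ‖grad n v x‖) 2 ((riemVolume n M).restrict Ω)) :
    IntegrableOn (fun x => b x * inner ℝ (grad n v x) (grad n w x)) Ω (riemVolume n M) := by
  refine integrableOn_of_continuousOn_of_abs_le hΩ (hbv.integrable_mul (hw.memLp_grad hΩ)).norm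
    (hb.mul (continuousOn_inner_grad hΩ hv hw.contMDiffOn)) fun x _ => ?_
  rw [abs_mul, Pi.mul_apply, norm_mul, norm_mul, norm_norm, norm_norm, mul_assoc]
  exact mul_le_mul_of_nonneg_left (abs_real_inner_le_norm _ _) (abs_nonneg _)

lemma ApproximatesInH1.tendsto_integral_mul {b w : M → ℝ} {φ : ℕ → M → ℝ} (hw : IsH10 n Ω w)
    (hφ : ApproximatesInH1 n Ω w φ) (hb : MemLp b 2 ((riemVolume n M).restrict Ω)) :
    Tendsto (fun m => ∫ x in Ω, b x * φ m x ∂(riemVolume n M)) atTop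
      (𝓝 (∫ x in Ω, b x * w x ∂(riemVolume n M))) := by
  have hφLp (m : ℕ) := (hφ.isH10 m).memLp hΩ
  refine tendsto_integral_of_abs_sub_le_mul (fun m => hb.integrable_mul (hφLp m))
    (hb.integrable_mul (hw.memLp hΩ)) (fun m => ((hw.memLp hΩ).sub (hφLp m)).1) hb hφ.tendsto
    fun m => Eventually.of_forall fun x => ?_
  rw [← mul_sub, abs_mul, mul_comm, Pi.sub_apply, abs_sub_comm]

lemma ApproximatesInH1.tendsto_integral_mul_inner_grad {b v w : M → ℝ} {φ : ℕ → M → ℝ}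
    (hw : IsH10 n Ω w) (hφ : ApproximatesInH1 n Ω w φ) (hb : ContinuousOn b Ω)
    (hv : ContMDiffOn (𝓡 n) 𝓘(ℝ, ℝ) 1 v Ω)
    (hbv : MemLp (fun x => b x * ‖grad n v x‖) 2 ((riemVolume n M).restrict Ω)) :
    Tendsto (fun m => ∫ x in Ω, b x * inner ℝ (grad n v x) (grad n (φ m) x) ∂(riemVolume n M))
      atTop (𝓝 (∫ x in Ω, b x * inner ℝ (grad n v x) (grad n w x) ∂(riemVolume n M))) := by
  refine tendsto_integral_of_abs_sub_le_mul
    (fun m => (hφ.isH10 m).integrable_mul_inner_grad hΩ hb hv hbv)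
    (hw.integrable_mul_inner_grad hΩ hb hv hbv)
    (fun m => aestronglyMeasurable_norm_grad_sub hΩ hw.contMDiffOn (hφ.contMDiff m).contMDiffOn)
    hbv hφ.tendsto_grad fun m => Eventually.of_forall fun x => ?_
  rw [← mul_sub, ← inner_sub_right, abs_mul, abs_mul, abs_norm, abs_norm, norm_sub_rev, mul_comm,
    mul_comm |b x|, ← mul_assoc]
  exact mul_le_mul_of_nonneg_right ((abs_real_inner_le_norm _ _).trans_eq (mul_comm _ _))
    (abs_nonneg _)

variable [SigmaCompactSpace M]

lemma setIntegral_mul_lap_mul_of_hasCompactSupport {a f φ : M → ℝ}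
    (ha : ContMDiffOn (𝓡 n) 𝓘(ℝ, ℝ) 1 a Ω) (hf : ContMDiffOn (𝓡 n) 𝓘(ℝ, ℝ) 2 f Ω)
    (hφ : ContMDiff (𝓡 n) 𝓘(ℝ, ℝ) 1 φ) (hc : HasCompactSupport φ) (hs : tsupport φ ⊆ Ω) :
    ∫ x in Ω, a x * lap n f x * φ x ∂(riemVolume n M) =
      -((∫ x in Ω, a x * inner ℝ (grad n f x) (grad n φ x) ∂(riemVolume n M)) +
        ∫ x in Ω, inner ℝ (grad n a x) (grad n f x) * φ x ∂(riemVolume n M)) := by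
  have hf1 := hf.of_le one_le_two
  have haφ := contMDiff_mul_of_tsupport_subset hΩ ha hφ hs
  have haφc : HasCompactSupport fun x => a x * φ x := hc.mul_left
  have haφs : tsupport (fun x => a x * φ x) ⊆ Ω := tsupport_mul_subset_right.trans hs
  have hlap : ∫ x in Ω, a x * lap n f x * φ x ∂(riemVolume n M) =
      ∫ x in Ω, a x * φ x * lap n f x ∂(riemVolume n M) := by
    simp only [mul_right_comm]
  have hgrad := (integrable_inner_grad hΩ hf1 haφ haφc haφs).integrableOn (s := Ω)
  have hdot : IntegrableOn (fun x => inner ℝ (grad n a x) (grad n f x) * φ x) Ω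
      (riemVolume n M) := by
    simpa only [mul_comm] using (integrable_mul_of_hasCompactSupport hφ.continuous hc
      ((continuousOn_inner_grad hΩ ha hf1).mono hs)).integrableOn
  have hproduct : ∫ x in Ω, a x * inner ℝ (grad n f x) (grad n φ x) ∂(riemVolume n M) =
      (∫ x in Ω, inner ℝ (grad n (fun x => a x * φ x) x) (grad n f x) ∂(riemVolume n M)) -
        ∫ x in Ω, inner ℝ (grad n a x) (grad n f x) * φ x ∂(riemVolume n M) := by
    rw [← integral_sub hgrad hdot]
    refine setIntegral_congr_fun hΩ.measurableSet fun x hx => ?_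
    simp only [grad_mul (mdifferentiableAt_of_contMDiffOn hΩ one_ne_zero ha hx)
      (hφ.mdifferentiableAt one_ne_zero), real_inner_comm (grad n f x), inner_add_right,
      real_inner_smul_right]
    ring
  rw [hlap, setIntegral_mul_lap hΩ hf haφ haφc haφs, hproduct]
  ring

lemma IsH10.setIntegral_mul_lap_mul {a f w : M → ℝ} (hw : IsH10 n Ω w)
    (ha : ContMDiffOn (𝓡 n) 𝓘(ℝ, ℝ) 1 a Ω) (hf : ContMDiffOn (𝓡 n) 𝓘(ℝ, ℝ) 2 f Ω)
    (hlap : MemLp (fun x => a x * lap n f x) 2 ((riemVolume n M).restrict Ω))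
    (hgrad : MemLp (fun x => a x * ‖grad n f x‖) 2 ((riemVolume n M).restrict Ω))
    (hinner : MemLp (fun x => inner ℝ (grad n a x) (grad n f x)) 2
      ((riemVolume n M).restrict Ω)) :
    ∫ x in Ω, a x * lap n f x * w x ∂(riemVolume n M) =
      -((∫ x in Ω, a x * inner ℝ (grad n f x) (grad n w x) ∂(riemVolume n M)) +
        ∫ x in Ω, inner ℝ (grad n a x) (grad n f x) * w x ∂(riemVolume n M)) := by
  obtain ⟨φ, hφ⟩ := hw.exists_approx
  have hright := ((hφ.tendsto_integral_mul_inner_grad hΩ hw ha.continuousOn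
    (hf.of_le one_le_two) hgrad).add (hφ.tendsto_integral_mul hΩ hw hinner)).neg
  exact tendsto_nhds_unique (hφ.tendsto_integral_mul hΩ hw hlap) <|
    hright.congr fun m => (setIntegral_mul_lap_mul_of_hasCompactSupport hΩ ha hf
      (hφ.contMDiff m) (hφ.hasCompactSupport m) (hφ.tsupport_subset m)).symm

lemma setIntegral_lapComm_mul {g u w : M → ℝ} (hg : IsBoundedC2 n Ω g) (hu : IsH10 n Ω u)
    (hw : IsH10 n Ω w) :
    ∫ x in Ω, lapComm n g u x * w x ∂(riemVolume n M) =
      (∫ x in Ω, inner ℝ (grad n g x) (grad n u x) * w x ∂(riemVolume n M)) -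
        ∫ x in Ω, u x * inner ℝ (grad n g x) (grad n w x) ∂(riemVolume n M) := by
  have hinner := hg.memLp_inner_grad hΩ hu
  have hlap := hg.memLp_mul_lap hΩ hu
  have hdotw : IntegrableOn (fun x => inner ℝ (grad n g x) (grad n u x) * w x) Ω
      (riemVolume n M) := hinner.integrable_mul (hw.memLp hΩ)
  have hlapw : IntegrableOn (fun x => u x * lap n g x * w x) Ω (riemVolume n M) :=
    hlap.integrable_mul (hw.memLp hΩ)
  have hparts := hw.setIntegral_mul_lap_mul hΩ hu.contMDiffOn hg.contMDiffOn hlap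
    (by simpa only [mul_comm] using hg.memLp_norm_grad_mul hΩ hu)
    (by simpa only [real_inner_comm] using hinner)
  simp only [real_inner_comm (grad n g _)] at hparts
  have hcomm : ∫ x in Ω, lapComm n g u x * w x ∂(riemVolume n M) =
      2 * (∫ x in Ω, inner ℝ (grad n g x) (grad n u x) * w x ∂(riemVolume n M)) +
        ∫ x in Ω, u x * lap n g x * w x ∂(riemVolume n M) := by
    rw [← integral_const_mul, ← integral_add (hdotw.const_mul 2) hlapw]
    exact integral_congr_ae (Eventually.of_forall fun x => by simp only [lapComm]; ring)
  rw [hcomm, hparts]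
  ring

lemma IsDirichletSolution.setIntegral_inner_grad {u w : M → ℝ} {lam : ℝ}
    (hu : IsDirichletSolution n Ω lam u) (hw : IsH10 n Ω w) :
    ∫ x in Ω, inner ℝ (grad n u x) (grad n w x) ∂(riemVolume n M) =
      lam * ∫ x in Ω, u x * w x ∂(riemVolume n M) := by
  have huH := hu.isH10
  obtain ⟨φ, hφ⟩ := hw.exists_approx
  have hleft := hφ.tendsto_integral_mul_inner_grad hΩ hw (b := fun _ => 1) continuousOn_const
    huH.contMDiffOn (by simpa only [one_mul] using huH.memLp_grad hΩ)
  simp only [one_mul] at hleft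
  refine tendsto_nhds_unique hleft
    (((hφ.tendsto_integral_mul hΩ hw (huH.memLp hΩ)).const_mul lam).congr fun m => ?_)
  have hgreen := setIntegral_mul_lap hΩ hu.contMDiffOn (hφ.contMDiff m) (hφ.hasCompactSupport m)
    (hφ.tsupport_subset m)
  simp only [real_inner_comm (grad n u _)] at hgreen
  rw [← neg_eq_iff_eq_neg.2 hgreen, ← integral_const_mul, ← integral_neg]
  refine setIntegral_congr_fun hΩ.measurableSet fun x hx => ?_
  simp only [hu.equation x hx]
  ring

end Sobolev

section Optimization

lemma sub_mul_sub_succ_nonneg {lam : ℕ+ → ℝ} (hlam : Monotone lam) (j m : ℕ+) :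
    0 ≤ (lam j - lam m) * (lam j - lam (m + 1)) := by
  rcases le_or_gt j m with hj | hj
  · exact mul_nonneg_of_nonpos_of_nonpos (sub_nonpos.2 (hlam hj))
      (sub_nonpos.2 (hlam (hj.trans (PNat.lt_add_right m 1).le)))
  · exact mul_nonneg (sub_nonneg.2 (hlam hj.le))
      (sub_nonneg.2 (hlam (PNat.add_one_le_iff.2 hj)))

lemma le_two_mul_sqrt_of_forall_sq_mul_le {K Y P : ℝ} (hY : 0 ≤ Y)
    (h : ∀ s : ℝ, s ^ 2 * K ≤ s ^ 4 * Y + P) : K ≤ 2 * Real.sqrt (P * Y) := by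
  rcases le_or_gt K 0 with hK | hK
  · exact hK.trans (by positivity)
  have hP : 0 ≤ P := by simpa using h 0
  have hquadratic (t : ℝ) : 0 ≤ Y * (t * t) + -K * t + P := by
    rcases le_or_gt 0 t with ht | ht
    · have hsqrt := h (Real.sqrt t)
      rw [show Real.sqrt t ^ 4 = (Real.sqrt t ^ 2) ^ 2 by ring, Real.sq_sqrt ht] at hsqrt
      linarith
    · have := mul_pos_of_neg_of_neg (neg_lt_zero.2 hK) ht
      nlinarith [mul_nonneg hY (mul_self_nonneg t)]
  have hdiscrim := discrim_le_zero hquadratic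
  rw [discrim] at hdiscrim
  calc K ≤ Real.sqrt (2 ^ 2 * (P * Y)) := Real.le_sqrt_of_sq_le (by linarith)
    _ = 2 * Real.sqrt (P * Y) := by rw [Real.sqrt_mul (sq_nonneg 2), Real.sqrt_sq zero_le_two]

lemma sub_sq_le_of_add_le_two_mul_sqrt {A B D : ℝ} (hB : 0 ≤ B) (hBA : B ≤ A)
    (h : A + B ≤ 2 * Real.sqrt (A * B) + D) : (A - B) ^ 2 ≤ 4 * D * A := by
  have hA := hB.trans hBA
  have hroots : Real.sqrt B ≤ Real.sqrt A := Real.sqrt_le_sqrt hBA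
  have hD : (Real.sqrt A - Real.sqrt B) ^ 2 ≤ D := by
    rw [sub_sq, Real.sq_sqrt hA, Real.sq_sqrt hB, mul_assoc, ← Real.sqrt_mul hA]
    linarith
  calc (A - B) ^ 2 = (Real.sqrt A - Real.sqrt B) ^ 2 * (Real.sqrt A + Real.sqrt B) ^ 2 := by
        rw [← mul_pow, mul_comm (_ - _), ← sq_sub_sq, Real.sq_sqrt hA, Real.sq_sqrt hB]
    _ ≤ D * (Real.sqrt A + Real.sqrt A) ^ 2 := by
        have hDnonneg := (sq_nonneg _).trans hD
        gcongr
    _ = 4 * D * A := by rw [← two_mul, mul_pow, Real.sq_sqrt hA]; ring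

end Optimization

section Spectral

lemma mul_neg_inner_le_of_hilbertBasis {ι H : Type*} [NormedAddCommGroup H] [InnerProductSpace ℝ H]
    (b : HilbertBasis ι ℝ H) {lam : ι → ℝ} {c α β : ℝ} {x y : H}
    (hxy : ∀ j, inner ℝ (b j) y = (c - lam j) * inner ℝ (b j) x)
    (hgap : ∀ j, 0 ≤ (lam j - α) * (lam j - β)) :
    ((α - c) + (β - c)) * -inner ℝ x y ≤ ‖y‖ ^ 2 + (α - c) * (β - c) * ‖x‖ ^ 2 := by
  have hyy := b.hasSum_inner_mul_inner y y
  have hxy_sum := (b.hasSum_inner_mul_inner x y).mul_left ((α - c) + (β - c))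
  have hxx := (b.hasSum_inner_mul_inner x x).mul_left ((α - c) * (β - c))
  have hnonneg := ((hyy.add hxy_sum).add hxx).nonneg fun j => by
    rw [real_inner_comm (b j) y, real_inner_comm (b j) x, hxy]
    exact (mul_nonneg (hgap j) (sq_nonneg (inner ℝ (b j) x))).trans_eq (by ring)
  rw [real_inner_self_eq_norm_sq, real_inner_self_eq_norm_sq] at hnonneg
  linarith

lemma inner_eq_integral_of_ae_eq {X : Type*} [MeasurableSpace X] {μ : Measure X}
    {F G : Lp ℝ 2 μ} {f g : X → ℝ} (hF : F =ᵐ[μ] f) (hG : G =ᵐ[μ] g) :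
    inner ℝ F G = ∫ x, g x * f x ∂μ := by
  rw [L2.inner_def]
  refine integral_congr_ae ?_
  filter_upwards [hF, hG] with x hf hg
  rw [hf, hg]
  rfl

variable {n : ℕ} {M : Type*} [MetricSpace M] [ChartedSpace (Euc n) M]
  [RiemannianBundle (fun x : M => TangentSpace (𝓡 n) x)] [MeasurableSpace M] {Ω : Set M}
  {lam : ℕ+ → ℝ} {u : ℕ+ → M → ℝ}

lemma IsDirichletEigensystem.isH10 (hu : IsDirichletEigensystem n Ω lam u) (j : ℕ+) :
    IsH10 n Ω (u j) :=
  (hu.solution j).isH10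

lemma IsDirichletEigensystem.integral_sq (hu : IsDirichletEigensystem n Ω lam u) (j : ℕ+) :
    ∫ x in Ω, u j x ^ 2 ∂(riemVolume n M) = 1 := by
  obtain ⟨b, hb⟩ := hu.orthonormal_basis
  simp only [sq]
  rw [← inner_eq_integral_of_ae_eq (hb j) (hb j), real_inner_self_eq_norm_sq,
    b.orthonormal.1 j, one_pow]

variable [BorelSpace M] [IsManifold (𝓡 n) ∞ M]
  [IsContMDiffRiemannianBundle (𝓡 n) ∞ (Euc n) (fun x : M => TangentSpace (𝓡 n) x)]
  [SigmaCompactSpace M] (hΩ : IsOpen Ω) {f g v w : M → ℝ}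

include hΩ

lemma IsDirichletSolution.setIntegral_mul_inner_grad_add {α : ℝ}
    (hv : IsDirichletSolution n Ω α v) (hg : IsBoundedC2 n Ω g) (hw : IsH10 n Ω w) :
    (∫ x in Ω, g x * inner ℝ (grad n v x) (grad n w x) ∂(riemVolume n M)) +
      ∫ x in Ω, inner ℝ (grad n g x) (grad n v x) * w x ∂(riemVolume n M) =
      α * ∫ x in Ω, g x * v x * w x ∂(riemVolume n M) := by
  obtain ⟨C, hC⟩ := hg.bound
  have hg1 := hg.contMDiffOn.of_le one_le_two
  have hvH := hv.isH10
  have hmul : IntegrableOn (fun x => g x * inner ℝ (grad n v x) (grad n w x)) Ω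
      (riemVolume n M) :=
    hw.integrable_mul_inner_grad hΩ hg1.continuousOn hvH.contMDiffOn
      (memLp_mul_of_continuousOn_of_abs_le hΩ (hvH.memLp_grad hΩ) hg1.continuousOn
        fun x hx => (hC x hx).1)
  have hdot : IntegrableOn (fun x => inner ℝ (grad n g x) (grad n v x) * w x) Ω
      (riemVolume n M) := (hg.memLp_inner_grad hΩ hvH).integrable_mul (hw.memLp hΩ)
  have hassoc : ∫ x in Ω, g x * v x * w x ∂(riemVolume n M) =
      ∫ x in Ω, v x * (g x * w x) ∂(riemVolume n M) := by simp only [mul_left_comm, mul_assoc]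
  rw [hassoc, ← hv.setIntegral_inner_grad hΩ (hw.mul hΩ hg), ← integral_add hmul hdot]
  refine setIntegral_congr_fun hΩ.measurableSet fun x hx => ?_
  simp only [grad_mul (mdifferentiableAt_of_contMDiffOn hΩ one_ne_zero hg1 hx)
    (mdifferentiableAt_of_contMDiffOn hΩ one_ne_zero hw.contMDiffOn hx), inner_add_right,
    real_inner_smul_right, real_inner_comm (grad n v x)]
  ring

lemma setIntegral_lapComm_mul_of_isDirichletSolution {α β : ℝ} (hg : IsBoundedC2 n Ω g)
    (hv : IsDirichletSolution n Ω α v) (hw : IsDirichletSolution n Ω β w) :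
    ∫ x in Ω, lapComm n g v x * w x ∂(riemVolume n M) =
      (α - β) * ∫ x in Ω, g x * v x * w x ∂(riemVolume n M) := by
  have hvH := hv.isH10
  have hwH := hw.isH10
  have hvw := hv.setIntegral_mul_inner_grad_add hΩ hg hwH
  have hwv := hw.setIntegral_mul_inner_grad_add hΩ hg hvH
  simp only [real_inner_comm (grad n v _) (grad n w _), mul_right_comm _ (w _) (v _),
    mul_comm _ (v _)] at hvw hwv
  rw [setIntegral_lapComm_mul hΩ hg hvH hwH]
  simp only [mul_comm _ (v _)]
  linarith

lemma IsH10.setIntegral_lapComm_mul_self (hg : IsBoundedC2 n Ω g) (hv : IsH10 n Ω v) :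
    ∫ x in Ω, lapComm n g v x * (g x * v x) ∂(riemVolume n M) =
      -∫ x in Ω, ‖grad n g x‖ ^ 2 * v x ^ 2 ∂(riemVolume n M) := by
  have hgv := hv.mul hΩ hg
  have hdot : IntegrableOn (fun x => inner ℝ (grad n g x) (grad n v x) * (g x * v x)) Ω
      (riemVolume n M) := (hg.memLp_inner_grad hΩ hv).integrable_mul (hgv.memLp hΩ)
  have hproduct : ∫ x in Ω, v x * inner ℝ (grad n g x) (grad n (fun y => g y * v y) x)
      ∂(riemVolume n M) =
      (∫ x in Ω, inner ℝ (grad n g x) (grad n v x) * (g x * v x) ∂(riemVolume n M)) +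
      ∫ x in Ω, ‖grad n g x‖ ^ 2 * v x ^ 2 ∂(riemVolume n M) := by
    rw [← integral_add hdot (hg.integrable_norm_grad_pow_mul_sq hΩ hv 2)]
    refine setIntegral_congr_fun hΩ.measurableSet fun x hx => ?_
    simp only [grad_mul (mdifferentiableAt_of_contMDiffOn hΩ two_ne_zero hg.contMDiffOn hx)
      (mdifferentiableAt_of_contMDiffOn hΩ one_ne_zero hv.contMDiffOn hx), inner_add_right,
      real_inner_smul_right, real_inner_self_eq_norm_sq]
    ring
  rw [setIntegral_lapComm_mul hΩ hg hv hgv, hproduct, sub_add_cancel_left]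

variable (hu : IsDirichletEigensystem n Ω lam u)

include hu

lemma IsDirichletEigensystem.integral_norm_grad_sq (j : ℕ+) :
    ∫ x in Ω, ‖grad n (u j) x‖ ^ 2 ∂(riemVolume n M) = lam j := by
  have hweak := (hu.solution j).setIntegral_inner_grad hΩ (hu.isH10 j)
  simp only [real_inner_self_eq_norm_sq, ← sq] at hweak
  rw [hweak, hu.integral_sq, mul_one]

lemma IsDirichletEigensystem.nonneg (j : ℕ+) : 0 ≤ lam j := by
  rw [← hu.integral_norm_grad_sq hΩ j]
  exact integral_nonneg fun x => sq_nonneg _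

theorem IsDirichletEigensystem.gap_mul_integral_norm_grad_sq_le (hg : IsBoundedC2 n Ω g)
    (i m : ℕ+) :
    ((lam m - lam i) + (lam (m + 1) - lam i)) *
        ∫ x in Ω, ‖grad n g x‖ ^ 2 * u i x ^ 2 ∂(riemVolume n M) ≤
      (∫ x in Ω, lapComm n g (u i) x ^ 2 ∂(riemVolume n M)) +
      (lam m - lam i) * (lam (m + 1) - lam i) *
        ∫ x in Ω, (g x * u i x) ^ 2 ∂(riemVolume n M) := by
  obtain ⟨b, hb⟩ := hu.orthonormal_basis
  have hi := hu.isH10 i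
  have hmul := (hi.mul hΩ hg).memLp hΩ
  have hcomm := hg.memLp_lapComm hΩ hi
  have hcoeff (j : ℕ+) :
      inner ℝ (b j) hcomm.toLp = (lam i - lam j) * inner ℝ (b j) hmul.toLp := by
    rw [inner_eq_integral_of_ae_eq (hb j) hcomm.coeFn_toLp,
      inner_eq_integral_of_ae_eq (hb j) hmul.coeFn_toLp,
      setIntegral_lapComm_mul_of_isDirichletSolution hΩ hg (hu.solution i) (hu.solution j)]
  have hspectral := mul_neg_inner_le_of_hilbertBasis b hcoeff
    fun j => sub_mul_sub_succ_nonneg hu.monotone j m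
  rw [← real_inner_self_eq_norm_sq, ← real_inner_self_eq_norm_sq,
    inner_eq_integral_of_ae_eq hmul.coeFn_toLp hcomm.coeFn_toLp,
    inner_eq_integral_of_ae_eq hmul.coeFn_toLp hmul.coeFn_toLp,
    inner_eq_integral_of_ae_eq hcomm.coeFn_toLp hcomm.coeFn_toLp,
    hi.setIntegral_lapComm_mul_self hΩ hg, neg_neg] at hspectral
  simpa only [sq] using hspectral

theorem IsDirichletEigensystem.gap_mul_integral_norm_grad_sq_add_le (hf : IsBoundedC2 n Ω f)
    (hg : IsBoundedC2 n Ω g) (i m : ℕ+) :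
    ((lam m - lam i) + (lam (m + 1) - lam i)) *
        ∫ x in Ω, (‖grad n f x‖ ^ 2 * u i x ^ 2 + ‖grad n g x‖ ^ 2 * u i x ^ 2)
          ∂(riemVolume n M) ≤
      (∫ x in Ω, (lapComm n f (u i) x ^ 2 + lapComm n g (u i) x ^ 2) ∂(riemVolume n M)) +
      (lam m - lam i) * (lam (m + 1) - lam i) *
        ∫ x in Ω, ((f x * u i x) ^ 2 + (g x * u i x) ^ 2) ∂(riemVolume n M) := by
  have hi := hu.isH10 i
  rw [integral_add (hf.integrable_norm_grad_pow_mul_sq hΩ hi 2)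
      (hg.integrable_norm_grad_pow_mul_sq hΩ hi 2),
    integral_add (hf.memLp_lapComm hΩ hi).integrable_sq (hg.memLp_lapComm hΩ hi).integrable_sq,
    integral_add ((hi.mul hΩ hf).memLp hΩ).integrable_sq ((hi.mul hΩ hg).memLp hΩ).integrable_sq]
  linarith [hu.gap_mul_integral_norm_grad_sq_le hΩ hf i m,
    hu.gap_mul_integral_norm_grad_sq_le hΩ hg i m]

end Spectral

section GapEstimates

variable {n : ℕ} {M : Type*} [MetricSpace M] [ChartedSpace (Euc n) M]
  [RiemannianBundle (fun x : M => TangentSpace (𝓡 n) x)]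

lemma norm_two_mul_cGradDot_add_mul_cLap_sq (g : M → ℂ) (v : M → ℝ) (x : M) :
    ‖2 * cGradDot n g v x + v x * cLap n g x‖ ^ 2 =
      lapComm n (fun y => (g y).re) v x ^ 2 + lapComm n (fun y => (g y).im) v x ^ 2 := by
  rw [Complex.sq_norm, Complex.normSq_apply]
  simp [cGradDot, cLap, lapComm, sq]

lemma norm_mul_ofReal_sq (z : ℂ) (r : ℝ) : ‖z * r‖ ^ 2 = (z.re * r) ^ 2 + (z.im * r) ^ 2 := by
  rw [Complex.sq_norm, Complex.normSq_apply]
  simp [sq]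

lemma grad_const_mul (c : ℝ) {f : M → ℝ} {p : M} (hf : MDifferentiableAt (𝓡 n) 𝓘(ℝ, ℝ) f p) :
    grad n (fun x => c * f x) p = c • grad n f p := by
  rw [grad_comp hf (differentiableAt_fun_id.const_mul c), deriv_const_mul_id']

lemma norm_grad_cos_sq_add_norm_grad_sin_sq {f : M → ℝ} {p : M}
    (hf : MDifferentiableAt (𝓡 n) 𝓘(ℝ, ℝ) f p) :
    ‖grad n (fun x => Real.cos (f x)) p‖ ^ 2 + ‖grad n (fun x => Real.sin (f x)) p‖ ^ 2 =
      ‖grad n f p‖ ^ 2 := by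
  rw [grad_comp hf Real.differentiableAt_cos, grad_comp hf Real.differentiableAt_sin,
    Real.deriv_cos, Real.deriv_sin, norm_smul, norm_smul, mul_pow, mul_pow, ← add_mul,
    Real.norm_eq_abs, Real.norm_eq_abs, sq_abs, sq_abs, neg_sq, Real.sin_sq_add_cos_sq, one_mul]

section Composition

variable [IsManifold (𝓡 n) ∞ M]
  [IsContMDiffRiemannianBundle (𝓡 n) ∞ (Euc n) (fun x : M => TangentSpace (𝓡 n) x)]
  {Ω : Set M} (hΩ : IsOpen Ω) {f : M → ℝ}

include hΩ

lemma lapComm_comp {θ : ℝ → ℝ} (hθ : ContDiff ℝ 2 θ) (hf : ContMDiffOn (𝓡 n) 𝓘(ℝ, ℝ) 2 f Ω)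
    (v : M → ℝ) {x : M} (hx : x ∈ Ω) :
    lapComm n (fun y => θ (f y)) v x =
      deriv θ (f x) * lapComm n f v x + deriv (deriv θ) (f x) * (‖grad n f x‖ ^ 2 * v x) := by
  rw [lapComm, lapComm, lap_comp hΩ hθ hf hx,
    grad_comp (mdifferentiableAt_of_contMDiffOn hΩ two_ne_zero hf hx)
      (hθ.differentiable two_ne_zero _), real_inner_smul_left]
  ring

lemma lap_const_mul (c : ℝ) (hf : ContMDiffOn (𝓡 n) 𝓘(ℝ, ℝ) 2 f Ω) {x : M} (hx : x ∈ Ω) :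
    lap n (fun y => c * f y) x = c * lap n f x := by
  rw [lap_comp (θ := fun t => c * t) hΩ (contDiff_const.mul contDiff_id) hf hx]
  simp [deriv_const_mul_id']

lemma lapComm_const_mul (c : ℝ) (hf : ContMDiffOn (𝓡 n) 𝓘(ℝ, ℝ) 2 f Ω) (v : M → ℝ) {x : M}
    (hx : x ∈ Ω) : lapComm n (fun y => c * f y) v x = c * lapComm n f v x := by
  rw [lapComm, lapComm, lap_const_mul hΩ c hf hx,
    grad_const_mul c (mdifferentiableAt_of_contMDiffOn hΩ two_ne_zero hf hx), real_inner_smul_left]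
  ring

lemma IsBoundedC2.const_mul (c : ℝ) (hf : IsBoundedC2 n Ω f) :
    IsBoundedC2 n Ω (fun x => c * f x) := by
  obtain ⟨C, hC⟩ := hf.bound
  refine ⟨contMDiffOn_const.mul hf.contMDiffOn, |c| * C, fun x hx => ?_⟩
  rw [grad_const_mul c (mdifferentiableAt_of_contMDiffOn hΩ two_ne_zero hf.contMDiffOn hx),
    lap_const_mul hΩ c hf.contMDiffOn hx, norm_smul, Real.norm_eq_abs, abs_mul, abs_mul]
  obtain ⟨hvalue, hgrad, hlap⟩ := hC x hx
  exact ⟨by gcongr, by gcongr, by gcongr⟩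

lemma IsBoundedC2.comp (hf : IsBoundedC2 n Ω f) {θ : ℝ → ℝ} (hθ : ContDiff ℝ 2 θ)
    {B₀ B₁ B₂ : ℝ} (h₀ : ∀ t, |θ t| ≤ B₀) (h₁ : ∀ t, |deriv θ t| ≤ B₁)
    (h₂ : ∀ t, |deriv (deriv θ) t| ≤ B₂) : IsBoundedC2 n Ω (fun x => θ (f x)) := by
  obtain ⟨C, hC⟩ := hf.bound
  have hB₁ : 0 ≤ B₁ := (abs_nonneg _).trans (h₁ 0)
  have hB₂ : 0 ≤ B₂ := (abs_nonneg _).trans (h₂ 0)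
  refine ⟨hθ.contMDiff.comp_contMDiffOn hf.contMDiffOn,
    max B₀ (max (B₁ * C) (B₁ * C + B₂ * C ^ 2)), fun x hx => ?_⟩
  obtain ⟨-, hgrad, hlap⟩ := hC x hx
  rw [grad_comp (mdifferentiableAt_of_contMDiffOn hΩ two_ne_zero hf.contMDiffOn hx)
    (hθ.differentiable two_ne_zero _), lap_comp hΩ hθ hf.contMDiffOn hx, norm_smul]
  refine ⟨le_max_of_le_left (h₀ _), le_max_of_le_right (le_max_of_le_left ?_),
    le_max_of_le_right (le_max_of_le_right ((abs_add_le _ _).trans ?_))⟩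
  · gcongr
    exact h₁ _
  · rw [abs_mul, abs_mul, abs_of_nonneg (sq_nonneg ‖grad n f x‖)]
    gcongr
    · exact h₁ _
    · exact h₂ _

lemma IsBoundedC2.cos (hf : IsBoundedC2 n Ω f) : IsBoundedC2 n Ω (fun x => Real.cos (f x)) :=
  hf.comp hΩ Real.contDiff_cos Real.abs_cos_le_one
    (fun t => by simpa using Real.abs_sin_le_one t)
    (fun t => by simpa using Real.abs_cos_le_one t)

lemma IsBoundedC2.sin (hf : IsBoundedC2 n Ω f) : IsBoundedC2 n Ω (fun x => Real.sin (f x)) :=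
  hf.comp hΩ Real.contDiff_sin Real.abs_sin_le_one
    (fun t => by simpa using Real.abs_cos_le_one t)
    (fun t => by simpa using Real.abs_sin_le_one t)

lemma lapComm_cos_sq_add_lapComm_sin_sq (hf : ContMDiffOn (𝓡 n) 𝓘(ℝ, ℝ) 2 f Ω) (v : M → ℝ)
    {x : M} (hx : x ∈ Ω) :
    lapComm n (fun y => Real.cos (f y)) v x ^ 2 + lapComm n (fun y => Real.sin (f y)) v x ^ 2 =
      lapComm n f v x ^ 2 + ‖grad n f x‖ ^ 4 * v x ^ 2 := by
  rw [lapComm_comp hΩ Real.contDiff_cos hf v hx, lapComm_comp hΩ Real.contDiff_sin hf v hx]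
  simp only [Real.deriv_cos', Real.deriv_sin, deriv.fun_neg]
  linear_combination (lapComm n f v x ^ 2 + ‖grad n f x‖ ^ 4 * v x ^ 2) *
    Real.sin_sq_add_cos_sq (f x)

end Composition

variable [MeasurableSpace M] [BorelSpace M] [IsManifold (𝓡 n) ∞ M]
  [IsContMDiffRiemannianBundle (𝓡 n) ∞ (Euc n) (fun x : M => TangentSpace (𝓡 n) x)]
  {Ω : Set M} (hΩ : IsOpen Ω) {f v : M → ℝ}

include hΩ

lemma IsBoundedC2.integrable_lap_sq_mul_sq (hf : IsBoundedC2 n Ω f) (hv : IsH10 n Ω v) :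
    IntegrableOn (fun x => lap n f x ^ 2 * v x ^ 2) Ω (riemVolume n M) := by
  have hsq : Integrable (fun x => (v x * lap n f x) ^ 2) ((riemVolume n M).restrict Ω) :=
    (hf.memLp_mul_lap hΩ hv).integrable_sq
  simp only [mul_pow, mul_comm (v _ ^ 2)] at hsq
  exact hsq

section CommutatorNorm

variable (hf : IsBoundedC2 n Ω f) (hf3 : ContMDiffOn (𝓡 n) 𝓘(ℝ, ℝ) 3 f Ω) {C : ℝ}
  (hC : ∀ x ∈ Ω, |inner ℝ (grad n (lap n f) x) (grad n f x)| ≤ C) (hv : IsH10 n Ω v)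

include hf3 hC hv

lemma memLp_inner_grad_lap_mul :
    MemLp (fun x => inner ℝ (grad n (lap n f) x) (grad n f x) * v x) 2
      ((riemVolume n M).restrict Ω) :=
  memLp_mul_of_continuousOn_of_abs_le hΩ (hv.memLp hΩ)
    (continuousOn_inner_grad hΩ
      (contMDiffOn_lap hΩ (k := 1) ENat.LEInfty.out (by norm_num) hf3)
      (hf3.of_le (by norm_num))) hC

lemma integrable_inner_grad_lap_mul_sq :
    IntegrableOn (fun x => inner ℝ (grad n (lap n f) x) (grad n f x) * v x ^ 2) Ω
      (riemVolume n M) := by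
  have hintegrable : IntegrableOn (fun x => inner ℝ (grad n (lap n f) x) (grad n f x) * v x * v x) Ω
      (riemVolume n M) := (memLp_inner_grad_lap_mul hΩ hf3 hC hv).integrable_mul (hv.memLp hΩ)
  simpa only [mul_assoc, ← sq] using hintegrable

variable [SigmaCompactSpace M]

include hf

lemma setIntegral_lap_sq_mul_sq :
    ∫ x in Ω, lap n f x ^ 2 * v x ^ 2 ∂(riemVolume n M) =
      -(2 * (∫ x in Ω, v x * lap n f x * inner ℝ (grad n f x) (grad n v x) ∂(riemVolume n M)) +
        ∫ x in Ω, inner ℝ (grad n (lap n f) x) (grad n f x) * v x ^ 2 ∂(riemVolume n M)) := by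
  have hlap1 : ContMDiffOn (𝓡 n) 𝓘(ℝ, ℝ) 1 (lap n f) Ω :=
    contMDiffOn_lap hΩ (k := 1) ENat.LEInfty.out (by norm_num) hf3
  have hv1 := hv.contMDiffOn
  have hvlap := hf.memLp_mul_lap hΩ hv
  have hcross := hf.memLp_inner_grad hΩ hv
  have hinner := memLp_inner_grad_lap_mul hΩ hf3 hC hv
  obtain ⟨B, hB⟩ := hf.bound
  have hlap_mul {w : M → ℝ} (hw : MemLp w 2 ((riemVolume n M).restrict Ω)) :
      MemLp (fun x => lap n f x * w x) 2 ((riemVolume n M).restrict Ω) :=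
    memLp_mul_of_continuousOn_of_abs_le hΩ hw hlap1.continuousOn fun x hx => (hB x hx).2.2
  have hgrad_mul : MemLp (fun x => ‖grad n f x‖ * (v x * lap n f x)) 2
      ((riemVolume n M).restrict Ω) :=
    memLp_mul_of_continuousOn_of_abs_le hΩ hvlap
      (continuousOn_norm_grad hΩ (hf.contMDiffOn.of_le one_le_two))
      fun x hx => (abs_norm _).trans_le (hB x hx).2.1
  have hproduct (x : M) (hx : x ∈ Ω) :
      inner ℝ (grad n (fun y => v y * lap n f y) x) (grad n f x) =
        lap n f x * inner ℝ (grad n f x) (grad n v x) +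
          inner ℝ (grad n (lap n f) x) (grad n f x) * v x := by
    rw [grad_mul (mdifferentiableAt_of_contMDiffOn hΩ one_ne_zero hv1 hx)
      (mdifferentiableAt_of_contMDiffOn hΩ one_ne_zero hlap1 hx), inner_add_left,
      real_inner_smul_left, real_inner_smul_left, real_inner_comm (grad n f x) (grad n v x)]
    ring
  have hvlap1 : ContMDiffOn (𝓡 n) 𝓘(ℝ, ℝ) 1 (fun x => v x * lap n f x) Ω := hv1.mul hlap1
  have hparts := hv.setIntegral_mul_lap_mul hΩ hvlap1 hf.contMDiffOn
    (by simpa only [mul_comm] using hlap_mul hvlap) (by simpa only [mul_comm] using hgrad_mul)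
    (((hlap_mul hcross).add hinner).ae_eq
      (ae_restrict_of_forall_mem hΩ.measurableSet fun x hx => (hproduct x hx).symm))
  have hcrossInt : IntegrableOn (fun x => v x * lap n f x * inner ℝ (grad n f x) (grad n v x)) Ω
      (riemVolume n M) := hvlap.integrable_mul hcross
  have hsecond : ∫ x in Ω, inner ℝ (grad n (fun y => v y * lap n f y) x) (grad n f x) * v x
      ∂(riemVolume n M) =
      ∫ x in Ω, (v x * lap n f x * inner ℝ (grad n f x) (grad n v x) +
        inner ℝ (grad n (lap n f) x) (grad n f x) * v x ^ 2) ∂(riemVolume n M) :=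
    setIntegral_congr_fun hΩ.measurableSet fun x hx => by simp only [hproduct x hx]; ring
  rw [hsecond, integral_add hcrossInt (integrable_inner_grad_lap_mul_sq hΩ hf3 hC hv),
    ← add_assoc, ← two_mul] at hparts
  rw [← hparts]
  exact integral_congr_ae (Eventually.of_forall fun x => by simp only; ring)

/- The mixed term of the square is evaluated by `setIntegral_lap_sq_mul_sq`, which turns the
coefficient of `∫ (Δf)² v²` from `1` into `-1`. -/
lemma setIntegral_lapComm_sq :
    ∫ x in Ω, lapComm n f v x ^ 2 ∂(riemVolume n M) =
      4 * ((∫ x in Ω, inner ℝ (grad n f x) (grad n v x) ^ 2 ∂(riemVolume n M))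
        - 1 / 4 * (∫ x in Ω, lap n f x ^ 2 * v x ^ 2 ∂(riemVolume n M))
        - 1 / 2 * (∫ x in Ω, inner ℝ (grad n (lap n f) x) (grad n f x) * v x ^ 2
            ∂(riemVolume n M))) := by
  have hvlap := hf.memLp_mul_lap hΩ hv
  have hcross := hf.memLp_inner_grad hΩ hv
  have hcrossInt : IntegrableOn (fun x => v x * lap n f x * inner ℝ (grad n f x) (grad n v x)) Ω
      (riemVolume n M) := hvlap.integrable_mul hcross
  have hsum : IntegrableOn (fun x => 4 * inner ℝ (grad n f x) (grad n v x) ^ 2 +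
      4 * (v x * lap n f x * inner ℝ (grad n f x) (grad n v x))) Ω (riemVolume n M) :=
    (hcross.integrable_sq.const_mul 4).add (hcrossInt.const_mul 4)
  have hexpand : ∫ x in Ω, lapComm n f v x ^ 2 ∂(riemVolume n M) =
      4 * (∫ x in Ω, inner ℝ (grad n f x) (grad n v x) ^ 2 ∂(riemVolume n M)) +
      4 * (∫ x in Ω, v x * lap n f x * inner ℝ (grad n f x) (grad n v x) ∂(riemVolume n M)) +
      ∫ x in Ω, lap n f x ^ 2 * v x ^ 2 ∂(riemVolume n M) := by
    rw [← integral_const_mul, ← integral_const_mul,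
      ← integral_add (hcross.integrable_sq.const_mul 4) (hcrossInt.const_mul 4),
      ← integral_add hsum (hf.integrable_lap_sq_mul_sq hΩ hv)]
    exact integral_congr_ae (Eventually.of_forall fun x => by simp only [lapComm]; ring)
  linarith [setIntegral_lap_sq_mul_sq hΩ hf hf3 hC hv]

end CommutatorNorm

variable [SigmaCompactSpace M] {lam : ℕ+ → ℝ} {u : ℕ+ → M → ℝ}
  (hu : IsDirichletEigensystem n Ω lam u)

include hu

lemma IsDirichletEigensystem.gap_mul_integral_norm_grad_sq_le_add_integral_norm_grad_pow_four
    (hf : IsBoundedC2 n Ω f) (i m : ℕ+) :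
    ((lam m - lam i) + (lam (m + 1) - lam i)) *
        ∫ x in Ω, ‖grad n f x‖ ^ 2 * u i x ^ 2 ∂(riemVolume n M) ≤
      (∫ x in Ω, lapComm n f (u i) x ^ 2 ∂(riemVolume n M)) +
      (∫ x in Ω, ‖grad n f x‖ ^ 4 * u i x ^ 2 ∂(riemVolume n M)) +
      (lam m - lam i) * (lam (m + 1) - lam i) := by
  have hi := hu.isH10 i
  have hpair := hu.gap_mul_integral_norm_grad_sq_add_le hΩ (hf.cos hΩ) (hf.sin hΩ) i m
  have hgrad : ∫ x in Ω, (‖grad n (fun y => Real.cos (f y)) x‖ ^ 2 * u i x ^ 2 +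
      ‖grad n (fun y => Real.sin (f y)) x‖ ^ 2 * u i x ^ 2) ∂(riemVolume n M) =
      ∫ x in Ω, ‖grad n f x‖ ^ 2 * u i x ^ 2 ∂(riemVolume n M) :=
    setIntegral_congr_fun hΩ.measurableSet fun x hx => by
      simp only [← add_mul, norm_grad_cos_sq_add_norm_grad_sin_sq
        (mdifferentiableAt_of_contMDiffOn hΩ two_ne_zero hf.contMDiffOn hx)]
  have hvalue : ∫ x in Ω, ((Real.cos (f x) * u i x) ^ 2 + (Real.sin (f x) * u i x) ^ 2)
      ∂(riemVolume n M) = 1 := by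
    simp only [mul_pow, ← add_mul, Real.cos_sq_add_sin_sq, one_mul, hu.integral_sq]
  rwa [hgrad, hvalue, mul_one, setIntegral_congr_fun hΩ.measurableSet fun x hx =>
    lapComm_cos_sq_add_lapComm_sin_sq hΩ hf.contMDiffOn (u i) hx,
    integral_add (hf.memLp_lapComm hΩ hi).integrable_sq
      (hf.integrable_norm_grad_pow_mul_sq hΩ hi 4)] at hpair

theorem IsDirichletEigensystem.gap_mul_integral_norm_grad_sq_le_sqrt (hf : IsBoundedC2 n Ω f)
    (i m : ℕ+) :
    ((lam (m + 1) - lam i) + (lam m - lam i)) *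
        ∫ x in Ω, ‖grad n f x‖ ^ 2 * u i x ^ 2 ∂(riemVolume n M) ≤
      2 * Real.sqrt ((lam (m + 1) - lam i) * (lam m - lam i) *
        ∫ x in Ω, ‖grad n f x‖ ^ 4 * u i x ^ 2 ∂(riemVolume n M)) +
      ∫ x in Ω, lapComm n f (u i) x ^ 2 ∂(riemVolume n M) := by
  rw [add_comm (lam (m + 1) - lam i), ← sub_le_iff_le_add]
  refine le_two_mul_sqrt_of_forall_sq_mul_le (integral_nonneg fun x => by positivity) fun s => ?_
  have hscaled :=
    hu.gap_mul_integral_norm_grad_sq_le_add_integral_norm_grad_pow_four hΩ (hf.const_mul hΩ s) i m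
  have hgrad (p : ℕ) :
      ∫ x in Ω, ‖grad n (fun y => s * f y) x‖ ^ p * u i x ^ 2 ∂(riemVolume n M) =
      |s| ^ p * ∫ x in Ω, ‖grad n f x‖ ^ p * u i x ^ 2 ∂(riemVolume n M) := by
    rw [← integral_const_mul]
    refine setIntegral_congr_fun hΩ.measurableSet fun x hx => ?_
    simp only [grad_const_mul s (mdifferentiableAt_of_contMDiffOn hΩ two_ne_zero hf.contMDiffOn hx),
      norm_smul, Real.norm_eq_abs, mul_pow, mul_assoc]
  have hcomm : ∫ x in Ω, lapComm n (fun y => s * f y) (u i) x ^ 2 ∂(riemVolume n M) =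
      s ^ 2 * ∫ x in Ω, lapComm n f (u i) x ^ 2 ∂(riemVolume n M) := by
    rw [← integral_const_mul]
    refine setIntegral_congr_fun hΩ.measurableSet fun x hx => ?_
    simp only [lapComm_const_mul hΩ s hf.contMDiffOn (u i) hx, mul_pow]
  rw [hgrad, hgrad, hcomm, sq_abs, Even.pow_abs (by decide)] at hscaled
  linarith

lemma IsDirichletEigensystem.sub_sq_le_mul_integral_lapComm_sq (hf : IsBoundedC2 n Ω f)
    (hf1 : ∀ x ∈ Ω, ‖grad n f x‖ = 1) {i m : ℕ+} (him : i ≤ m) :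
    (lam (m + 1) - lam m) ^ 2 ≤
      4 * (∫ x in Ω, lapComm n f (u i) x ^ 2 ∂(riemVolume n M)) * lam (m + 1) := by
  have hgap := hu.gap_mul_integral_norm_grad_sq_le_sqrt hΩ hf i m
  have hnorm (p : ℕ) : ∫ x in Ω, ‖grad n f x‖ ^ p * u i x ^ 2 ∂(riemVolume n M) = 1 := by
    rw [← hu.integral_sq i]
    exact setIntegral_congr_fun hΩ.measurableSet fun x hx => by
      simp only [hf1 x hx, one_pow, one_mul]
  rw [hnorm, hnorm, mul_one, mul_one] at hgap
  have hsq := sub_sq_le_of_add_le_two_mul_sqrt (sub_nonneg.2 (hu.monotone him))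
    (sub_le_sub_right (hu.monotone (PNat.lt_add_right m 1).le) _) hgap
  rw [sub_sub_sub_cancel_right] at hsq
  refine hsq.trans (mul_le_mul_of_nonneg_left (sub_le_self _ (hu.nonneg hΩ i)) ?_)
  exact mul_nonneg zero_le_four (integral_nonneg fun x => sq_nonneg _)

lemma IsDirichletEigensystem.integral_inner_grad_sq_le (hf : IsBoundedC2 n Ω f)
    (hf1 : ∀ x ∈ Ω, ‖grad n f x‖ = 1) (i : ℕ+) :
    ∫ x in Ω, inner ℝ (grad n f x) (grad n (u i) x) ^ 2 ∂(riemVolume n M) ≤ lam i := by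
  have hi := hu.isH10 i
  rw [← hu.integral_norm_grad_sq hΩ i]
  refine setIntegral_mono_on (hf.memLp_inner_grad hΩ hi).integrable_sq
    (hi.memLp_grad hΩ).integrable_sq hΩ.measurableSet fun x hx => ?_
  have hle := abs_real_inner_le_norm (grad n f x) (grad n (u i) x)
  rw [hf1 x hx, one_mul] at hle
  exact sq_le_sq.2 (hle.trans_eq (abs_norm _).symm)

end GapEstimates

section BoundedNear

variable {n : ℕ}

/-- `H` is differentiable in `O` and, near `y₀` in `O`, is bounded together with its derivative
along the vector field `X`. -/
structure IsBoundedAlong (O : Set (Euc n)) (y₀ : Euc n) (X : Fin n → Euc n → ℝ)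
    (H : Euc n → ℝ) : Prop where
  differentiableOn : DifferentiableOn ℝ H O
  isBigO : H =O[𝓝[O] y₀] fun _ => (1 : ℝ)
  isBigO_deriv : (fun y => ∑ i, X i y * partialDeriv i H y) =O[𝓝[O] y₀] fun _ => (1 : ℝ)

/-- `H` is differentiable in `O` and, near `y₀` in `O`, is bounded together with its first
derivatives. -/
structure IsBoundedC1Near (O : Set (Euc n)) (y₀ : Euc n) (H : Euc n → ℝ) : Prop where
  differentiableOn : DifferentiableOn ℝ H O
  isBigO : H =O[𝓝[O] y₀] fun _ => (1 : ℝ)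
  isBigO_partialDeriv : ∀ k, partialDeriv k H =O[𝓝[O] y₀] fun _ => (1 : ℝ)

lemma isBigO_one_mul {α : Type*} {l : Filter α} {F G : α → ℝ} (hF : F =O[l] fun _ => (1 : ℝ))
    (hG : G =O[l] fun _ => (1 : ℝ)) : (fun y => F y * G y) =O[l] fun _ => (1 : ℝ) := by
  simpa only [mul_one] using hF.mul hG

lemma isBigO_one_congr {X : Type*} [TopologicalSpace X] {s : Set X} {x : X} {F G : X → ℝ}
    (hF : F =O[𝓝[s] x] fun _ => (1 : ℝ)) (h : EqOn G F s) : G =O[𝓝[s] x] fun _ => (1 : ℝ) :=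
  hF.congr' (h.symm.eventuallyEq_of_mem self_mem_nhdsWithin) EventuallyEq.rfl

lemma isBigO_one_of_norm_le_of_tendsto {X E : Type*} [TopologicalSpace X] [NormedAddCommGroup E]
    {s : Set X} {x : X} {F : X → ℝ} {K : X → E} {L : E} (hK : Tendsto K (𝓝[s] x) (𝓝 L))
    (hF : ∀ y ∈ s, ‖F y‖ ≤ ‖K y‖) : F =O[𝓝[s] x] fun _ => (1 : ℝ) := by
  refine Asymptotics.IsBigO.trans (.of_bound 1 ?_) (hK.isBigO_one ℝ)
  filter_upwards [self_mem_nhdsWithin] with y hy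
  simpa only [one_mul] using hF y hy

variable {O : Set (Euc n)} {y₀ : Euc n} {X : Fin n → Euc n → ℝ}

lemma IsBoundedC1Near.isBoundedAlong {H : Euc n → ℝ} (hH : IsBoundedC1Near O y₀ H)
    (hX : ∀ i, X i =O[𝓝[O] y₀] fun _ => (1 : ℝ)) : IsBoundedAlong O y₀ X H :=
  ⟨hH.differentiableOn, hH.isBigO,
    .fun_sum fun i _ => isBigO_one_mul (hX i) (hH.isBigO_partialDeriv i)⟩

lemma isBoundedC1Near_iff_forall_isBoundedAlong {H : Euc n → ℝ} :
    IsBoundedC1Near O y₀ H ↔ ∀ X : Fin n → Euc n → ℝ,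
      (∀ i, X i =O[𝓝[O] y₀] fun _ => (1 : ℝ)) → IsBoundedAlong O y₀ X H := by
  refine ⟨fun h X hX => h.isBoundedAlong hX, fun h => ?_⟩
  have hzero := h (fun _ _ => 0) fun _ => Asymptotics.isBigO_zero _ _
  refine ⟨hzero.differentiableOn, hzero.isBigO, fun k => ?_⟩
  have hcoord := h (fun i _ => if i = k then 1 else 0)
    fun _ => Asymptotics.isBigO_const_const _ one_ne_zero _
  simpa using hcoord.isBigO_deriv

section Open

variable (hO : IsOpen O)

include hO

lemma IsBoundedAlong.congr {H K : Euc n → ℝ} (hH : IsBoundedAlong O y₀ X H) (h : EqOn K H O) :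
    IsBoundedAlong O y₀ X K := by
  refine ⟨hH.differentiableOn.congr h, isBigO_one_congr hH.isBigO h,
    isBigO_one_congr hH.isBigO_deriv fun y hy => ?_⟩
  simp only [partialDeriv_congr (h.eventuallyEq_of_mem (hO.mem_nhds hy))]

lemma IsBoundedAlong.mul {H K : Euc n → ℝ} (hH : IsBoundedAlong O y₀ X H)
    (hK : IsBoundedAlong O y₀ X K) : IsBoundedAlong O y₀ X (fun y => H y * K y) := by
  refine ⟨hH.differentiableOn.mul hK.differentiableOn, isBigO_one_mul hH.isBigO hK.isBigO,
    isBigO_one_congr ((isBigO_one_mul hH.isBigO hK.isBigO_deriv).add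
      (isBigO_one_mul hK.isBigO hH.isBigO_deriv)) fun y hy => ?_⟩
  simp only [Finset.mul_sum, ← Finset.sum_add_distrib]
  refine Finset.sum_congr rfl fun i _ => ?_
  rw [partialDeriv_mul (hH.differentiableOn.differentiableAt (hO.mem_nhds hy))
    (hK.differentiableOn.differentiableAt (hO.mem_nhds hy))]
  ring

lemma IsBoundedAlong.sum {ι : Type*} {s : Finset ι} {H : ι → Euc n → ℝ}
    (hH : ∀ j ∈ s, IsBoundedAlong O y₀ X (H j)) :
    IsBoundedAlong O y₀ X (fun y => ∑ j ∈ s, H j y) := by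
  refine ⟨DifferentiableOn.fun_sum fun j hj => (hH j hj).differentiableOn,
    .fun_sum fun j hj => (hH j hj).isBigO,
    isBigO_one_congr (.fun_sum fun j hj => (hH j hj).isBigO_deriv) fun y hy => ?_⟩
  rw [Finset.sum_comm]
  refine Finset.sum_congr rfl fun i _ => ?_
  rw [partialDeriv_sum s fun j hj =>
    (hH j hj).differentiableOn.differentiableAt (hO.mem_nhds hy), Finset.mul_sum]

lemma IsBoundedAlong.add {H K : Euc n → ℝ} (hH : IsBoundedAlong O y₀ X H)
    (hK : IsBoundedAlong O y₀ X K) : IsBoundedAlong O y₀ X (fun y => H y + K y) := by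
  have hsum : IsBoundedAlong O y₀ X (fun y => ∑ j : Fin 2, ![H, K] j y) :=
    .sum hO fun j _ => by fin_cases j <;> assumption
  simpa only [Fin.sum_univ_two, Matrix.cons_val_zero, Matrix.cons_val_one] using hsum

lemma IsBoundedC1Near.mul {H K : Euc n → ℝ} (hH : IsBoundedC1Near O y₀ H)
    (hK : IsBoundedC1Near O y₀ K) : IsBoundedC1Near O y₀ (fun y => H y * K y) :=
  isBoundedC1Near_iff_forall_isBoundedAlong.2 fun _ hX =>
    (hH.isBoundedAlong hX).mul hO (hK.isBoundedAlong hX)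

lemma IsBoundedC1Near.sum {ι : Type*} {s : Finset ι} {H : ι → Euc n → ℝ}
    (hH : ∀ j ∈ s, IsBoundedC1Near O y₀ (H j)) : IsBoundedC1Near O y₀ (fun y => ∑ j ∈ s, H j y) :=
  isBoundedC1Near_iff_forall_isBoundedAlong.2 fun _ hX =>
    .sum hO fun j hj => (hH j hj).isBoundedAlong hX

lemma IsBoundedAlong.partialDeriv_sum_mul {ι : Type*} {s : Finset ι} {c H : ι → Euc n → ℝ}
    {a : Fin n} (hX : ∀ i, X i =O[𝓝[O] y₀] fun _ => (1 : ℝ))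
    (hc : ∀ b ∈ s, IsBoundedC1Near O y₀ (c b))
    (hac : ∀ b ∈ s, IsBoundedC1Near O y₀ (partialDeriv a (c b)))
    (hH : ∀ b ∈ s, IsBoundedC1Near O y₀ (H b))
    (haH : ∀ b ∈ s, IsBoundedAlong O y₀ X (partialDeriv a (H b))) :
    IsBoundedAlong O y₀ X (partialDeriv a (fun y => ∑ b ∈ s, c b y * H b y)) := by
  have hproduct : ∀ b ∈ s, IsBoundedAlong O y₀ X
      (fun y => c b y * partialDeriv a (H b) y + H b y * partialDeriv a (c b) y) := fun b hb =>
    (((hc b hb).isBoundedAlong hX).mul hO (haH b hb)).add hO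
      (((hH b hb).isBoundedAlong hX).mul hO ((hac b hb).isBoundedAlong hX))
  refine (IsBoundedAlong.sum hO hproduct).congr hO fun y hy => ?_
  have hdc : ∀ b ∈ s, DifferentiableAt ℝ (c b) y := fun b hb =>
    (hc b hb).differentiableOn.differentiableAt (hO.mem_nhds hy)
  have hdH : ∀ b ∈ s, DifferentiableAt ℝ (H b) y := fun b hb =>
    (hH b hb).differentiableOn.differentiableAt (hO.mem_nhds hy)
  have hdcH : ∀ b ∈ s, DifferentiableAt ℝ (fun z => c b z * H b z) y := fun b hb =>
    (hdc b hb).mul (hdH b hb)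
  rw [partialDeriv_sum s hdcH]
  exact Finset.sum_congr rfl fun b hb => partialDeriv_mul (hdc b hb) (hdH b hb) a

lemma partialDeriv_partialDeriv {F : Euc n → ℝ} (hF : ContDiffOn ℝ 2 F O) {y : Euc n} (hy : y ∈ O)
    (i j : Fin n) : partialDeriv i (partialDeriv j F) y =
      fderiv ℝ (fderiv ℝ F) y (EuclideanSpace.single i 1) (EuclideanSpace.single j 1) := by
  have hdiff : DifferentiableAt ℝ (fderiv ℝ F) y :=
    ((hF.fderiv_of_isOpen hO (m := 1) (by norm_num)).differentiableOn
      one_ne_zero).differentiableAt (hO.mem_nhds hy)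
  change fderiv ℝ (fun z => fderiv ℝ F z (EuclideanSpace.single j 1)) y _ = _
  rw [fderiv_clm_apply hdiff (differentiableAt_const _)]
  simp

lemma partialDeriv_comm {F : Euc n → ℝ} (hF : ContDiffOn ℝ 2 F O) {y : Euc n} (hy : y ∈ O)
    (i j : Fin n) : partialDeriv i (partialDeriv j F) y = partialDeriv j (partialDeriv i F) y := by
  rw [partialDeriv_partialDeriv hO hF hy, partialDeriv_partialDeriv hO hF hy]
  exact (hF.contDiffAt (hO.mem_nhds hy)).isSymmSndFDerivAt (by simp) _ _

lemma isBoundedC1Near_partialDeriv_of_tendsto {F : Euc n → ℝ} (hF : ContDiffOn ℝ 2 F O)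
    (hlim : ∀ m : ℕ, m ≤ 2 → ∃ L, Tendsto (iteratedFDeriv ℝ m F) (𝓝[O] y₀) (𝓝 L)) (j : Fin n) :
    IsBoundedC1Near O y₀ (partialDeriv j F) := by
  obtain ⟨L₁, hL₁⟩ := hlim 1 one_le_two
  obtain ⟨L₂, hL₂⟩ := hlim 2 le_rfl
  refine ⟨(contDiffOn_partialDeriv hO (k := 1) hF (by norm_num) j).differentiableOn one_ne_zero,
    isBigO_one_of_norm_le_of_tendsto hL₁ fun y _ => ?_,
    fun k => isBigO_one_of_norm_le_of_tendsto hL₂ fun y hy => ?_⟩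
  · rw [norm_iteratedFDeriv_one]
    simpa [partialDeriv] using (fderiv ℝ F y).le_opNorm (EuclideanSpace.single j (1 : ℝ))
  · rw [partialDeriv_partialDeriv hO hF hy]
    have hle := (iteratedFDeriv ℝ 2 F y).le_opNorm
      ![EuclideanSpace.single k (1 : ℝ), EuclideanSpace.single j 1]
    simpa [iteratedFDeriv_two_apply, Fin.prod_univ_two] using hle

end Open

lemma isBoundedC1Near_of_contDiffOn {T : Set (Euc n)} (hT : IsOpen T) (hOT : O ⊆ T) (hy : y₀ ∈ T)
    {H : Euc n → ℝ} (hH : ContDiffOn ℝ 1 H T) : IsBoundedC1Near O y₀ H := by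
  have hbound (K : Euc n → ℝ) (hK : ContinuousOn K T) : K =O[𝓝[O] y₀] fun _ => (1 : ℝ) :=
    (((hK.continuousAt (hT.mem_nhds hy)).tendsto).mono_left nhdsWithin_le_nhds).isBigO_one ℝ
  exact ⟨(hH.differentiableOn one_ne_zero).mono hOT, hbound _ hH.continuousOn, fun k =>
    hbound _ (contDiffOn_partialDeriv hT (k := 0) hH (by simp) k).continuousOn⟩

end BoundedNear

section Eikonal

section Commutation

variable {n : ℕ} {O : Set (Euc n)} (hO : IsOpen O) {F : Euc n → ℝ} (hF : ContDiffOn ℝ 3 F O)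

include hO hF

lemma partialDeriv_partialDeriv_partialDeriv_comm {y : Euc n} (hy : y ∈ O) (i j k : Fin n) :
    partialDeriv i (partialDeriv k (partialDeriv j F)) y =
      partialDeriv k (partialDeriv j (partialDeriv i F)) y := by
  rw [partialDeriv_comm hO (contDiffOn_partialDeriv hO hF (by norm_num) j) hy i k]
  refine partialDeriv_congr ?_ k
  filter_upwards [hO.mem_nhds hy] with z hz
  exact partialDeriv_comm hO (hF.of_le (by norm_num)) hz i j

lemma sum_mul_partialDeriv_partialDeriv_partialDeriv {X : Fin n → Euc n → ℝ}
    (hX : ∀ i, DifferentiableOn ℝ (X i) O) (j k : Fin n) {y : Euc n} (hy : y ∈ O) :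
    ∑ i, X i y * partialDeriv i (partialDeriv k (partialDeriv j F)) y =
      partialDeriv k (fun z => ∑ i, X i z * partialDeriv j (partialDeriv i F) z) y -
        ∑ i, partialDeriv k (X i) y * partialDeriv j (partialDeriv i F) y := by
  have hdX (i) : DifferentiableAt ℝ (X i) y := (hX i).differentiableAt (hO.mem_nhds hy)
  have hdF (i) : DifferentiableAt ℝ (partialDeriv j (partialDeriv i F)) y :=
    ((contDiffOn_partialDeriv hO (k := 1) (contDiffOn_partialDeriv hO (k := 2) hF (by norm_num) i)
      (by norm_num) j).differentiableOn one_ne_zero).differentiableAt (hO.mem_nhds hy)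
  have hdprod (i) : DifferentiableAt ℝ (fun z => X i z * partialDeriv j (partialDeriv i F) z) y :=
    (hdX i).mul (hdF i)
  rw [partialDeriv_sum _ fun i _ => hdprod i, ← Finset.sum_sub_distrib]
  refine Finset.sum_congr rfl fun i _ => ?_
  rw [partialDeriv_mul (hdX i) (hdF i), partialDeriv_partialDeriv_partialDeriv_comm hO hF hy]
  ring

end Commutation

variable {n : ℕ} {O : Set (Euc n)} (hO : IsOpen O) {F : Euc n → ℝ}
  {G : Fin n → Fin n → Euc n → ℝ} (hsymm : ∀ i m y, G i m y = G m i y) {c : ℝ}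
  (heikonal : ∀ y ∈ O, ∑ i, ∑ m, G i m y * (partialDeriv m F y * partialDeriv i F y) = c)

include hO hsymm heikonal

lemma two_mul_sum_partialDeriv_of_eikonal (hF : ContDiffOn ℝ 2 F O)
    (hG : ∀ i m, DifferentiableOn ℝ (G i m) O) (j : Fin n) {y : Euc n} (hy : y ∈ O) :
    2 * ∑ i, (∑ m, G i m y * partialDeriv m F y) * partialDeriv j (partialDeriv i F) y =
      -∑ i, ∑ m, partialDeriv j (G i m) y * (partialDeriv m F y * partialDeriv i F y) := by
  have hdF (i) : DifferentiableAt ℝ (partialDeriv i F) y :=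
    ((contDiffOn_partialDeriv hO (k := 1) hF (by norm_num) i).differentiableOn
      one_ne_zero).differentiableAt (hO.mem_nhds hy)
  have hdG (i m) : DifferentiableAt ℝ (G i m) y := (hG i m).differentiableAt (hO.mem_nhds hy)
  have hdFF (m i) : DifferentiableAt ℝ (fun z => partialDeriv m F z * partialDeriv i F z) y :=
    (hdF m).mul (hdF i)
  have hdprod (i m) : DifferentiableAt ℝ
      (fun z => G i m z * (partialDeriv m F z * partialDeriv i F z)) y :=
    (hdG i m).mul (hdFF m i)
  have hderiv : ∑ i, ∑ m, (G i m y * (partialDeriv m F y * partialDeriv j (partialDeriv i F) y +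
      partialDeriv i F y * partialDeriv j (partialDeriv m F) y) +
      partialDeriv j (G i m) y * (partialDeriv m F y * partialDeriv i F y)) = 0 := by
    have hconst : partialDeriv j
        (fun z => ∑ i, ∑ m, G i m z * (partialDeriv m F z * partialDeriv i F z)) y = 0 := by
      rw [partialDeriv_congr (H := fun _ => c)
        (by filter_upwards [hO.mem_nhds hy] with z hz using heikonal z hz), partialDeriv,
        fderiv_fun_const, Pi.zero_apply, zero_apply]
    rw [← hconst, partialDeriv_sum _ fun i _ => .fun_sum fun m _ => hdprod i m]
    refine Finset.sum_congr rfl fun i _ => ?_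
    rw [partialDeriv_sum _ fun m _ => hdprod i m]
    refine Finset.sum_congr rfl fun m _ => ?_
    rw [partialDeriv_mul (hdG i m) (hdFF m i), partialDeriv_mul (hdF m) (hdF i)]
    ring
  have hswap : ∑ i, ∑ m, G i m y * (partialDeriv i F y * partialDeriv j (partialDeriv m F) y) =
      ∑ i, ∑ m, G i m y * (partialDeriv m F y * partialDeriv j (partialDeriv i F) y) := by
    rw [Finset.sum_comm]
    simp only [hsymm]
  simp only [mul_add, Finset.sum_add_distrib, hswap] at hderiv
  simp only [Finset.sum_mul, mul_assoc]
  linarith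

/-- Differentiating the eikonal equation once expresses `X(∂ⱼF)` through first derivatives of `F`;
differentiating once more and commuting derivatives bounds the third derivatives `X(∂ₖ∂ⱼF)`,
although the third derivatives of `F` themselves may be unbounded. -/
lemma isBoundedAlong_partialDeriv_partialDeriv_of_eikonal {y₀ : Euc n} (hF : ContDiffOn ℝ 3 F O)
    (hF₁ : ∀ i, IsBoundedC1Near O y₀ (partialDeriv i F))
    (hG : ∀ i m, IsBoundedC1Near O y₀ (G i m))
    (hG₁ : ∀ j i m, IsBoundedC1Near O y₀ (partialDeriv j (G i m))) (k j : Fin n) :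
    IsBoundedAlong O y₀ (fun i y => ∑ m, G i m y * partialDeriv m F y)
      (partialDeriv k (partialDeriv j F)) := by
  have hF2 (i) : ContDiffOn ℝ 2 (partialDeriv i F) O :=
    contDiffOn_partialDeriv hO hF (by norm_num) i
  set X : Fin n → Euc n → ℝ := fun i y => ∑ m, G i m y * partialDeriv m F y
  have hX (i) : IsBoundedC1Near O y₀ (X i) := .sum hO fun m _ => .mul hO (hG i m) (hF₁ m)
  set r : Euc n → ℝ := fun y =>
    ∑ i, ∑ m, partialDeriv j (G i m) y * (partialDeriv m F y * partialDeriv i F y)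
  have hr : IsBoundedC1Near O y₀ r :=
    .sum hO fun i _ => .sum hO fun m _ => .mul hO (hG₁ j i m) (.mul hO (hF₁ m) (hF₁ i))
  have hfirst : EqOn (fun y => ∑ i, X i y * partialDeriv j (partialDeriv i F) y)
      (fun y => -(1 / 2) * r y) O := fun y hy => by
    linarith [two_mul_sum_partialDeriv_of_eikonal hO hsymm heikonal (hF.of_le (by norm_num))
      (fun i m => (hG i m).differentiableOn) j hy]
  have hsecond : EqOn (fun y => ∑ i, X i y * partialDeriv i (partialDeriv k (partialDeriv j F)) y)
      (fun y => -(1 / 2) * partialDeriv k r y -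
        ∑ i, partialDeriv k (X i) y * partialDeriv j (partialDeriv i F) y) O := by
    intro y hy
    have hdr : DifferentiableAt ℝ r y := hr.differentiableOn.differentiableAt (hO.mem_nhds hy)
    simp only [sum_mul_partialDeriv_partialDeriv_partialDeriv hO hF
      (fun i => (hX i).differentiableOn) j k hy,
      partialDeriv_congr (hfirst.eventuallyEq_of_mem (hO.mem_nhds hy)),
      partialDeriv_mul (differentiableAt_const _) hdr]
    simp [partialDeriv]
  exact ⟨(contDiffOn_partialDeriv hO (k := 1) (hF2 j) (by norm_num) k).differentiableOn
    one_ne_zero, (hF₁ j).isBigO_partialDeriv k, isBigO_one_congr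
      (((hr.isBigO_partialDeriv k).const_mul_left (-(1 / 2))).sub (.fun_sum fun i _ =>
        isBigO_one_mul ((hX i).isBigO_partialDeriv k) ((hF₁ i).isBigO_partialDeriv j))) hsecond⟩

end Eikonal

section Closure

variable {n : ℕ} {M : Type*} [MetricSpace M] [ChartedSpace (Euc n) M] {Ω : Set M}

lemma tendsto_chartAt_nhdsWithin (x₀ : M) : Tendsto (chartAt (Euc n) x₀) (𝓝[Ω] x₀)
    (𝓝[chartDom x₀ Ω] (chartAt (Euc n) x₀ x₀)) := by
  have hsource : (chartAt (Euc n) x₀).source ∈ 𝓝 x₀ := chart_source_mem_nhds _ x₀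
  refine tendsto_nhdsWithin_iff.2 ⟨((chartAt (Euc n) x₀).continuousAt
    (mem_chart_source _ x₀)).tendsto.mono_left nhdsWithin_le_nhds, ?_⟩
  filter_upwards [self_mem_nhdsWithin, nhdsWithin_le_nhds hsource] with x hx hxs
  exact chart_mem_chartDom hxs hx

lemma isBigO_one_of_inChart {x₀ : M} {P : M → ℝ} (h : inChart (n := n) x₀ P
    =O[𝓝[chartDom x₀ Ω] (chartAt (Euc n) x₀ x₀)] fun _ => (1 : ℝ)) :
    P =O[𝓝[Ω] x₀] fun _ => (1 : ℝ) := by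
  refine (h.comp_tendsto (tendsto_chartAt_nhdsWithin x₀)).congr' ?_ EventuallyEq.rfl
  filter_upwards [nhdsWithin_le_nhds (chart_source_mem_nhds (Euc n) x₀)] with x hx
  exact congrArg P ((chartAt (Euc n) x₀).left_inv hx)

lemma exists_bound_of_forall_isBigO_one {X : Type*} [TopologicalSpace X] {s : Set X}
    (hs : IsCompact (closure s)) {P : X → ℝ}
    (h : ∀ x₀ ∈ closure s, P =O[𝓝[s] x₀] fun _ => (1 : ℝ)) : ∃ C, ∀ x ∈ s, |P x| ≤ C := by
  suffices hbound : ∃ C, ∀ x ∈ closure s ∩ s, |P x| ≤ C by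
    rwa [inter_eq_right.2 subset_closure] at hbound
  refine hs.induction_on (p := fun t => ∃ C, ∀ x ∈ t ∩ s, |P x| ≤ C) ⟨0, by simp⟩
    (fun t t' ht ⟨C, hC⟩ => ⟨C, fun x hx => hC x ⟨ht hx.1, hx.2⟩⟩)
    (fun t t' ⟨C, hC⟩ ⟨D, hD⟩ => ⟨max C D, fun x hx => hx.1.elim
      (fun hxt => (hC x ⟨hxt, hx.2⟩).trans (le_max_left _ _))
      fun hxt => (hD x ⟨hxt, hx.2⟩).trans (le_max_right _ _)⟩) fun x₀ hx₀ => ?_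
  obtain ⟨C, hC⟩ := (h x₀ hx₀).bound
  simp only [norm_one, mul_one, Real.norm_eq_abs] at hC
  obtain ⟨t, ht, htC⟩ := mem_nhdsWithin_iff_exists_mem_nhds_inter.1 hC
  exact ⟨t, nhdsWithin_le_nhds ht, C, fun x hx => htC hx⟩

lemma exists_bound_of_forall_isBigO_one_inChart (hcpt : IsCompact (closure Ω)) {P : M → ℝ}
    (h : ∀ x₀ ∈ closure Ω, inChart (n := n) x₀ P
      =O[𝓝[chartDom x₀ Ω] (chartAt (Euc n) x₀ x₀)] fun _ => (1 : ℝ)) :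
    ∃ C, ∀ x ∈ Ω, |P x| ≤ C :=
  exists_bound_of_forall_isBigO_one hcpt fun x₀ hx₀ => isBigO_one_of_inChart (h x₀ hx₀)

lemma isBoundedC1Near_of_contDiffOn_target (x₀ : M) {H : Euc n → ℝ}
    (hH : ContDiffOn ℝ ∞ H (chartAt (Euc n) x₀).target) :
    IsBoundedC1Near (chartDom x₀ Ω) (chartAt (Euc n) x₀ x₀) H :=
  isBoundedC1Near_of_contDiffOn (chartAt (Euc n) x₀).open_target inter_subset_left
    (mem_chart_target _ x₀) (hH.of_le ENat.LEInfty.out)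

lemma C3C2Closure.clm_comp [IsManifold (𝓡 n) ∞ M] (hΩ : IsOpen Ω) {E F : Type*}
    [NormedAddCommGroup E] [NormedSpace ℝ E] [NormedAddCommGroup F] [NormedSpace ℝ F] {g : M → E}
    (hg : C3C2Closure n Ω g) (A : E →L[ℝ] F) : C3C2Closure n Ω (fun x => A (g x)) := by
  refine ⟨A.contMDiff.comp_contMDiffOn hg.contMDiffOn, fun x₀ hx₀ m hm => ?_⟩
  obtain ⟨L, hL⟩ := hg.limits x₀ hx₀ m hm
  have hlim := ((ContinuousLinearMap.compContinuousMultilinearMapL ℝ (fun _ : Fin m => Euc n) E F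
    A).continuous.tendsto L).comp hL
  refine ⟨A.compContinuousMultilinearMap L, hlim.congr' ?_⟩
  filter_upwards [self_mem_nhdsWithin] with y hy
  exact (A.iteratedFDeriv_comp_left
    ((contDiffOn_comp_chartAt_symm x₀ ENat.LEInfty.out hg.contMDiffOn).contDiffAt
      ((isOpen_chartDom x₀ hΩ).mem_nhds hy))
    (by exact_mod_cast hm.trans (by norm_num))).symm

end Closure

section ClosureBounds

section Regularity

variable {n : ℕ} {M : Type*} [MetricSpace M] [ChartedSpace (Euc n) M] {Ω : Set M} {f : M → ℝ}
  (hf : C3C2Closure n Ω f)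

include hf

lemma C3C2Closure.exists_bound (hcpt : IsCompact (closure Ω)) : ∃ C, ∀ x ∈ Ω, |f x| ≤ C :=
  exists_bound_of_forall_isBigO_one_inChart hcpt fun x₀ hx₀ =>
    let ⟨_, hL⟩ := hf.limits x₀ hx₀ 0 zero_le_two
    isBigO_one_of_norm_le_of_tendsto hL fun _ _ => norm_iteratedFDeriv_zero.ge

lemma C3C2Closure.isBoundedC1Near_partialDeriv [IsManifold (𝓡 n) ∞ M] (hΩ : IsOpen Ω) {x₀ : M}
    (hx₀ : x₀ ∈ closure Ω) (j : Fin n) :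
    IsBoundedC1Near (chartDom x₀ Ω) (chartAt (Euc n) x₀ x₀) (partialDeriv j (inChart x₀ f)) :=
  isBoundedC1Near_partialDeriv_of_tendsto (isOpen_chartDom x₀ hΩ)
    (contDiffOn_inChart x₀ ENat.LEInfty.out (hf.contMDiffOn.of_le (by norm_num)))
    (hf.limits x₀ hx₀) j

end Regularity

section Riemannian

variable {n : ℕ} {M : Type*} [MetricSpace M] [ChartedSpace (Euc n) M]
  [RiemannianBundle (fun x : M => TangentSpace (𝓡 n) x)] [IsManifold (𝓡 n) ∞ M]
  [IsContMDiffRiemannianBundle (𝓡 n) ∞ (Euc n) (fun x : M => TangentSpace (𝓡 n) x)] {Ω : Set M}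

lemma isBoundedC1Near_inv_volDensity (x₀ : M) :
    IsBoundedC1Near (chartDom x₀ Ω) (chartAt (Euc n) x₀ x₀) (fun y => (volDensity x₀ y)⁻¹) :=
  isBoundedC1Near_of_contDiffOn_target x₀
    ((contDiffOn_volDensity x₀).inv fun _ hy => (volDensity_pos x₀ hy).ne')

variable (hΩ : IsOpen Ω) {f : M → ℝ} (hf : C3C2Closure n Ω f)

include hΩ hf

lemma C3C2Closure.isBoundedC1Near_gradCoord {x₀ : M} (hx₀ : x₀ ∈ closure Ω) (i : Fin n) :
    IsBoundedC1Near (chartDom x₀ Ω) (chartAt (Euc n) x₀ x₀) (gradCoord x₀ f i) :=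
  .sum (isOpen_chartDom x₀ hΩ) fun j _ => .mul (isOpen_chartDom x₀ hΩ)
    (isBoundedC1Near_of_contDiffOn_target x₀ (contDiffOn_gram_inv x₀ i j))
    (hf.isBoundedC1Near_partialDeriv hΩ hx₀ j)

lemma C3C2Closure.exists_bound_norm_grad (hcpt : IsCompact (closure Ω)) :
    ∃ C, ∀ x ∈ Ω, ‖grad n f x‖ ≤ C := by
  obtain ⟨C, hC⟩ := exists_bound_of_forall_isBigO_one_inChart (n := n) hcpt
    (P := fun x => inner ℝ (grad n f x) (grad n f x)) fun x₀ hx₀ =>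
      isBigO_one_congr (.fun_sum fun i _ =>
        isBigO_one_mul (hf.isBoundedC1Near_partialDeriv hΩ hx₀ i).isBigO
          (hf.isBoundedC1Near_gradCoord hΩ hx₀ i).isBigO) fun y hy =>
        have hfd := mdifferentiableAt_of_contMDiffOn hΩ three_ne_zero hf.contMDiffOn hy.2
        inner_grad_inChart x₀ hy.1 hfd hfd
  refine ⟨√C, fun x hx => Real.le_sqrt_of_sq_le ?_⟩
  rw [← real_inner_self_eq_norm_sq]
  exact (le_abs_self _).trans (hC x hx)

section Borel

variable [MeasurableSpace M] [BorelSpace M]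

lemma C3C2Closure.inChart_lap (x₀ : M) :
    EqOn (inChart x₀ (lap n f))
      (fun y : Euc n => (volDensity x₀ y)⁻¹ * ∑ i, partialDeriv i (gradFlux x₀ f i) y)
      (chartDom x₀ Ω) :=
  fun _ hy => lap_chart_symm hΩ (hf.contMDiffOn.of_le (by norm_num)) x₀ hy

lemma C3C2Closure.exists_bound_lap (hcpt : IsCompact (closure Ω)) :
    ∃ C, ∀ x ∈ Ω, |lap n f x| ≤ C := by
  refine exists_bound_of_forall_isBigO_one_inChart (n := n) hcpt fun x₀ hx₀ =>
    isBigO_one_congr (isBigO_one_mul (isBoundedC1Near_inv_volDensity x₀).isBigO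
      (.fun_sum fun i _ => ?_)) (hf.inChart_lap hΩ x₀)
  exact ((isBoundedC1Near_of_contDiffOn_target x₀ (contDiffOn_volDensity x₀)).mul
    (isOpen_chartDom x₀ hΩ) (hf.isBoundedC1Near_gradCoord hΩ hx₀ i)).isBigO_partialDeriv i

lemma C3C2Closure.isBoundedC2 (hcpt : IsCompact (closure Ω)) : IsBoundedC2 n Ω f := by
  obtain ⟨A, hA⟩ := hf.exists_bound hcpt
  obtain ⟨B, hB⟩ := hf.exists_bound_norm_grad hΩ hcpt
  obtain ⟨C, hC⟩ := hf.exists_bound_lap hΩ hcpt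
  exact ⟨hf.contMDiffOn.of_le (by norm_num), max A (max B C), fun x hx =>
    ⟨le_max_of_le_left (hA x hx), le_max_of_le_right (le_max_of_le_left (hB x hx)),
      le_max_of_le_right (le_max_of_le_right (hC x hx))⟩⟩

end Borel

variable (hf1 : ∀ x ∈ Ω, ‖grad n f x‖ = 1)

include hf1

lemma C3C2Closure.isBoundedAlong_partialDeriv_partialDeriv {x₀ : M} (hx₀ : x₀ ∈ closure Ω)
    (k j : Fin n) : IsBoundedAlong (chartDom x₀ Ω) (chartAt (Euc n) x₀ x₀) (gradCoord x₀ f)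
      (partialDeriv k (partialDeriv j (inChart x₀ f))) :=
  isBoundedAlong_partialDeriv_partialDeriv_of_eikonal (isOpen_chartDom x₀ hΩ)
    (fun i m y => gram_inv_symm x₀ y i m)
    (fun y hy => by rw [← norm_grad_inChart_sq x₀ hy.1 (mdifferentiableAt_of_contMDiffOn hΩ
      three_ne_zero hf.contMDiffOn hy.2), hf1 _ hy.2, one_pow])
    (contDiffOn_inChart x₀ ENat.LEInfty.out hf.contMDiffOn)
    (hf.isBoundedC1Near_partialDeriv hΩ hx₀)
    (fun i m => isBoundedC1Near_of_contDiffOn_target x₀ (contDiffOn_gram_inv x₀ i m))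
    (fun l i m => isBoundedC1Near_of_contDiffOn_target x₀ (contDiffOn_partialDeriv
      (chartAt (Euc n) x₀).open_target (contDiffOn_gram_inv x₀ i m) (by simp) l)) k j

lemma C3C2Closure.isBoundedAlong_partialDeriv_gradFlux {x₀ : M} (hx₀ : x₀ ∈ closure Ω)
    (a : Fin n) : IsBoundedAlong (chartDom x₀ Ω) (chartAt (Euc n) x₀ x₀) (gradCoord x₀ f)
      (partialDeriv a (gradFlux x₀ f a)) := by
  have hcoeff (b) : ContDiffOn ℝ ∞ (fun y => volDensity x₀ y * (gram x₀ y)⁻¹ a b)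
      (chartAt (Euc n) x₀).target :=
    (contDiffOn_volDensity x₀).mul (contDiffOn_gram_inv x₀ a b)
  have hflux : gradFlux x₀ f a = fun y =>
      ∑ b, volDensity x₀ y * (gram x₀ y)⁻¹ a b * partialDeriv b (inChart x₀ f) y := by
    funext y
    simp only [gradFlux, gradCoord, Finset.mul_sum, mul_assoc]
  rw [hflux]
  exact .partialDeriv_sum_mul (isOpen_chartDom x₀ hΩ)
    (fun i => (hf.isBoundedC1Near_gradCoord hΩ hx₀ i).isBigO)
    (fun b _ => isBoundedC1Near_of_contDiffOn_target x₀ (hcoeff b))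
    (fun b _ => isBoundedC1Near_of_contDiffOn_target x₀ (contDiffOn_partialDeriv
      (chartAt (Euc n) x₀).open_target (hcoeff b) (by simp) a))
    (fun b _ => hf.isBoundedC1Near_partialDeriv hΩ hx₀ b)
    fun b _ => hf.isBoundedAlong_partialDeriv_partialDeriv hΩ hf1 hx₀ a b

variable [MeasurableSpace M] [BorelSpace M]

lemma C3C2Closure.exists_bound_inner_grad_lap (hcpt : IsCompact (closure Ω)) :
    ∃ C, ∀ x ∈ Ω, |inner ℝ (grad n (lap n f) x) (grad n f x)| ≤ C := by
  have hlap : ContMDiffOn (𝓡 n) 𝓘(ℝ, ℝ) 1 (lap n f) Ω :=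
    contMDiffOn_lap hΩ (k := 1) (l := 3) ENat.LEInfty.out (by norm_num) hf.contMDiffOn
  refine exists_bound_of_forall_isBigO_one_inChart (n := n) hcpt fun x₀ hx₀ => ?_
  have hO := isOpen_chartDom (n := n) x₀ hΩ
  have hbound : IsBoundedAlong (chartDom x₀ Ω) (chartAt (Euc n) x₀ x₀) (gradCoord x₀ f)
      (inChart x₀ (lap n f)) :=
    (((isBoundedC1Near_inv_volDensity x₀).isBoundedAlong fun i =>
      (hf.isBoundedC1Near_gradCoord hΩ hx₀ i).isBigO).mul hO
        (.sum hO fun a _ => hf.isBoundedAlong_partialDeriv_gradFlux hΩ hf1 hx₀ a)).congr hO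
          (hf.inChart_lap hΩ x₀)
  refine isBigO_one_congr hbound.isBigO_deriv fun y hy => ?_
  refine (inner_grad_inChart x₀ hy.1 (mdifferentiableAt_of_contMDiffOn hΩ one_ne_zero hlap hy.2)
    (mdifferentiableAt_of_contMDiffOn hΩ three_ne_zero hf.contMDiffOn hy.2)).trans ?_
  exact Finset.sum_congr rfl fun i _ => mul_comm _ _

end Riemannian

end ClosureBounds

lemma gap_bounds_of_sq_le {d D I a b Λ l : ℝ} (hl : 0 ≤ l) (hD : 0 ≤ D) (hI : I ≤ Λ)
    (hDI : D = 4 * (I - a - b)) (h : d ^ 2 ≤ 4 * D * l) :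
    d ^ 2 ≤ 16 * (I - a - b) * l ∧ 0 ≤ Λ - a - b ∧ d ^ 2 ≤ 16 * (Λ - a - b) * l ∧
      d ≤ 4 * Real.sqrt (Λ - a - b) * Real.sqrt l := by
  have hgap : d ^ 2 ≤ 16 * (I - a - b) * l := h.trans_eq (by rw [hDI]; ring)
  have hgapΛ : d ^ 2 ≤ 16 * (Λ - a - b) * l := hgap.trans (by gcongr)
  have hΛ : 0 ≤ Λ - a - b := by linarith
  refine ⟨hgap, hΛ, hgapΛ, le_of_sq_le_sq (hgapΛ.trans_eq ?_) (by positivity)⟩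
  rw [mul_pow, mul_pow, Real.sq_sqrt hΛ, Real.sq_sqrt hl]
  norm_num

end RiemDirichlet

open RiemDirichlet in
theorem mainTheorem2_general {n : ℕ} {M : Type*} [MetricSpace M] [ChartedSpace (Euc n) M]
    [IsManifold (𝓡 n) ∞ M]
    [RiemannianBundle (fun x : M => TangentSpace (𝓡 n) x)]
    [IsContMDiffRiemannianBundle (𝓡 n) ∞ (Euc n) (fun x : M => TangentSpace (𝓡 n) x)]
    [SigmaCompactSpace M] [MeasurableSpace M] [BorelSpace M]
    (Ω : Set M) (hΩ : IsOpen Ω) (hcpt : IsCompact (closure Ω))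
    (lam : ℕ+ → ℝ) (u : ℕ+ → M → ℝ) (hu : IsDirichletEigensystem n Ω lam u)
    (i m : ℕ+) (him : i ≤ m) :
    (∀ g : M → ℂ, C3C2Closure n Ω g →
      IntegrableOn (fun x => cGradSq n g x * u i x ^ 2) Ω (riemVolume n M) ∧
      IntegrableOn (fun x => ‖2 * cGradDot n g (u i) x + u i x * cLap n g x‖ ^ 2) Ω
        (riemVolume n M) ∧
      IntegrableOn (fun x => ‖g x * u i x‖ ^ 2) Ω (riemVolume n M) ∧
      ((lam m - lam i) + (lam (m + 1) - lam i)) *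
          ∫ x in Ω, cGradSq n g x * u i x ^ 2 ∂(riemVolume n M) ≤
        (∫ x in Ω, ‖2 * cGradDot n g (u i) x + u i x * cLap n g x‖ ^ 2 ∂(riemVolume n M)) +
        (lam m - lam i) * (lam (m + 1) - lam i) *
          ∫ x in Ω, ‖g x * u i x‖ ^ 2 ∂(riemVolume n M)) ∧
    (∀ f : M → ℝ, C3C2Closure n Ω f →
      IntegrableOn (fun x => ‖grad n f x‖ ^ 2 * u i x ^ 2) Ω (riemVolume n M) ∧
      IntegrableOn (fun x => ‖grad n f x‖ ^ 4 * u i x ^ 2) Ω (riemVolume n M) ∧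
      IntegrableOn (fun x => (2 * inner ℝ (grad n f x) (grad n (u i) x) + u i x * lap n f x) ^ 2)
        Ω (riemVolume n M) ∧
      ((lam (m + 1) - lam i) + (lam m - lam i)) *
          ∫ x in Ω, ‖grad n f x‖ ^ 2 * u i x ^ 2 ∂(riemVolume n M) ≤
        2 * Real.sqrt ((lam (m + 1) - lam i) * (lam m - lam i) *
          ∫ x in Ω, ‖grad n f x‖ ^ 4 * u i x ^ 2 ∂(riemVolume n M)) +
        ∫ x in Ω, (2 * inner ℝ (grad n f x) (grad n (u i) x) + u i x * lap n f x) ^ 2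
          ∂(riemVolume n M)) ∧
    (∀ f : M → ℝ, C3C2Closure n Ω f → (∀ x ∈ Ω, ‖grad n f x‖ ^ 2 = 1) →
      IntegrableOn (fun x => inner ℝ (grad n f x) (grad n (u i) x) ^ 2) Ω (riemVolume n M) ∧
      IntegrableOn (fun x => lap n f x ^ 2 * u i x ^ 2) Ω (riemVolume n M) ∧
      IntegrableOn (fun x => inner ℝ (grad n (lap n f) x) (grad n f x) * u i x ^ 2) Ω
        (riemVolume n M) ∧
      (lam (m + 1) - lam m) ^ 2 ≤
        16 * ((∫ x in Ω, inner ℝ (grad n f x) (grad n (u i) x) ^ 2 ∂(riemVolume n M))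
          - 1 / 4 * (∫ x in Ω, lap n f x ^ 2 * u i x ^ 2 ∂(riemVolume n M))
          - 1 / 2 * (∫ x in Ω, inner ℝ (grad n (lap n f) x) (grad n f x) * u i x ^ 2
              ∂(riemVolume n M))) * lam (m + 1) ∧
      0 ≤ lam i
          - 1 / 4 * (∫ x in Ω, lap n f x ^ 2 * u i x ^ 2 ∂(riemVolume n M))
          - 1 / 2 * (∫ x in Ω, inner ℝ (grad n (lap n f) x) (grad n f x) * u i x ^ 2
              ∂(riemVolume n M)) ∧
      (lam (m + 1) - lam m) ^ 2 ≤
        16 * (lam i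
          - 1 / 4 * (∫ x in Ω, lap n f x ^ 2 * u i x ^ 2 ∂(riemVolume n M))
          - 1 / 2 * (∫ x in Ω, inner ℝ (grad n (lap n f) x) (grad n f x) * u i x ^ 2
              ∂(riemVolume n M))) * lam (m + 1) ∧
      lam (m + 1) - lam m ≤
        4 * Real.sqrt (lam i
          - 1 / 4 * (∫ x in Ω, lap n f x ^ 2 * u i x ^ 2 ∂(riemVolume n M))
          - 1 / 2 * (∫ x in Ω, inner ℝ (grad n (lap n f) x) (grad n f x) * u i x ^ 2
              ∂(riemVolume n M))) * Real.sqrt (lam (m + 1))) := by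
  have hi := hu.isH10 i
  refine ⟨fun g hg => ?_, fun f hf => ?_, fun f hf hf1 => ?_⟩
  · have hre := (hg.clm_comp hΩ Complex.reCLM).isBoundedC2 hΩ hcpt
    have him := (hg.clm_comp hΩ Complex.imCLM).isBoundedC2 hΩ hcpt
    simp only [cGradSq, add_mul (‖grad n (fun y => (g y).re) _‖ ^ 2),
      norm_two_mul_cGradDot_add_mul_cLap_sq, norm_mul_ofReal_sq]
    exact ⟨(hre.integrable_norm_grad_pow_mul_sq hΩ hi 2).add
        (him.integrable_norm_grad_pow_mul_sq hΩ hi 2),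
      (hre.memLp_lapComm hΩ hi).integrable_sq.add (him.memLp_lapComm hΩ hi).integrable_sq,
      ((hi.mul hΩ hre).memLp hΩ).integrable_sq.add ((hi.mul hΩ him).memLp hΩ).integrable_sq,
      hu.gap_mul_integral_norm_grad_sq_add_le hΩ hre him i m⟩
  · have hf2 := hf.isBoundedC2 hΩ hcpt
    exact ⟨hf2.integrable_norm_grad_pow_mul_sq hΩ hi 2, hf2.integrable_norm_grad_pow_mul_sq hΩ hi 4,
      (hf2.memLp_lapComm hΩ hi).integrable_sq, hu.gap_mul_integral_norm_grad_sq_le_sqrt hΩ hf2 i m⟩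
  · have hf2 := hf.isBoundedC2 hΩ hcpt
    have heikonal (x : M) (hx : x ∈ Ω) : ‖grad n f x‖ = 1 :=
      (pow_eq_one_iff_of_nonneg (norm_nonneg _) two_ne_zero).1 (hf1 x hx)
    obtain ⟨C, hC⟩ := hf.exists_bound_inner_grad_lap hΩ heikonal hcpt
    exact ⟨(hf2.memLp_inner_grad hΩ hi).integrable_sq, hf2.integrable_lap_sq_mul_sq hΩ hi,
      integrable_inner_grad_lap_mul_sq hΩ hf.contMDiffOn hC hi,
      gap_bounds_of_sq_le (hu.nonneg hΩ (m + 1)) (integral_nonneg fun x => sq_nonneg _)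
        (hu.integral_inner_grad_sq_le hΩ hf2 heikonal i)
        (setIntegral_lapComm_sq hΩ hf2 hf.contMDiffOn hC hi)
        (hu.sub_sq_le_mul_integral_lapComm_sq hΩ hf2 heikonal him)⟩

open RiemDirichlet in
theorem mainTheorem2 {n : ℕ} {M : Type*} [MetricSpace M] [ChartedSpace (Euc n) M]
    [IsManifold (𝓡 n) ∞ M]
    [RiemannianBundle (fun x : M => TangentSpace (𝓡 n) x)]
    [IsContMDiffRiemannianBundle (𝓡 n) ∞ (Euc n) (fun x : M => TangentSpace (𝓡 n) x)]
    [IsRiemannianManifold (𝓡 n) M] [CompleteSpace M]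
    [MeasurableSpace M] [BorelSpace M]
    (Ω : Set M) (hΩ_open : IsOpen Ω) (hΩ_conn : IsConnected Ω)
    (hΩ_bdd : Bornology.IsBounded Ω)
    (lam : ℕ+ → ℝ) (u : ℕ+ → M → ℝ) (hu : IsDirichletEigensystem n Ω lam u)
    (i k : ℕ+) (hik : i < k) :
    -- the inequality for a complex-valued function `g`
    (∀ g : M → ℂ, C3C2Closure n Ω g →
      IntegrableOn (fun x => cGradSq n g x * u i x ^ 2) Ω (riemVolume n M) ∧
      IntegrableOn (fun x => ‖2 * cGradDot n g (u i) x + u i x * cLap n g x‖ ^ 2) Ω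
        (riemVolume n M) ∧
      IntegrableOn (fun x => ‖g x * u i x‖ ^ 2) Ω (riemVolume n M) ∧
      ((lam (k + 1) - lam i) + (lam (k + 2) - lam i)) *
          ∫ x in Ω, cGradSq n g x * u i x ^ 2 ∂(riemVolume n M) ≤
        (∫ x in Ω, ‖2 * cGradDot n g (u i) x + u i x * cLap n g x‖ ^ 2 ∂(riemVolume n M)) +
        (lam (k + 1) - lam i) * (lam (k + 2) - lam i) *
          ∫ x in Ω, ‖g x * u i x‖ ^ 2 ∂(riemVolume n M)) ∧
    -- the inequality for a real-valued function `f`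
    (∀ f : M → ℝ, C3C2Closure n Ω f →
      IntegrableOn (fun x => ‖grad n f x‖ ^ 2 * u i x ^ 2) Ω (riemVolume n M) ∧
      IntegrableOn (fun x => ‖grad n f x‖ ^ 4 * u i x ^ 2) Ω (riemVolume n M) ∧
      IntegrableOn (fun x => (2 * inner ℝ (grad n f x) (grad n (u i) x) + u i x * lap n f x) ^ 2)
        Ω (riemVolume n M) ∧
      ((lam (k + 2) - lam i) + (lam (k + 1) - lam i)) *
          ∫ x in Ω, ‖grad n f x‖ ^ 2 * u i x ^ 2 ∂(riemVolume n M) ≤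
        2 * Real.sqrt ((lam (k + 2) - lam i) * (lam (k + 1) - lam i) *
          ∫ x in Ω, ‖grad n f x‖ ^ 4 * u i x ^ 2 ∂(riemVolume n M)) +
        ∫ x in Ω, (2 * inner ℝ (grad n f x) (grad n (u i) x) + u i x * lap n f x) ^ 2
          ∂(riemVolume n M)) ∧
    -- the gap estimates for a real-valued function `f` with `|∇f| = 1`
    (∀ f : M → ℝ, C3C2Closure n Ω f → (∀ x ∈ Ω, ‖grad n f x‖ ^ 2 = 1) →
      IntegrableOn (fun x => inner ℝ (grad n f x) (grad n (u i) x) ^ 2) Ω (riemVolume n M) ∧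
      IntegrableOn (fun x => lap n f x ^ 2 * u i x ^ 2) Ω (riemVolume n M) ∧
      IntegrableOn (fun x => inner ℝ (grad n (lap n f) x) (grad n f x) * u i x ^ 2) Ω
        (riemVolume n M) ∧
      (lam (k + 2) - lam (k + 1)) ^ 2 ≤
        16 * ((∫ x in Ω, inner ℝ (grad n f x) (grad n (u i) x) ^ 2 ∂(riemVolume n M))
          - 1 / 4 * (∫ x in Ω, lap n f x ^ 2 * u i x ^ 2 ∂(riemVolume n M))
          - 1 / 2 * (∫ x in Ω, inner ℝ (grad n (lap n f) x) (grad n f x) * u i x ^ 2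
              ∂(riemVolume n M))) * lam (k + 2) ∧
      0 ≤ lam i
          - 1 / 4 * (∫ x in Ω, lap n f x ^ 2 * u i x ^ 2 ∂(riemVolume n M))
          - 1 / 2 * (∫ x in Ω, inner ℝ (grad n (lap n f) x) (grad n f x) * u i x ^ 2
              ∂(riemVolume n M)) ∧
      (lam (k + 2) - lam (k + 1)) ^ 2 ≤
        16 * (lam i
          - 1 / 4 * (∫ x in Ω, lap n f x ^ 2 * u i x ^ 2 ∂(riemVolume n M))
          - 1 / 2 * (∫ x in Ω, inner ℝ (grad n (lap n f) x) (grad n f x) * u i x ^ 2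
              ∂(riemVolume n M))) * lam (k + 2) ∧
      lam (k + 2) - lam (k + 1) ≤
        4 * Real.sqrt (lam i
          - 1 / 4 * (∫ x in Ω, lap n f x ^ 2 * u i x ^ 2 ∂(riemVolume n M))
          - 1 / 2 * (∫ x in Ω, inner ℝ (grad n (lap n f) x) (grad n f x) * u i x ^ 2
              ∂(riemVolume n M))) * Real.sqrt (lam (k + 2))) := by
  have : ProperSpace M := properSpace_of_completeSpace n M
  exact mainTheorem2_general Ω hΩ_open hΩ_bdd.isCompact_closure lam u hu i (k + 1)
    (hik.trans (PNat.lt_add_right k 1)).le
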